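/- **Setting.** For every sample size $n$ let $p=p(n)$ and $n'=n'(n)\ge 1$ be integers with $p/n\to\gamma\in(0,\infty)$. All random objects live on one probability space, with an arbitrary joint law across different $n$; the dependence on $n$ is suppressed. *Training data.* $\mathbf X=\mathbf Q^\top\mathbf D\mathbf O\in\mathbb R^{n\times p}$, where $\mathbf Q\in\mathbb O(n)$ and $\mathbf O\in\mathbb O(p)$ are random orthogonal matrices, $\mathbf D\in\mathbb R^{n\times p}$ is a random rectangular diagonal matrix with nonnegative diagonal entries $D_{ii}$ (with the convention $D_{ii}=0$ for $i>\min(n,p)$), $\mathbf O$ is Haar distributed and independent of $(\mathbf Q,\mathbf D)$. There is a constant $C$ with $\limsup_n\max_i D_{ii}<C$ almost surely. Write $\mathbf o_i$ for the $i$-th row of $\mathbf O$. Let $\mathcal J_a,\mathcal J_c$ be finite sets of indices and $\boldsymbol\alpha=(\alpha_i)_{i\in\mathcal J_a}$ real numbers, all not depending on $n$. The signal is $$\boldsymbol\beta=\boldsymbol\beta'+\sum_{i\in\mathcal J_a}\sqrt n\,\alpha_i\mathbf o_i ,$$ where $\boldsymbol\beta'\in\mathbb R^p$ is fixed, or random and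 independent of $(\mathbf Q,\mathbf D,\mathbf O)$, with $\|\boldsymbol\beta'\|/\sqrt n=r$ for all large $n$. One observes $\mathbf y=\mathbf X\boldsymbol\beta+\boldsymbol\epsilon$, where $\boldsymbol\epsilon\in\mathbb R^n$ is independent of $(\mathbf Q,\mathbf D,\mathbf O,\boldsymbol\beta')$ and has independent entries with mean $0$, variance $\sigma^2$ and, for some $\eta>0$, moments of order $4+\eta$ bounded uniformly in the entry and in $n$. *Test data.* $\tilde{\mathbf X}=\tilde{\mathbf Q}^\top\tilde{\mathbf D}\tilde{\mathbf O}\in\mathbb R^{n'\times p}$, where $\tilde{\mathbf Q}\in\mathbb O(n')$, $\tilde{\mathbf D}\in\mathbb R^{n'\times p}$ is rectangular diagonal with nonnegative diagonal entries; given $(\mathbf Q,\mathbf D,\mathbf O,\boldsymbol\beta',\boldsymbol\epsilon)$, the matrix $\tilde{\mathbf O}$ is Haar distributed on $\mathbb O(p)$ conditioned on $\tilde{\mathbf o}_i=\mathbf o_i$ for all $i\in\mathcal J_c$ (that is, it is uniformly distributed on the set of orthogonal matrices whose rows with index in $\mathcal J_c$ are those of $\mathbf O$); and $(\tilde{\mathbf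 Q},\tilde{\mathbf D})$ is independent of $(\mathbf Q,\mathbf D,\mathbf O,\boldsymbol\beta',\boldsymbol\epsilon,\tilde{\mathbf O})$. Put $\mathfrak d_i^2=\mathbb E[(\tilde{\mathbf D}^\top\tilde{\mathbf D})_{ii}]$ for $1\le i\le p$, assumed finite, and $\mathfrak d_{\mathsf{bulk}}^2=\frac1{p-|\mathcal J_c|}\sum_{i\notin\mathcal J_c}\mathfrak d_i^2$. Assume that $\limsup_n \frac{n}{n'}\big\|\mathbb E[\tilde{\mathbf D}^\top\tilde{\mathbf D}]\big\|_{\mathsf{op}}=\limsup_n \frac{n}{n'}\max_i\mathfrak d_i^2<\infty$. *Estimator and risk.* For $\lambda>0$ let $\hat{\boldsymbol\beta}_\lambda=\arg\min_{\mathbf b}\{\|\mathbf y-\mathbf X\mathbf b\|^2+\lambda\|\mathbf b\|^2\}=(\mathbf X^\top\mathbf X+\lambda\mathbf I)^{-1}\mathbf X^\top\mathbf y$, and let $$R_{\mathbf X,\mathbf y}(\hat{\boldsymbol\beta}_\lambda,\boldsymbol\beta)=\frac1{n'}\,\mathbb E\big[\|\tilde{\mathbf X}\hat{\boldsymbol\beta}_\lambda-\tilde{\mathbf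 X}\boldsymbol\beta\|^2\ \big|\ \mathbf X,\mathbf y,\mathbf O,\boldsymbol\beta\big],$$ the expectation over the test design $\tilde{\mathbf X}$ under its regular conditional distribution given the training data. **Theorem.** For all $0<\lambda_1<\lambda_2<\infty$, $$\sup_{\lambda\in[\lambda_1,\lambda_2]}\Big|R_{\mathbf X,\mathbf y}(\hat{\boldsymbol\beta}_\lambda,\boldsymbol\beta)-\big(\mathcal B_{\mathbf X}(\lambda)+\mathcal V_{\mathbf X}(\lambda)\big)\Big|\xrightarrow[n\to\infty]{a.s.}0,$$ where $$\mathcal B_{\mathbf X}(\lambda)=\frac{\lambda^2}{n'}\sum_{i=1}^p\frac{\big(r^2/\gamma+\mathbf 1(i\in\mathcal J_a)\,n\alpha_i^2\big)\big(\mathfrak d_{\mathsf{bulk}}^2+\mathbf 1(i\in\mathcal J_c)(\mathfrak d_i^2-\mathfrak d_{\mathsf{bulk}}^2)\big)}{(D_{ii}^2+\lambda)^2},$$ $$\mathcal V_{\mathbf X}(\lambda)=\frac{\sigma^2}{n'}\sum_{i=1}^n\frac{D_{ii}^2}{(D_{ii}^2+\lambda)^2}\big(\mathfrak d_{\mathsf{bulk}}^2+\mathbf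 1(i\in\mathcal J_c)(\mathfrak d_i^2-\mathfrak d_{\mathsf{bulk}}^2)\big).$$ -/

import Mathlib

open MeasureTheory ProbabilityTheory Filter Topology Matrix
open scoped ENNReal

/-! ### Measurable structure on real matrices (the Borel structure, entrywise) -/

instance matMeasurableSpace (m k : ℕ) : MeasurableSpace (Matrix (Fin m) (Fin k) ℝ) :=
  inferInstanceAs (MeasurableSpace (Fin m → Fin k → ℝ))

instance matBorelSpace (m k : ℕ) : BorelSpace (Matrix (Fin m) (Fin k) ℝ) :=
  inferInstanceAs (BorelSpace (Fin m → Fin k → ℝ))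

instance matStandardBorelSpace (m k : ℕ) : StandardBorelSpace (Matrix (Fin m) (Fin k) ℝ) :=
  inferInstanceAs (StandardBorelSpace (Fin m → Fin k → ℝ))

/-- The group `𝕆(k)` of orthogonal `k × k` real matrices. -/
abbrev Orth (k : ℕ) : Type := Matrix.orthogonalGroup (Fin k) ℝ

instance orthStandardBorelSpace (k : ℕ) : StandardBorelSpace (Orth k) := by
  have h : IsClosed ((Matrix.orthogonalGroup (Fin k) ℝ : Set (Matrix (Fin k) (Fin k) ℝ))) := by
    have h2 : (Matrix.orthogonalGroup (Fin k) ℝ : Set (Matrix (Fin k) (Fin k) ℝ))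
        = {A | A * Aᵀ = 1} := by
      ext A
      exact Matrix.mem_orthogonalGroup_iff (Fin k) ℝ
    rw [h2]
    exact isClosed_eq (continuous_id.mul continuous_id.matrix_transpose) continuous_const
  exact h.measurableSet.standardBorel

/-- A random orthogonal matrix is Haar distributed: its law is a Haar measure on `𝕆(k)`. -/
def IsHaarDistributed {Ω : Type*} [MeasurableSpace Ω] (P : Measure Ω) {k : ℕ}
    (O : Ω → Orth k) : Prop :=
  (P.map O).IsHaarMeasure

/-- The subgroup of orthogonal matrices that fix the basis vectors `e_j`, `j ∈ J`. -/
def basisStabilizer (k : ℕ) (J : Finset ℕ) : Subgroup (Orth k) where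
  carrier := {U | ∀ j : Fin k, (j : ℕ) ∈ J →
    (U : Matrix (Fin k) (Fin k) ℝ) *ᵥ Pi.single j 1 = Pi.single j 1}
  one_mem' := by
    intro j _
    exact Matrix.one_mulVec _
  mul_mem' := by
    intro U V hU hV j hj
    have h : ((U * V : Orth k) : Matrix (Fin k) (Fin k) ℝ)
        = (U : Matrix (Fin k) (Fin k) ℝ) * (V : Matrix (Fin k) (Fin k) ℝ) := rfl
    rw [h, ← Matrix.mulVec_mulVec, hV j hj, hU j hj]
  inv_mem' := by
    intro U hU j hj
    have h : ((U⁻¹ : Orth k) : Matrix (Fin k) (Fin k) ℝ) * (U : Matrix (Fin k) (Fin k) ℝ) = 1 := by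
      exact congrArg Subtype.val (inv_mul_cancel U)
    conv_lhs => rw [← hU j hj]
    rw [Matrix.mulVec_mulVec, h, Matrix.one_mulVec]

/-- The matrices `U * M` with `U` in the stabilizer are exactly the orthogonal matrices whose
rows with index in `J` coincide with those of `M`. -/
theorem rows_eq_iff_mem_basisStabilizer {k : ℕ} (J : Finset ℕ) (M N : Orth k) :
    (∀ j : Fin k, (j : ℕ) ∈ J → ∀ l : Fin k,
      (N : Matrix (Fin k) (Fin k) ℝ) j l = (M : Matrix (Fin k) (Fin k) ℝ) j l)
      ↔ ∃ U ∈ basisStabilizer k J, N = U * M := by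
  have mc : ∀ A B : Orth k, ((A * B : Orth k) : Matrix (Fin k) (Fin k) ℝ)
      = (A : Matrix (Fin k) (Fin k) ℝ) * (B : Matrix (Fin k) (Fin k) ℝ) := fun _ _ => rfl
  have tr : ∀ A : Orth k, ((A⁻¹ : Orth k) : Matrix (Fin k) (Fin k) ℝ)
      = (A : Matrix (Fin k) (Fin k) ℝ)ᵀ := fun A => Matrix.conjTranspose_eq_transpose_of_trivial _
  have hrow : ∀ (A : Orth k) (j : Fin k), (A : Matrix (Fin k) (Fin k) ℝ) j
      = (A : Matrix (Fin k) (Fin k) ℝ)ᵀ *ᵥ Pi.single j 1 := by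
    intro A j
    rw [Matrix.mulVec_single_one]
    rfl
  have hcancel : ∀ (A : Orth k) (v : Fin k → ℝ), (A : Matrix (Fin k) (Fin k) ℝ) *ᵥ
      ((A : Matrix (Fin k) (Fin k) ℝ)ᵀ *ᵥ v) = v := by
    intro A v
    rw [Matrix.mulVec_mulVec, ← tr, ← mc, mul_inv_cancel]
    exact Matrix.one_mulVec _
  constructor
  · intro h
    refine ⟨N * M⁻¹, ?_, by group⟩
    intro j hj
    have h1 : (M : Matrix (Fin k) (Fin k) ℝ)ᵀ *ᵥ Pi.single j 1
        = (N : Matrix (Fin k) (Fin k) ℝ)ᵀ *ᵥ Pi.single j 1 := by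
      rw [← hrow, ← hrow]
      exact (funext (h j hj)).symm
    rw [mc, tr, ← Matrix.mulVec_mulVec, h1, hcancel]
  · rintro ⟨U, hU, rfl⟩ j hj l
    have h2 := (basisStabilizer k J).inv_mem hU j hj
    rw [tr] at h2
    have h3 : ((U * M : Orth k) : Matrix (Fin k) (Fin k) ℝ) j
        = (M : Matrix (Fin k) (Fin k) ℝ) j := by
      rw [hrow (U * M), mc, Matrix.transpose_mul, ← Matrix.mulVec_mulVec, h2, ← hrow]
    exact congrFun h3 l

/-- "Haar measure on `𝕆(k)` conditioned on the rows `j ∈ J` being equal to those of `M`": the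
uniform distribution on the set `{U * M : U ∈ basisStabilizer k J}` of all orthogonal matrices
whose rows `j ∈ J` are those of `M`; `ν` is the Haar probability measure on the stabilizer. -/
noncomputable def haarGivenRows {k : ℕ} {J : Finset ℕ} (ν : Measure (basisStabilizer k J))
    (M : Orth k) : Measure (Orth k) :=
  ν.map (fun U : basisStabilizer k J => (U : Orth k) * M)

/-- Given the training data `T` (of which `O` is a part), the random matrix `Ot` is Haar
distributed conditioned on its rows `j ∈ J` being equal to those of `O`. -/
def IsHaarCoupled {Ω τ : Type*} [MeasurableSpace Ω] [MeasurableSpace τ]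
    (P : Measure Ω) [IsFiniteMeasure P] {k : ℕ} (J : Finset ℕ)
    (O Ot : Ω → Orth k) (T : Ω → τ) : Prop :=
  ∃ ν : Measure (basisStabilizer k J), ν.IsHaarMeasure ∧ IsProbabilityMeasure ν ∧
    ∀ᵐ ω ∂P, condDistrib Ot T P (T ω) = haarGivenRows ν (O ω)

/-! ### Regression model -/

/-- `D` is a rectangular diagonal matrix with nonnegative entries (singular values). -/
def IsSingularValueMatrix {m k : ℕ} (D : Matrix (Fin m) (Fin k) ℝ) : Prop :=
  (∀ (i : Fin m) (j : Fin k), (i : ℕ) ≠ (j : ℕ) → D i j = 0) ∧ ∀ i j, 0 ≤ D i j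

/-- The diagonal entry `D_ii`, with `D_ii = 0` beyond the range of the matrix. -/
noncomputable def diagEntry {m k : ℕ} (D : Matrix (Fin m) (Fin k) ℝ) (i : ℕ) : ℝ :=
  if h : i < m ∧ i < k then D ⟨i, h.1⟩ ⟨i, h.2⟩ else 0

/-- The design `X = Qᵀ D O`. -/
noncomputable def design {m k : ℕ} (Q : Orth m) (D : Matrix (Fin m) (Fin k) ℝ) (O : Orth k) :
    Matrix (Fin m) (Fin k) ℝ :=
  (Q : Matrix (Fin m) (Fin m) ℝ)ᵀ * D * (O : Matrix (Fin k) (Fin k) ℝ)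

/-- The squared Euclidean norm. -/
def sqNorm {k : ℕ} (v : Fin k → ℝ) : ℝ := ∑ i, v i ^ 2

/-- The aligned signal `β = β' + ∑_{i ∈ J} √n α_i o_i`, where `o_i` is the `i`-th row of `O`. -/
noncomputable def alignedSignal (n : ℕ) {k : ℕ} (J : Finset ℕ) (α : ℕ → ℝ)
    (β' : Fin k → ℝ) (O : Orth k) : Fin k → ℝ :=
  β' + ∑ i : Fin k, if (i : ℕ) ∈ J then
    (Real.sqrt n * α i) • (O : Matrix (Fin k) (Fin k) ℝ) i else 0

/-- The response `y = X β + ε`. -/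
noncomputable def response {m k : ℕ} (X : Matrix (Fin m) (Fin k) ℝ) (β : Fin k → ℝ)
    (ε : Fin m → ℝ) : Fin m → ℝ :=
  X *ᵥ β + ε

/-- The ridge estimator `(Xᵀ X + λ I)⁻¹ Xᵀ y`. -/
noncomputable def ridge {m k : ℕ} (X : Matrix (Fin m) (Fin k) ℝ) (y : Fin m → ℝ) (lam : ℝ) :
    Fin k → ℝ :=
  (Xᵀ * X + lam • (1 : Matrix (Fin k) (Fin k) ℝ))⁻¹ *ᵥ (Xᵀ *ᵥ y)

/-- For `λ > 0` the ridge estimator is the unique minimizer of `‖y - X b‖² + λ ‖b‖²`. -/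
theorem ridge_isArgmin {m k : ℕ} (X : Matrix (Fin m) (Fin k) ℝ) (y : Fin m → ℝ) {lam : ℝ}
    (hlam : 0 < lam) (b : Fin k → ℝ) (hb : b ≠ ridge X y lam) :
    sqNorm (y - X *ᵥ ridge X y lam) + lam * sqNorm (ridge X y lam)
      < sqNorm (y - X *ᵥ b) + lam * sqNorm b := by
  have sq : ∀ {q : ℕ} (v : Fin q → ℝ), sqNorm v = v ⬝ᵥ v := by
    intro q v
    simp [sqNorm, dotProduct, pow_two]
  have sqn : ∀ {q : ℕ} (v : Fin q → ℝ), 0 ≤ sqNorm v := fun v =>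
    Finset.sum_nonneg fun i _ => sq_nonneg (v i)
  have sqp : ∀ {q : ℕ} (v : Fin q → ℝ), v ≠ 0 → 0 < sqNorm v := by
    intro q v hv
    obtain ⟨i, hi⟩ := Function.ne_iff.mp hv
    exact Finset.sum_pos' (fun i _ => sq_nonneg (v i)) ⟨i, Finset.mem_univ i, by
      have : v i ≠ 0 := hi
      positivity⟩
  set A : Matrix (Fin k) (Fin k) ℝ := Xᵀ * X + lam • (1 : Matrix (Fin k) (Fin k) ℝ) with hA
  have hAv : ∀ v, A *ᵥ v = Xᵀ *ᵥ (X *ᵥ v) + lam • v := by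
    intro v
    rw [hA, Matrix.add_mulVec, Matrix.mulVec_mulVec, Matrix.smul_mulVec, Matrix.one_mulVec]
  have adj : ∀ (v : Fin k → ℝ) (w : Fin m → ℝ), v ⬝ᵥ (Xᵀ *ᵥ w) = (X *ᵥ v) ⬝ᵥ w := by
    intro v w
    rw [Matrix.dotProduct_mulVec, Matrix.vecMul_transpose]
  have hunit : IsUnit A.det := by
    rw [← Matrix.isUnit_iff_isUnit_det, ← Matrix.mulVec_injective_iff_isUnit]
    intro v w hvw
    by_contra hne
    have h0 : A *ᵥ (v - w) = 0 := by
      rw [Matrix.mulVec_sub]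
      exact sub_eq_zero.mpr hvw
    have h1 : (v - w) ⬝ᵥ (A *ᵥ (v - w)) = 0 := by rw [h0, dotProduct_zero]
    rw [hAv, dotProduct_add, adj, dotProduct_smul, ← sq, ← sq, smul_eq_mul] at h1
    have h2 := sqn (X *ᵥ (v - w))
    have h3 := mul_pos hlam (sqp (v - w) (sub_ne_zero.mpr hne))
    linarith
  have hnormal : A *ᵥ ridge X y lam = Xᵀ *ᵥ y := by
    rw [ridge, Matrix.mulVec_mulVec, Matrix.mul_nonsing_inv A hunit, Matrix.one_mulVec]
  obtain ⟨c, hc⟩ : ∃ c, ridge X y lam = c := ⟨_, rfl⟩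
  rw [hc] at hb hnormal ⊢
  obtain ⟨d, rfl⟩ : ∃ d, b = c + d := ⟨b - c, by abel⟩
  have hd : d ≠ 0 := by
    rintro rfl
    exact hb (add_zero c)
  have h1 : d ⬝ᵥ (A *ᵥ c) = d ⬝ᵥ (Xᵀ *ᵥ y) := by rw [hnormal]
  rw [hAv, dotProduct_add, adj, adj, dotProduct_smul, smul_eq_mul] at h1
  have h2 := sqn (X *ᵥ d)
  have h3 := mul_pos hlam (sqp d hd)
  have e1 : sqNorm (y - X *ᵥ (c + d)) = sqNorm (y - X *ᵥ c)
      - 2 * ((X *ᵥ d) ⬝ᵥ y - (X *ᵥ d) ⬝ᵥ (X *ᵥ c)) + sqNorm (X *ᵥ d) := by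
    rw [Matrix.mulVec_add]
    simp only [sqNorm, dotProduct, ← Finset.sum_sub_distrib, Finset.mul_sum,
      ← Finset.sum_add_distrib]
    refine Finset.sum_congr rfl fun i _ => ?_
    simp only [Pi.sub_apply, Pi.add_apply]
    ring
  have e2 : sqNorm (c + d) = sqNorm c + 2 * (d ⬝ᵥ c) + sqNorm d := by
    simp only [sqNorm, dotProduct, Finset.mul_sum, ← Finset.sum_add_distrib]
    refine Finset.sum_congr rfl fun i _ => ?_
    simp only [Pi.add_apply]
    ring
  rw [e1, e2]
  nlinarith

/-- The out-of-sample risk `(1/n') E[‖X̃ b̂ - X̃ β‖² | S]`, the expectation being taken under the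
regular conditional distribution of the test design `X̃` given the training data `S`; `b̂` and `β`
are functions of `S`. -/
noncomputable def outOfSampleRisk {Ω τ : Type*} [MeasurableSpace Ω] [MeasurableSpace τ]
    (P : Measure Ω) [IsFiniteMeasure P] {m k : ℕ} (Xt : Ω → Matrix (Fin m) (Fin k) ℝ)
    (S : Ω → τ) (bhat β : Fin k → ℝ) (ω : Ω) : ℝ :=
  (1 / (m : ℝ)) * ∫ M, sqNorm (M *ᵥ bhat - M *ᵥ β) ∂(condDistrib Xt S P (S ω))

/-- `𝔡_i² = E[(D̃ᵀ D̃)_ii]`, for `i < k` (and `0` for other indices). -/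
noncomputable def testSpec {Ω : Type*} [MeasurableSpace Ω] (P : Measure Ω) {m k : ℕ}
    (Dt : Ω → Matrix (Fin m) (Fin k) ℝ) (i : ℕ) : ℝ :=
  if h : i < k then ∫ ω, ((Dt ω)ᵀ * Dt ω) ⟨i, h⟩ ⟨i, h⟩ ∂P else 0

/-- `𝔡_bulk² = (k - |J|)⁻¹ ∑_{i ∉ J} 𝔡_i²`. -/
noncomputable def bulkSpec (k : ℕ) (J : Finset ℕ) (d : ℕ → ℝ) : ℝ :=
  (1 / ((k : ℝ) - (J.card : ℝ))) * ∑ i ∈ Finset.range k \ J, d i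

/-- The bias formula, with `d i = 𝔡_i²`, sample sizes `n` (train) and `n'` (test). -/
noncomputable def biasFormula (n n' : ℕ) {k : ℕ} (D : Matrix (Fin n) (Fin k) ℝ)
    (Ja Jc : Finset ℕ) (α d : ℕ → ℝ) (r γ lam : ℝ) : ℝ :=
  (lam ^ 2 / n') * ∑ i ∈ Finset.range k,
    ((r ^ 2 / γ + if i ∈ Ja then n * α i ^ 2 else 0) *
      (bulkSpec k Jc d + if i ∈ Jc then d i - bulkSpec k Jc d else 0)) /
      (diagEntry D i ^ 2 + lam) ^ 2

/-- The variance formula, with `d i = 𝔡_i²`, sample sizes `n` (train) and `n'` (test). -/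
noncomputable def varFormula (n n' : ℕ) {k : ℕ} (D : Matrix (Fin n) (Fin k) ℝ)
    (Jc : Finset ℕ) (d : ℕ → ℝ) (σ lam : ℝ) : ℝ :=
  (σ ^ 2 / n') * ∑ i ∈ Finset.range n,
    diagEntry D i ^ 2 / (diagEntry D i ^ 2 + lam) ^ 2 *
      (bulkSpec k Jc d + if i ∈ Jc then d i - bulkSpec k Jc d else 0)

/-! ### Moment inequalities for sums and quadratic forms of independent variables -/

section Moments

variable {Ω : Type*} [MeasurableSpace Ω] {P : Measure Ω}

/-! The proof has an exact algebraic part and a probabilistic part.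

Exact part. Given the training data, `Ot = U * O` with `U` Haar on the stabilizer of the coupled
basis vectors. Integrating `U` out leaves the coupled coordinates of the rotated error `O (b̂ - β)`
fixed and spreads the energy of the others evenly over them. Hence the conditional risk equals
`1/n'` times a sum of squared rotated errors with the weights `specWeight`
(`outOfSampleRisk_ae_eq`). In the basis of right singular vectors ridge regression is diagonal: with
`a = O β` and `z = Q ε`, padded to length `p`, the error has coordinates `(-λ a_i + D_ii z_i) /
(D_ii² + λ)` (`orth_mulVec_ridge_sub`). Subtracting bias and variance gives `riskGap`, a sum of the
centred quantities `a_i² - τ_i`, `a_i z_i` and `z_i² - σ²` with coefficients of order `1/n`.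

Probabilistic part. `riskGap_eq` splits the gap, for a fixed penalty, into pieces that vanish
separately. The vector `O β'` is uniform on a sphere; comparison with a Gaussian vector
(`lintegral_homogeneous_orth`) bounds the fourth moments of its centred quadratic forms and of its
coordinates, the latter controlling the interaction with the aligned spikes. The signal-noise
interaction is a linear form in `ε`. The noise energy is a quadratic form in `ε`, split into a
diagonal part, with a moment of order `q > 2` of size `n^(-q/2)`, and an off-diagonal part, with a
fourth moment of size `n^(-2)`. The replacement of `n r² / p` by `r² / γ` is deterministic. All the
random bounds are summable in `n`, so Borel-Cantelli gives almost sure convergence whatever the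
joint law across `n`.

Uniformity in the penalty follows because `riskGap` is eventually Lipschitz in `λ` with a constant
free of `n` (`eventually_abs_riskGap_sub_le`), so that convergence at countably many grid points
suffices (`tendsto_iSup_enorm_of_grid`). -/

theorem integral_sq_mul_sq_le {S L : Ω → ℝ} (hSm : Measurable S)
    (hLm : Measurable L) (hS : Integrable (fun ω => S ω ^ 4) P)
    (hL : Integrable (fun ω => L ω ^ 4) P) {A B : ℝ} (hA : 0 ≤ A) (hB : 0 ≤ B)
    (hSA : ∫ ω, S ω ^ 4 ∂P ≤ A ^ 2) (hLB : ∫ ω, L ω ^ 4 ∂P ≤ B ^ 2) :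
    ∫ ω, S ω ^ 2 * L ω ^ 2 ∂P ≤ A * B := by
  have key : ∀ {S : Ω → ℝ}, Measurable S → Integrable (fun ω => S ω ^ 4) P →
      MemLp (fun ω => S ω ^ 2) (ENNReal.ofReal 2) P := by
    intro S hSm hS
    rw [ENNReal.ofReal_ofNat, memLp_two_iff_integrable_sq (hSm.pow_const 2).aestronglyMeasurable]
    refine hS.congr (Eventually.of_forall fun ω => ?_)
    ring
  have h := integral_mul_le_Lp_mul_Lq_of_nonneg (μ := P) Real.HolderConjugate.two_two
    (f := fun ω => S ω ^ 2) (g := fun ω => L ω ^ 2)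
    (Eventually.of_forall fun ω => sq_nonneg _) (Eventually.of_forall fun ω => sq_nonneg _)
    (key hSm hS) (key hLm hL)
  have e : ∀ S : Ω → ℝ, (∫ ω, (S ω ^ 2) ^ (2 : ℝ) ∂P) = ∫ ω, S ω ^ 4 ∂P := by
    intro S
    congr 1 with ω
    rw [Real.rpow_two]
    ring
  rw [e, e, ← Real.sqrt_eq_rpow, ← Real.sqrt_eq_rpow] at h
  refine h.trans (mul_le_mul ?_ ?_ (Real.sqrt_nonneg _) hA)
  · exact Real.sqrt_le_iff.mpr ⟨hA, hSA⟩
  · exact Real.sqrt_le_iff.mpr ⟨hB, hLB⟩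

theorem integrable_pow_mul_pow {S L : Ω → ℝ} (hSm : Measurable S)
    (hLm : Measurable L) (hS : Integrable (fun ω => S ω ^ 4) P)
    (hL : Integrable (fun ω => L ω ^ 4) P) :
    Integrable (fun ω => S ω ^ 3 * L ω) P ∧ Integrable (fun ω => S ω ^ 2 * L ω ^ 2) P := by
  have h := hS.add hL
  constructor
  · refine h.mono' (by fun_prop) (Eventually.of_forall fun ω => ?_)
    simp only [Real.norm_eq_abs, Pi.add_apply]
    rw [abs_le]
    constructor <;>
    nlinarith [sq_nonneg (S ω ^ 2 - L ω ^ 2), sq_nonneg (S ω * (S ω - L ω)),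
      sq_nonneg (S ω * (S ω + L ω)), sq_nonneg (S ω ^ 2), sq_nonneg (L ω ^ 2)]
  · refine h.mono' (by fun_prop) (Eventually.of_forall fun ω => ?_)
    simp only [Real.norm_eq_abs, Pi.add_apply]
    rw [abs_of_nonneg (by positivity)]
    nlinarith [sq_nonneg (S ω ^ 2 - L ω ^ 2), sq_nonneg (S ω ^ 2), sq_nonneg (L ω ^ 2)]

theorem integral_sq_le_of_fourth [IsProbabilityMeasure P] {e : Ω → ℝ} (hem : Measurable e)
    (he : Integrable (fun ω => e ω ^ 4) P) {K : ℝ} (hK : 1 ≤ K) (hK4 : ∫ ω, e ω ^ 4 ∂P ≤ K) :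
    Integrable (fun ω => e ω ^ 2) P ∧ ∫ ω, e ω ^ 2 ∂P ≤ K := by
  have hint : Integrable (fun ω => (1 + e ω ^ 4) / 2) P := ((integrable_const 1).add he).div_const 2
  have hle : ∀ ω, e ω ^ 2 ≤ (1 + e ω ^ 4) / 2 := fun ω => by nlinarith [sq_nonneg (e ω ^ 2 - 1)]
  have h2 : Integrable (fun ω => e ω ^ 2) P := by
    refine hint.mono' (by fun_prop) (Eventually.of_forall fun ω => ?_)
    rw [Real.norm_eq_abs, abs_of_nonneg (sq_nonneg _)]
    exact hle ω
  refine ⟨h2, (integral_mono h2 hint hle).trans ?_⟩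
  rw [integral_div, integral_add (integrable_const 1) he]
  simp
  linarith

/-- The fourth moment of `S + e L` when `e` is centred and independent of `(S, L)`. -/
theorem fourth_moment_add_mul_le [IsProbabilityMeasure P] {e S L : Ω → ℝ} (hem : Measurable e)
    (hSm : Measurable S) (hLm : Measurable L)
    (hind : IndepFun e (fun ω => (S ω, L ω)) P) (he : Integrable (fun ω => e ω ^ 4) P)
    (h0 : ∫ ω, e ω ∂P = 0) {K : ℝ} (hK : 1 ≤ K) (hK4 : ∫ ω, e ω ^ 4 ∂P ≤ K)
    (hS : Integrable (fun ω => S ω ^ 4) P)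
    (hL : Integrable (fun ω => L ω ^ 4) P) {A B : ℝ} (hA : 0 ≤ A) (hB : 0 ≤ B)
    (hSA : ∫ ω, S ω ^ 4 ∂P ≤ A ^ 2) (hLB : ∫ ω, L ω ^ 4 ∂P ≤ B ^ 2) :
    Integrable (fun ω => (S ω + e ω * L ω) ^ 4) P ∧
      ∫ ω, (S ω + e ω * L ω) ^ 4 ∂P ≤ (A + 4 * K * B) ^ 2 := by
  obtain ⟨he2, hK2⟩ := integral_sq_le_of_fourth hem he hK hK4
  have he1 : Integrable e P := by
    have hint : Integrable (fun ω => 1 + e ω ^ 2) P := (integrable_const 1).add he2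
    refine hint.mono' (by fun_prop) (Eventually.of_forall fun ω => ?_)
    rw [Real.norm_eq_abs, abs_le]
    constructor <;> nlinarith [sq_nonneg (e ω + 1), sq_nonneg (e ω - 1)]
  obtain ⟨h31, h22⟩ := integrable_pow_mul_pow hSm hLm hS hL
  have i1 : IndepFun e (fun ω => S ω ^ 3 * L ω) P :=
    hind.comp measurable_id (φ := id) (ψ := fun x : ℝ × ℝ => x.1 ^ 3 * x.2) (by fun_prop)
  have i2 : IndepFun (fun ω => e ω ^ 2) (fun ω => S ω ^ 2 * L ω ^ 2) P :=
    hind.comp (φ := fun x => x ^ 2) (ψ := fun x : ℝ × ℝ => x.1 ^ 2 * x.2 ^ 2)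
      (by fun_prop) (by fun_prop)
  have i4 : IndepFun (fun ω => e ω ^ 4) (fun ω => L ω ^ 4) P :=
    hind.comp (φ := fun x => x ^ 4) (ψ := fun x : ℝ × ℝ => x.2 ^ 4)
      (by fun_prop) (by fun_prop)
  have j1 : Integrable (fun ω => e ω * (S ω ^ 3 * L ω)) P := i1.integrable_mul he1 h31
  have j2 : Integrable (fun ω => e ω ^ 2 * (S ω ^ 2 * L ω ^ 2)) P := i2.integrable_mul he2 h22
  have j4 : Integrable (fun ω => e ω ^ 4 * L ω ^ 4) P := i4.integrable_mul he hL
  have m1 : ∫ ω, e ω * (S ω ^ 3 * L ω) ∂P = 0 := by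
    rw [i1.integral_fun_mul_eq_mul_integral (by fun_prop) (by fun_prop), h0, zero_mul]
  have m2 : ∫ ω, e ω ^ 2 * (S ω ^ 2 * L ω ^ 2) ∂P ≤ K * (A * B) := by
    rw [i2.integral_fun_mul_eq_mul_integral (by fun_prop) (by fun_prop)]
    exact mul_le_mul hK2 (integral_sq_mul_sq_le hSm hLm hS hL hA hB hSA hLB)
      (integral_nonneg fun ω => by positivity) (by linarith)
  have m4 : ∫ ω, e ω ^ 4 * L ω ^ 4 ∂P ≤ K * B ^ 2 := by
    rw [i4.integral_fun_mul_eq_mul_integral (by fun_prop) (by fun_prop)]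
    exact mul_le_mul hK4 hLB (integral_nonneg fun ω => by positivity) (by linarith)
  have hdom : Integrable (fun ω => S ω ^ 4 + 4 * (e ω * (S ω ^ 3 * L ω))
      + 8 * (e ω ^ 2 * (S ω ^ 2 * L ω ^ 2)) + 3 * (e ω ^ 4 * L ω ^ 4)) P :=
    ((hS.add (j1.const_mul 4)).add (j2.const_mul 8)).add (j4.const_mul 3)
  -- In the binomial expansion the cubic term obeys `4 e³ S L³ ≤ 2 e² S² L² + 2 e⁴ L⁴`, which turns
  -- the coefficients 6 and 1 into 8 and 3. The term linear in `e` is kept exactly, since its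
  -- integral is zero.
  have hle : ∀ ω, (S ω + e ω * L ω) ^ 4 ≤ S ω ^ 4 + 4 * (e ω * (S ω ^ 3 * L ω))
      + 8 * (e ω ^ 2 * (S ω ^ 2 * L ω ^ 2)) + 3 * (e ω ^ 4 * L ω ^ 4) := by
    intro ω
    nlinarith [sq_nonneg (e ω * L ω * (S ω - e ω * L ω))]
  have hint : Integrable (fun ω => (S ω + e ω * L ω) ^ 4) P := by
    refine hdom.mono' (by fun_prop) (Eventually.of_forall fun ω => ?_)
    rw [Real.norm_eq_abs, abs_of_nonneg (by positivity)]
    exact hle ω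
  refine ⟨hint, (integral_mono hint hdom hle).trans ?_⟩
  rw [integral_add (by fun_prop) (by fun_prop), integral_add (by fun_prop) (by fun_prop),
    integral_add (by fun_prop) (by fun_prop), integral_const_mul, integral_const_mul,
    integral_const_mul, m1]
  -- The moments add up to `A² + 8 K A B + 3 K B²`, and `K ≥ 1` completes the square. Bounds written
  -- as squares make the step additive, `A ↦ A + 4 K B`, which is what the inductions below need.
  nlinarith [mul_nonneg hA hB, sq_nonneg B, mul_nonneg (sub_nonneg.mpr hK) (sq_nonneg B),
    mul_nonneg (mul_nonneg (sub_nonneg.mpr hK) (sub_nonneg.mpr hK)) (sq_nonneg B)]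

variable {ι : Type*} {ε : ι → Ω → ℝ}

/-- Variables are added one at a time: a new index `a` contributes `ε a` times the constant `c a`,
and the square root of the bound grows by exactly `4 K (c a)²`. -/
theorem fourth_moment_linear_form_le [IsProbabilityMeasure P] (hm : ∀ i, Measurable (ε i))
    (hind : iIndepFun ε P) (h4 : ∀ i, Integrable (fun ω => ε i ω ^ 4) P)
    (h0 : ∀ i, ∫ ω, ε i ω ∂P = 0) {K : ℝ} (hK : 1 ≤ K) (hK4 : ∀ i, ∫ ω, ε i ω ^ 4 ∂P ≤ K)
    (c : ι → ℝ) (s : Finset ι) :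
    Integrable (fun ω => (∑ i ∈ s, c i * ε i ω) ^ 4) P ∧
      ∫ ω, (∑ i ∈ s, c i * ε i ω) ^ 4 ∂P ≤ (4 * K * ∑ i ∈ s, c i ^ 2) ^ 2 := by
  classical
  induction s using Finset.induction with
  | empty => simp
  | insert a s ha ih =>
    have hsm : Measurable (fun ω => ∑ i ∈ s, c i * ε i ω) :=
      Finset.measurable_fun_sum s fun i _ => (hm i).const_mul _
    have hi : IndepFun (ε a) (fun ω => ((∑ i ∈ s, c i * ε i ω), c a)) P := by
      have h := hind.indepFun_finset {a} s (by simpa using ha) hm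
      have hφ : Measurable (fun x : (({a} : Finset ι) → ℝ) => x ⟨a, by simp⟩) :=
        measurable_pi_apply _
      have h2 := h.comp (φ := fun x : (({a} : Finset ι) → ℝ) => x ⟨a, by simp⟩)
        (ψ := fun x : s → ℝ => ((∑ i : s, c i * x i), c a)) hφ (by fun_prop)
      convert h2 using 1
      · rfl
      funext ω
      refine Prod.ext ?_ rfl
      exact (Finset.sum_coe_sort s fun i => c i * ε i ω).symm
    have h := fourth_moment_add_mul_le (hm a) hsm measurable_const hi (h4 a) (h0 a) hK (hK4 a)
      ih.1 (integrable_const _) (A := 4 * K * ∑ i ∈ s, c i ^ 2) (B := c a ^ 2)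
      (mul_nonneg (by linarith) (Finset.sum_nonneg fun i _ => sq_nonneg _)) (sq_nonneg _)
      ih.2 (by simp; nlinarith)
    have e1 : ∀ ω, ∑ i ∈ insert a s, c i * ε i ω = (∑ i ∈ s, c i * ε i ω) + ε a ω * c a := by
      intro ω
      rw [Finset.sum_insert ha]
      ring
    have e2 : 4 * K * ∑ i ∈ insert a s, c i ^ 2
        = 4 * K * (∑ i ∈ s, c i ^ 2) + 4 * K * c a ^ 2 := by
      rw [Finset.sum_insert ha]
      ring
    simp only [e1, e2]
    exact h

/-- Since the diagonal vanishes, a new index `a` adds `ε a` times a linear form in the earlier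
variables, of which `ε a` is independent. The linear form costs `8 K` and the multiplication by `ε
a` another `4 K`, whence `32 K²`. -/
theorem fourth_moment_offDiag_form_le [IsProbabilityMeasure P] (hm : ∀ i, Measurable (ε i))
    (hind : iIndepFun ε P) (h4 : ∀ i, Integrable (fun ω => ε i ω ^ 4) P)
    (h0 : ∀ i, ∫ ω, ε i ω ∂P = 0) {K : ℝ} (hK : 1 ≤ K) (hK4 : ∀ i, ∫ ω, ε i ω ^ 4 ∂P ≤ K)
    (M : ι → ι → ℝ) (hM : ∀ i, M i i = 0) (s : Finset ι) :
    Integrable (fun ω => (∑ i ∈ s, ∑ j ∈ s, M i j * (ε i ω * ε j ω)) ^ 4) P ∧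
      ∫ ω, (∑ i ∈ s, ∑ j ∈ s, M i j * (ε i ω * ε j ω)) ^ 4 ∂P
        ≤ (32 * K ^ 2 * ∑ i ∈ s, ∑ j ∈ s, M i j ^ 2) ^ 2 := by
  classical
  induction s using Finset.induction with
  | empty => simp
  | insert a s ha ih =>
    have hsm : Measurable (fun ω => ∑ i ∈ s, ∑ j ∈ s, M i j * (ε i ω * ε j ω)) :=
      Finset.measurable_fun_sum s fun i _ => Finset.measurable_fun_sum s fun j _ =>
        ((hm i).mul (hm j)).const_mul _
    have hlm : Measurable (fun ω => ∑ j ∈ s, (M a j + M j a) * ε j ω) :=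
      Finset.measurable_fun_sum s fun i _ => (hm i).const_mul _
    have hi : IndepFun (ε a) (fun ω => ((∑ i ∈ s, ∑ j ∈ s, M i j * (ε i ω * ε j ω)),
        ∑ j ∈ s, (M a j + M j a) * ε j ω)) P := by
      have h := hind.indepFun_finset {a} s (by simpa using ha) hm
      have hφ : Measurable (fun x : (({a} : Finset ι) → ℝ) => x ⟨a, by simp⟩) :=
        measurable_pi_apply _
      have h2 := h.comp (φ := fun x : (({a} : Finset ι) → ℝ) => x ⟨a, by simp⟩)
        (ψ := fun x : s → ℝ => ((∑ i : s, ∑ j : s, M i j * (x i * x j)),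
          ∑ j : s, (M a j + M j a) * x j)) hφ (by fun_prop)
      convert h2 using 1
      · rfl
      funext ω
      refine Prod.ext ?_ ?_ <;> simp only [Function.comp]
      · rw [← Finset.sum_coe_sort s]
        refine Finset.sum_congr rfl fun i _ => ?_
        exact (Finset.sum_coe_sort s fun j => M i j * (ε i ω * ε j ω)).symm
      · exact (Finset.sum_coe_sort s fun j => (M a j + M j a) * ε j ω).symm
    obtain ⟨l1, l2⟩ := fourth_moment_linear_form_le hm hind h4 h0 hK hK4
      (fun j => M a j + M j a) s
    have hB : 4 * K * ∑ j ∈ s, (M a j + M j a) ^ 2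
        ≤ 8 * K * ∑ j ∈ s, (M a j ^ 2 + M j a ^ 2) := by
      rw [show 8 * K * ∑ j ∈ s, (M a j ^ 2 + M j a ^ 2)
        = 4 * K * ∑ j ∈ s, 2 * (M a j ^ 2 + M j a ^ 2) by rw [← Finset.mul_sum]; ring]
      refine mul_le_mul_of_nonneg_left (Finset.sum_le_sum fun j _ => ?_) (by linarith)
      nlinarith [sq_nonneg (M a j - M j a)]
    have hB0 : 0 ≤ 4 * K * ∑ j ∈ s, (M a j + M j a) ^ 2 :=
      mul_nonneg (by linarith) (Finset.sum_nonneg fun j _ => sq_nonneg _)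
    have h := fourth_moment_add_mul_le (hm a) hsm hlm hi (h4 a) (h0 a) hK (hK4 a)
      ih.1 l1 (A := 32 * K ^ 2 * ∑ i ∈ s, ∑ j ∈ s, M i j ^ 2)
      (B := 8 * K * ∑ j ∈ s, (M a j ^ 2 + M j a ^ 2))
      (mul_nonneg (by positivity) (Finset.sum_nonneg fun i _ => Finset.sum_nonneg
        fun j _ => sq_nonneg _)) (hB0.trans hB)
      ih.2 (l2.trans (pow_le_pow_left₀ hB0 hB 2))
    have e1 : ∀ ω, ∑ i ∈ insert a s, ∑ j ∈ insert a s, M i j * (ε i ω * ε j ω)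
        = (∑ i ∈ s, ∑ j ∈ s, M i j * (ε i ω * ε j ω))
          + ε a ω * ∑ j ∈ s, (M a j + M j a) * ε j ω := by
      intro ω
      simp only [Finset.sum_insert ha, Finset.sum_add_distrib, hM, Finset.mul_sum, add_mul,
        mul_add]
      have : ∀ x y : ι → ℝ, (∀ i, x i = y i) → ∑ i ∈ s, x i = ∑ i ∈ s, y i :=
        fun x y h => Finset.sum_congr rfl fun i _ => h i
      rw [this (fun j => M a j * (ε a ω * ε j ω)) (fun j => ε a ω * (M a j * ε j ω))
        (fun j => by ring), this (fun j => M j a * (ε j ω * ε a ω))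
        (fun j => ε a ω * (M j a * ε j ω)) (fun j => by ring)]
      ring
    have e2 : 32 * K ^ 2 * ∑ i ∈ insert a s, ∑ j ∈ insert a s, M i j ^ 2
        = 32 * K ^ 2 * (∑ i ∈ s, ∑ j ∈ s, M i j ^ 2)
          + 4 * K * (8 * K * ∑ j ∈ s, (M a j ^ 2 + M j a ^ 2)) := by
      simp only [Finset.sum_insert ha, Finset.sum_add_distrib, hM]
      ring
    simp only [e1, e2]
    exact h

/-- A second order Taylor bound with the exact linear coefficient `q`, as that term disappears after
integration. For `|x| ≤ 1` one factors out `(1 + x)²` and applies Bernoulli's inequality to the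
exponent `q - 2` in `[0, 1]`; for `x ≥ 1` the constant is `2^q ≤ 8`. -/
theorem abs_one_add_rpow_le {q : ℝ} (hq2 : 2 ≤ q) (hq3 : q ≤ 3) (x : ℝ) :
    |1 + x| ^ q ≤ 1 + q * x + 8 * (x ^ 2 + |x| ^ q) := by
  have hxq : 0 ≤ |x| ^ q := Real.rpow_nonneg (abs_nonneg x) q
  rcases le_total x (-1) with h | h
  · have h1 : |1 + x| ≤ |x| := by
      rw [abs_of_nonpos (by linarith), abs_of_nonpos (by linarith)]
      linarith
    have h2 : |1 + x| ^ q ≤ |x| ^ q := Real.rpow_le_rpow (abs_nonneg _) h1 (by linarith)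
    nlinarith
  · rcases le_total x 1 with h' | h'
    · have h0 : 0 ≤ 1 + x := by linarith
      rw [abs_of_nonneg h0]
      have e : (1 + x) ^ q = (1 + x) ^ 2 * (1 + x) ^ (q - 2) := by
        rw [← Real.rpow_two, ← Real.rpow_add_of_nonneg h0 (by norm_num) (by linarith)]
        congr 1
        ring
      have hb := rpow_one_add_le_one_add_mul_self h (p := q - 2) (by linarith) (by linarith)
      have h3 : (1 + x) ^ q ≤ (1 + x) ^ 2 * (1 + (q - 2) * x) := by
        rw [e]
        exact mul_le_mul_of_nonneg_left hb (sq_nonneg _)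
      have h4 : (q - 2) * x ^ 3 ≤ x ^ 2 := by
        have h5 : (q - 2) * x ≤ 1 := by nlinarith
        nlinarith [sq_nonneg x]
      nlinarith [sq_nonneg x]
    · have h1 : |1 + x| ≤ 2 * |x| := by
        rw [abs_of_nonneg (by linarith), abs_of_nonneg (by linarith)]
        linarith
      have h2 : |1 + x| ^ q ≤ (2 * |x|) ^ q := Real.rpow_le_rpow (abs_nonneg _) h1 (by linarith)
      rw [Real.mul_rpow (by norm_num) (abs_nonneg x)] at h2
      have h3 : (2 : ℝ) ^ q ≤ 8 := by
        calc (2 : ℝ) ^ q ≤ 2 ^ (3 : ℝ) := Real.rpow_le_rpow_of_exponent_le (by norm_num) hq3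
          _ = 8 := by norm_num
      nlinarith [mul_le_mul_of_nonneg_right h3 hxq]

theorem abs_add_rpow_le {q : ℝ} (hq2 : 2 ≤ q) (hq3 : q ≤ 3) (a b : ℝ) :
    |a + b| ^ q ≤ |a| ^ q + q * (a * |a| ^ (q - 2) * b) + 8 * (|a| ^ (q - 2) * b ^ 2 + |b| ^ q) := by
  rcases eq_or_ne a 0 with rfl | ha
  · have : 0 ≤ |b| ^ q := Real.rpow_nonneg (abs_nonneg b) q
    have h2 : 0 ≤ |(0 : ℝ)| ^ (q - 2) * b ^ 2 := by positivity
    have h3 : 0 ≤ |(0 : ℝ)| ^ q := by positivity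
    rw [zero_add]
    linarith
  · have hpos : 0 < |a| := abs_pos.mpr ha
    have h := mul_le_mul_of_nonneg_left (abs_one_add_rpow_le hq2 hq3 (b / a))
      (Real.rpow_nonneg hpos.le q)
    have e1 : |a| ^ q * |1 + b / a| ^ q = |a + b| ^ q := by
      rw [← Real.mul_rpow hpos.le (abs_nonneg _), ← abs_mul]
      congr 2
      field_simp
    have e2 : |a| ^ q * |b / a| ^ q = |b| ^ q := by
      rw [← Real.mul_rpow hpos.le (abs_nonneg _), ← abs_mul]
      congr 2
      field_simp
    have e3 : |a| ^ q = |a| ^ (q - 2) * a ^ 2 := by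
      rw [← sq_abs a, ← Real.rpow_two, ← Real.rpow_add hpos]
      congr 1
      ring
    have e4 : |a| ^ q * (b / a) = a * |a| ^ (q - 2) * b := by
      rw [e3]
      field_simp
    have e5 : |a| ^ q * (b / a) ^ 2 = |a| ^ (q - 2) * b ^ 2 := by
      rw [e3]
      field_simp
    rw [e1] at h
    calc |a + b| ^ q ≤ _ := h
      _ = |a| ^ q + q * (|a| ^ q * (b / a)) + 8 * (|a| ^ q * (b / a) ^ 2 + |a| ^ q * |b / a| ^ q) := by
        ring
      _ = _ := by rw [e2, e4, e5]

end Moments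

/-! ### Moments of order between 2 and 3 of sums of independent variables. -/

section SumMoments

variable {Ω : Type*} [MeasurableSpace Ω] {P : Measure Ω}

theorem mul_rpow_sub_two_le {q t : ℝ} (hq : 2 ≤ q) (ht : 0 ≤ t) : t * t ^ (q - 2) ≤ 1 + t ^ q := by
  have h0 : 0 ≤ t ^ (q - 2) := Real.rpow_nonneg ht _
  rcases le_total t 1 with h | h
  · have h1 : t ^ (q - 2) ≤ 1 := Real.rpow_le_one ht h (by linarith)
    have h2 : 0 ≤ t ^ q := Real.rpow_nonneg ht _
    nlinarith
  · have e : t ^ q = t ^ (q - 2) * t ^ 2 := by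
      rw [← Real.rpow_two, ← Real.rpow_add (by linarith)]
      congr 1
      ring
    rw [e]
    nlinarith [mul_le_mul_of_nonneg_left (show t ≤ t ^ 2 by nlinarith) h0]

/-- With `x = t² / n` this is `x^((q-2)/2) ≤ 1 + x`, the exponent lying in `[0, 1]`. Integrated, it
replaces Jensen's inequality: a second moment of order `n` gives a moment of order `q - 2` of size
`n^((q-2)/2)`. -/
theorem abs_rpow_sub_two_le {q n : ℝ} (hq2 : 2 ≤ q) (hq3 : q ≤ 3) (hn : 0 < n) (t : ℝ) :
    |t| ^ (q - 2) ≤ n ^ ((q - 2) / 2) * (1 + t ^ 2 / n) := by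
  have hx : 0 ≤ t ^ 2 / n := by positivity
  have e : |t| ^ (q - 2) = n ^ ((q - 2) / 2) * (t ^ 2 / n) ^ ((q - 2) / 2) := by
    rw [← Real.mul_rpow hn.le hx, mul_div_cancel₀ _ hn.ne', ← sq_abs, ← Real.rpow_two,
      ← Real.rpow_mul (abs_nonneg t)]
    congr 1
    ring
  rw [e]
  refine mul_le_mul_of_nonneg_left ?_ (Real.rpow_nonneg hn.le _)
  rcases le_total (t ^ 2 / n) 1 with h | h
  · exact (Real.rpow_le_one hx h (by linarith)).trans (by linarith)
  · calc (t ^ 2 / n) ^ ((q - 2) / 2) ≤ (t ^ 2 / n) ^ (1 : ℝ) :=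
          Real.rpow_le_rpow_of_exponent_le h (by linarith)
      _ ≤ _ := by rw [Real.rpow_one]; linarith

/-- One step of a random walk: the first order term of `abs_add_rpow_le` integrates to zero by
independence, and the second order term costs `n^((q-2)/2)`. About `n` such steps give the expected
growth `n^(q/2)`. -/
theorem integral_abs_add_rpow_le [IsProbabilityMeasure P] {S X : Ω → ℝ} (hSm : Measurable S)
    (hXm : Measurable X) (hi : IndepFun S X P) (h0 : ∫ ω, X ω ∂P = 0)
    {q K A n : ℝ} (hq2 : 2 ≤ q) (hq3 : q ≤ 3) (hK : 0 ≤ K) (hn : 1 ≤ n)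
    (hX2 : Integrable (fun ω => X ω ^ 2) P) (hX2K : ∫ ω, X ω ^ 2 ∂P ≤ K)
    (hXq : Integrable (fun ω => |X ω| ^ q) P) (hXqK : ∫ ω, |X ω| ^ q ∂P ≤ K)
    (hS2 : Integrable (fun ω => S ω ^ 2) P) (hS2K : ∫ ω, S ω ^ 2 ∂P ≤ n * K)
    (hSq : Integrable (fun ω => |S ω| ^ q) P) (hSqA : ∫ ω, |S ω| ^ q ∂P ≤ A) :
    Integrable (fun ω => |S ω + X ω| ^ q) P ∧
      ∫ ω, |S ω + X ω| ^ q ∂P ≤ A + 8 * K * (2 + K) * n ^ ((q - 2) / 2) := by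
  have hn0 : (0 : ℝ) < n := by linarith
  have hq20 : 0 ≤ q - 2 := by linarith
  have hq00 : 0 ≤ q := by linarith
  have hnθ : 1 ≤ n ^ ((q - 2) / 2) := Real.one_le_rpow hn (by linarith)
  have hX1 : Integrable X P := by
    have hint : Integrable (fun ω => 1 + X ω ^ 2) P := (integrable_const 1).add hX2
    refine hint.mono' (by fun_prop) (Eventually.of_forall fun ω => ?_)
    rw [Real.norm_eq_abs, abs_le]
    constructor <;> nlinarith [sq_nonneg (X ω + 1), sq_nonneg (X ω - 1)]
  have hψ : Integrable (fun ω => S ω * |S ω| ^ (q - 2)) P := by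
    have hint : Integrable (fun ω => 1 + |S ω| ^ q) P := (integrable_const 1).add hSq
    refine hint.mono' (by fun_prop) (Eventually.of_forall fun ω => ?_)
    rw [Real.norm_eq_abs, abs_mul, abs_of_nonneg (Real.rpow_nonneg (abs_nonneg _) (q - 2))]
    exact mul_rpow_sub_two_le hq2 (abs_nonneg _)
  have hdom : Integrable (fun ω => n ^ ((q - 2) / 2) * (1 + S ω ^ 2 / n)) P :=
    ((integrable_const 1).add (hS2.div_const n)).const_mul _
  have hφ : Integrable (fun ω => |S ω| ^ (q - 2)) P := by
    refine hdom.mono' (by fun_prop) (Eventually.of_forall fun ω => ?_)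
    rw [Real.norm_eq_abs, abs_of_nonneg (Real.rpow_nonneg (abs_nonneg _) (q - 2))]
    exact abs_rpow_sub_two_le hq2 hq3 hn0 _
  have hφK : ∫ ω, |S ω| ^ (q - 2) ∂P ≤ n ^ ((q - 2) / 2) * (1 + K) := by
    refine (integral_mono hφ hdom fun ω => abs_rpow_sub_two_le hq2 hq3 hn0 (S ω)).trans ?_
    rw [integral_const_mul, integral_add (integrable_const 1) (hS2.div_const n), integral_div]
    refine mul_le_mul_of_nonneg_left ?_ (by linarith)
    have : (∫ ω, S ω ^ 2 ∂P) / n ≤ K := by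
      rw [div_le_iff₀ hn0]
      linarith
    simpa using this
  have i1 : IndepFun (fun ω => S ω * |S ω| ^ (q - 2)) X P :=
    hi.comp (φ := fun x : ℝ => x * |x| ^ (q - 2)) (ψ := id) (by fun_prop) measurable_id
  have i2 : IndepFun (fun ω => |S ω| ^ (q - 2)) (fun ω => X ω ^ 2) P :=
    hi.comp (φ := fun x : ℝ => |x| ^ (q - 2)) (ψ := fun x => x ^ 2) (by fun_prop) (by fun_prop)
  have j1 : Integrable (fun ω => S ω * |S ω| ^ (q - 2) * X ω) P := i1.integrable_mul hψ hX1
  have j2 : Integrable (fun ω => |S ω| ^ (q - 2) * X ω ^ 2) P := i2.integrable_mul hφ hX2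
  have m1 : ∫ ω, S ω * |S ω| ^ (q - 2) * X ω ∂P = 0 := by
    rw [i1.integral_fun_mul_eq_mul_integral (by fun_prop) (by fun_prop), h0, mul_zero]
  have m2 : ∫ ω, |S ω| ^ (q - 2) * X ω ^ 2 ∂P ≤ n ^ ((q - 2) / 2) * (1 + K) * K := by
    rw [i2.integral_fun_mul_eq_mul_integral (by fun_prop) (by fun_prop)]
    exact mul_le_mul hφK hX2K (integral_nonneg fun ω => sq_nonneg _) (by positivity)
  have hR : Integrable (fun ω => |S ω| ^ q + q * (S ω * |S ω| ^ (q - 2) * X ω)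
      + 8 * (|S ω| ^ (q - 2) * X ω ^ 2 + |X ω| ^ q)) P :=
    (hSq.add (j1.const_mul q)).add ((j2.add hXq).const_mul 8)
  have hle := fun ω => abs_add_rpow_le hq2 hq3 (S ω) (X ω)
  have hint : Integrable (fun ω => |S ω + X ω| ^ q) P := by
    refine hR.mono' (by fun_prop) (Eventually.of_forall fun ω => ?_)
    rw [Real.norm_eq_abs, abs_of_nonneg (Real.rpow_nonneg (abs_nonneg _) _)]
    exact hle ω
  refine ⟨hint, (integral_mono hint hR hle).trans ?_⟩
  rw [integral_add (by fun_prop) (by fun_prop), integral_add hSq (j1.const_mul q),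
    integral_const_mul, integral_const_mul, integral_add j2 hXq, m1]
  nlinarith [mul_le_mul_of_nonneg_left hnθ hK]

/-- The `q`-th absolute moment, `2 ≤ q ≤ 3`, of a sum of independent centred variables. -/
theorem integral_abs_sum_rpow_le [IsProbabilityMeasure P] {ι : Type*} {Z : ι → Ω → ℝ}
    (hm : ∀ i, Measurable (Z i)) (hind : iIndepFun Z P) (h0 : ∀ i, ∫ ω, Z i ω ∂P = 0)
    {q K : ℝ} (hq2 : 2 ≤ q) (hq3 : q ≤ 3) (hK : 0 ≤ K)
    (h2 : ∀ i, Integrable (fun ω => Z i ω ^ 2) P) (h2K : ∀ i, ∫ ω, Z i ω ^ 2 ∂P ≤ K)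
    (hq : ∀ i, Integrable (fun ω => |Z i ω| ^ q) P) (hqK : ∀ i, ∫ ω, |Z i ω| ^ q ∂P ≤ K)
    {n : ℝ} (hn : 1 ≤ n) (s : Finset ι) (hs : (s.card : ℝ) ≤ n) :
    (Integrable (fun ω => (∑ i ∈ s, Z i ω) ^ 2) P ∧ ∫ ω, (∑ i ∈ s, Z i ω) ^ 2 ∂P ≤ s.card * K) ∧
    Integrable (fun ω => |∑ i ∈ s, Z i ω| ^ q) P ∧
      ∫ ω, |∑ i ∈ s, Z i ω| ^ q ∂P ≤ s.card * (8 * K * (2 + K) * n ^ ((q - 2) / 2)) := by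
  classical
  have hq0 : q ≠ 0 := by linarith
  induction s using Finset.induction with
  | empty => simp [Real.zero_rpow hq0]
  | insert a s ha ih =>
    have hcard : ((insert a s).card : ℝ) = s.card + 1 := by
      rw [Finset.card_insert_of_notMem ha]
      push_cast
      ring
    rw [hcard] at hs
    obtain ⟨⟨s2, s2K⟩, sq, sqK⟩ := ih (by linarith)
    have hsm : Measurable (fun ω => ∑ i ∈ s, Z i ω) := Finset.measurable_fun_sum s fun i _ => hm i
    have hi : IndepFun (fun ω => ∑ i ∈ s, Z i ω) (Z a) P := by
      have h := hind.indepFun_finsetSum_of_notMem hm ha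
      convert h using 1
      ext ω
      simp
    have e1 : ∀ ω, ∑ i ∈ insert a s, Z i ω = (∑ i ∈ s, Z i ω) + Z a ω := by
      intro ω
      rw [Finset.sum_insert ha, add_comm]
    simp only [e1, hcard]
    -- The second moment travels through the induction because each step needs it to be at most `n
    -- K`; this is where the cardinality bound enters.
    have hstep := integral_abs_add_rpow_le hsm (hm a) hi (h0 a) hq2 hq3 hK hn (h2 a) (h2K a)
      (hq a) (hqK a) s2 (s2K.trans (mul_le_mul_of_nonneg_right (by linarith) hK)) sq sqK
    refine ⟨?_, hstep.1, hstep.2.trans (by ring_nf; rfl)⟩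
    have L2 : ∀ {f : Ω → ℝ}, Measurable f → Integrable (fun ω => f ω ^ 2) P → Integrable f P :=
      fun hf h => ((memLp_two_iff_integrable_sq hf.aestronglyMeasurable).mpr h).integrable (by simp)
    have jm : Integrable (fun ω => (∑ i ∈ s, Z i ω) * Z a ω) P :=
      hi.integrable_mul (L2 hsm s2) (L2 (hm a) (h2 a))
    have e2 : ∀ ω, ((∑ i ∈ s, Z i ω) + Z a ω) ^ 2
        = (∑ i ∈ s, Z i ω) ^ 2 + 2 * ((∑ i ∈ s, Z i ω) * Z a ω) + Z a ω ^ 2 := fun ω => by ring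
    simp only [e2]
    refine ⟨(s2.add (jm.const_mul 2)).add (h2 a), ?_⟩
    rw [integral_add (by fun_prop) (h2 a), integral_add s2 (jm.const_mul 2),
      integral_const_mul, hi.integral_fun_mul_eq_mul_integral (by fun_prop) (by fun_prop), h0 a]
    linarith [h2K a]

end SumMoments

/-! ### Orthogonal matrices acting on vectors -/

section OrthAction

variable {k : ℕ}

theorem orth_coe_mul (A B : Orth k) : ((A * B : Orth k) : Matrix (Fin k) (Fin k) ℝ)
    = (A : Matrix (Fin k) (Fin k) ℝ) * (B : Matrix (Fin k) (Fin k) ℝ) := rfl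

theorem orth_coe_inv (A : Orth k) : ((A⁻¹ : Orth k) : Matrix (Fin k) (Fin k) ℝ)
    = (A : Matrix (Fin k) (Fin k) ℝ)ᵀ := Matrix.conjTranspose_eq_transpose_of_trivial _

theorem orth_transpose_mul (A : Orth k) : (A : Matrix (Fin k) (Fin k) ℝ)ᵀ
    * (A : Matrix (Fin k) (Fin k) ℝ) = 1 := by
  rw [← orth_coe_inv, ← orth_coe_mul, inv_mul_cancel]
  rfl

theorem orth_mul_transpose (A : Orth k) : (A : Matrix (Fin k) (Fin k) ℝ)
    * (A : Matrix (Fin k) (Fin k) ℝ)ᵀ = 1 := by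
  rw [← orth_coe_inv, ← orth_coe_mul, mul_inv_cancel]
  rfl

theorem sqNorm_eq_dotProduct (v : Fin k → ℝ) : sqNorm v = v ⬝ᵥ v := by
  simp [sqNorm, dotProduct, pow_two]

theorem sqNorm_nonneg (v : Fin k → ℝ) : 0 ≤ sqNorm v :=
  Finset.sum_nonneg fun i _ => sq_nonneg (v i)

theorem sqNorm_smul (t : ℝ) (v : Fin k → ℝ) : sqNorm (t • v) = t ^ 2 * sqNorm v := by
  simp [sqNorm, Finset.mul_sum, mul_pow]

theorem measurable_sqNorm : Measurable (sqNorm : (Fin k → ℝ) → ℝ) := by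
  unfold sqNorm
  fun_prop

theorem sqNorm_mulVec_of_transpose_mul {m : ℕ} {A : Matrix (Fin m) (Fin k) ℝ} (hA : Aᵀ * A = 1)
    (v : Fin k → ℝ) : sqNorm (A *ᵥ v) = sqNorm v := by
  rw [sqNorm_eq_dotProduct, Matrix.dotProduct_mulVec, ← Matrix.mulVec_transpose,
    Matrix.mulVec_mulVec, hA, Matrix.one_mulVec, ← sqNorm_eq_dotProduct]

theorem sqNorm_orth_mulVec (A : Orth k) (v : Fin k → ℝ) :
    sqNorm ((A : Matrix (Fin k) (Fin k) ℝ) *ᵥ v) = sqNorm v :=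
  sqNorm_mulVec_of_transpose_mul (orth_transpose_mul A) v

theorem measurable_mulVec_uncurry {m : ℕ} :
    Measurable (fun x : Matrix (Fin m) (Fin k) ℝ × (Fin k → ℝ) => x.1 *ᵥ x.2) :=
  (Continuous.matrix_mulVec continuous_fst continuous_snd).measurable

/-- The Householder reflection along `x - y` maps `x` to `y` when the norms agree, so the orthogonal
group is transitive on spheres. -/
theorem exists_orth_mulVec_eq {x y : Fin k → ℝ} (h : sqNorm x = sqNorm y) :
    ∃ V : Orth k, (V : Matrix (Fin k) (Fin k) ℝ) *ᵥ x = y := by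
  rcases eq_or_ne x y with rfl | hne
  · exact ⟨1, Matrix.one_mulVec _⟩
  · obtain ⟨u, hu⟩ : ∃ u, u = x - y := ⟨_, rfl⟩
    have hu0 : u ⬝ᵥ u ≠ 0 := by
      rw [Ne, dotProduct_self_eq_zero, hu]
      exact sub_ne_zero.mpr hne
    have hux : u ⬝ᵥ u = 2 * (u ⬝ᵥ x) := by
      rw [sqNorm_eq_dotProduct, sqNorm_eq_dotProduct] at h
      rw [hu, dotProduct_sub, sub_dotProduct, sub_dotProduct, dotProduct_comm x y]
      linarith
    have hT : (1 - (2 / (u ⬝ᵥ u)) • vecMulVec u u)ᵀ = 1 - (2 / (u ⬝ᵥ u)) • vecMulVec u u := by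
      rw [Matrix.transpose_sub, Matrix.transpose_smul, Matrix.transpose_one,
        Matrix.transpose_vecMulVec]
    have hsq : (1 - (2 / (u ⬝ᵥ u)) • vecMulVec u u) * (1 - (2 / (u ⬝ᵥ u)) • vecMulVec u u) = 1 := by
      have e : vecMulVec u u * vecMulVec u u = (u ⬝ᵥ u) • vecMulVec u u := by
        rw [vecMulVec_mul_vecMulVec]
        ext i j
        simp [vecMulVec_apply]
        ring
      rw [sub_mul, mul_sub, mul_sub, one_mul, one_mul, mul_one, smul_mul_assoc, mul_smul_comm, e,
        smul_smul, smul_smul, mul_assoc, div_mul_cancel₀ _ hu0]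
      module
    refine ⟨⟨1 - (2 / (u ⬝ᵥ u)) • vecMulVec u u, ?_⟩, ?_⟩
    · rw [Matrix.mem_orthogonalGroup_iff]
      show _ * (1 - (2 / (u ⬝ᵥ u)) • vecMulVec u u)ᵀ = 1
      rw [hT, hsq]
    · simp only
      rw [Matrix.sub_mulVec, Matrix.one_mulVec, Matrix.smul_mulVec, vecMulVec_mulVec]
      ext i
      have hui : u i = x i - y i := by rw [hu]; rfl
      have h2 : 2 / (u ⬝ᵥ u) * (u ⬝ᵥ x) = 1 := by
        field_simp
        rw [hux]
      simp only [Pi.sub_apply, Pi.smul_apply, MulOpposite.smul_eq_mul_unop, MulOpposite.unop_op,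
        smul_eq_mul]
      linear_combination hui * (-1) - (u i) * h2

theorem measurable_orth_mulVec :
    Measurable (fun z : Orth k × (Fin k → ℝ) => (z.1 : Matrix (Fin k) (Fin k) ℝ) *ᵥ z.2) :=
  measurable_mulVec_uncurry.comp
    ((measurable_subtype_coe.comp measurable_fst).prodMk measurable_snd)

end OrthAction

/-! ### Moments of uniformly distributed points of the sphere -/

section Sphere

variable {k : ℕ}

/-- The standard Gaussian measure on `Fin k → ℝ`. -/
noncomputable def gaussVec (k : ℕ) : Measure (Fin k → ℝ) := Measure.pi fun _ => gaussianReal 0 1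

instance (k : ℕ) : IsProbabilityMeasure (gaussVec k) := by
  unfold gaussVec
  infer_instance

theorem gaussVec_map_orth (V : Orth k) :
    (gaussVec k).map (fun x => (V : Matrix (Fin k) (Fin k) ℝ) *ᵥ x) = gaussVec k := by
  have hlin : ∀ x : EuclideanSpace ℝ (Fin k),
      ‖Matrix.toEuclideanLin (V : Matrix (Fin k) (Fin k) ℝ) x‖ = ‖x‖ := by
    intro x
    rw [EuclideanSpace.norm_eq, EuclideanSpace.norm_eq]
    congr 1
    simp only [Real.norm_eq_abs, sq_abs]
    exact sqNorm_orth_mulVec V _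
  obtain ⟨f, hf⟩ : ∃ f : EuclideanSpace ℝ (Fin k) ≃ₗᵢ[ℝ] EuclideanSpace ℝ (Fin k),
      ∀ x, f x = WithLp.toLp 2 ((V : Matrix (Fin k) (Fin k) ℝ) *ᵥ (WithLp.ofLp x)) :=
    ⟨LinearIsometry.toLinearIsometryEquiv ⟨Matrix.toEuclideanLin (V : Matrix (Fin k) (Fin k) ℝ),
      hlin⟩ rfl, fun x => rfl⟩
  have h := stdGaussian_map f
  rw [← map_pi_eq_stdGaussian, Measure.map_map f.continuous.measurable (by fun_prop)] at h
  have h2 := congrArg (fun μ => μ.map (WithLp.ofLp : EuclideanSpace ℝ (Fin k) → (Fin k → ℝ))) h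
  simp only at h2
  rw [Measure.map_map (by fun_prop) (f.continuous.measurable.comp (by fun_prop)),
    Measure.map_map (by fun_prop) (by fun_prop)] at h2
  have e1 : ((WithLp.ofLp : EuclideanSpace ℝ (Fin k) → (Fin k → ℝ)) ∘ WithLp.toLp 2) = id := rfl
  have e2 : ((WithLp.ofLp : EuclideanSpace ℝ (Fin k) → (Fin k → ℝ)) ∘ (⇑f ∘ WithLp.toLp 2))
      = fun x => (V : Matrix (Fin k) (Fin k) ℝ) *ᵥ x := by
    funext x
    simp [hf]
  rw [e1, e2, Measure.map_id] at h2
  exact h2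

/-- A homogeneous function of a uniformly distributed vector, compared with the same function of a
Gaussian vector. -/
theorem lintegral_homogeneous_orth (μ : Measure (Orth k)) [IsProbabilityMeasure μ]
    [μ.IsMulLeftInvariant] (hk : 0 < k) {f : (Fin k → ℝ) → ℝ≥0∞} (hf : Measurable f) (d : ℕ)
    (hd : ∀ (t : ℝ) x, f (t • x) = ENNReal.ofReal (t ^ 2) ^ d * f x) (b : Fin k → ℝ) :
    (∫⁻ V : Orth k, f ((V : Matrix (Fin k) (Fin k) ℝ) *ᵥ b) ∂μ)
        * ∫⁻ g, ENNReal.ofReal (sqNorm g) ^ d ∂(gaussVec k)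
      = ENNReal.ofReal (sqNorm b) ^ d * ∫⁻ g, f g ∂(gaussVec k) := by
  -- `h` is the average of `f` over the orbit of `x`. The inverse `V⁻¹` makes left invariance of `μ`
  -- suffice for `h` to be rotation invariant.
  obtain ⟨h, hh⟩ : ∃ h : (Fin k → ℝ) → ℝ≥0∞, ∀ x,
      h x = ∫⁻ V : Orth k, f (((V⁻¹ : Orth k) : Matrix (Fin k) (Fin k) ℝ) *ᵥ x) ∂μ :=
    ⟨_, fun _ => rfl⟩
  have hmeas : Measurable (fun z : Orth k × (Fin k → ℝ) =>
      f (((z.1⁻¹ : Orth k) : Matrix (Fin k) (Fin k) ℝ) *ᵥ z.2)) :=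
    hf.comp (measurable_orth_mulVec.comp (measurable_fst.inv.prodMk measurable_snd))
  have hinv : ∀ (W : Orth k) x, h ((W : Matrix (Fin k) (Fin k) ℝ) *ᵥ x) = h x := by
    intro W x
    rw [hh, hh, ← lintegral_mul_left_eq_self
      (fun V : Orth k => f (((V⁻¹ : Orth k) : Matrix (Fin k) (Fin k) ℝ) *ᵥ
        ((W : Matrix (Fin k) (Fin k) ℝ) *ᵥ x))) W]
    refine lintegral_congr fun V => ?_
    rw [Matrix.mulVec_mulVec, ← orth_coe_mul, _root_.mul_inv_rev, inv_mul_cancel_right]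
  have hhom : ∀ (t : ℝ) x, h (t • x) = ENNReal.ofReal (t ^ 2) ^ d * h x := by
    intro t x
    have hx : Measurable (fun V : Orth k =>
        f (((V⁻¹ : Orth k) : Matrix (Fin k) (Fin k) ℝ) *ᵥ x)) :=
      hf.comp (measurable_orth_mulVec.comp (f := fun V : Orth k => (V⁻¹, x))
        (measurable_inv.prodMk measurable_const))
    rw [hh, hh, ← lintegral_const_mul _ hx]
    refine lintegral_congr fun V => ?_
    rw [Matrix.mulVec_smul, hd]
  -- A rotation invariant homogeneous function is a multiple of a power of the norm; `c` is its
  -- value at a unit vector.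
  obtain ⟨c, hc⟩ : ∃ c, ∀ x, h x = ENNReal.ofReal (sqNorm x) ^ d * c := by
    refine ⟨h (Pi.single ⟨0, hk⟩ 1), fun x => ?_⟩
    have hx : Real.sqrt (sqNorm x) ^ 2 = sqNorm x := Real.sq_sqrt (sqNorm_nonneg x)
    obtain ⟨V, hV⟩ := exists_orth_mulVec_eq
      (x := Real.sqrt (sqNorm x) • (Pi.single ⟨0, hk⟩ 1 : Fin k → ℝ)) (y := x) (by
        rw [sqNorm_smul, hx, sqNorm_eq_dotProduct (Pi.single _ _)]
        simp)
    conv_lhs => rw [← hV, hinv, hhom, hx]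
  -- A second average over `U` is inserted by left invariance; after exchanging the integrals the
  -- inner one is `h (V b)`, which depends on `V b` only through its norm. The same device, with
  -- Gaussian rotation invariance, gives `e2`, and the unknown `c` is then eliminated between the
  -- two.
  have e1 : ∫⁻ V : Orth k, f ((V : Matrix (Fin k) (Fin k) ℝ) *ᵥ b) ∂μ
      = ENNReal.ofReal (sqNorm b) ^ d * c := by
    have hU : ∀ U : Orth k, ∫⁻ V : Orth k, f ((V : Matrix (Fin k) (Fin k) ℝ) *ᵥ b) ∂μ
        = ∫⁻ V : Orth k, f (((U⁻¹ : Orth k) : Matrix (Fin k) (Fin k) ℝ) *ᵥ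
          ((V : Matrix (Fin k) (Fin k) ℝ) *ᵥ b)) ∂μ := by
      intro U
      rw [← lintegral_mul_left_eq_self
        (fun V : Orth k => f ((V : Matrix (Fin k) (Fin k) ℝ) *ᵥ b)) U⁻¹]
      refine lintegral_congr fun V => ?_
      rw [Matrix.mulVec_mulVec, ← orth_coe_mul]
    have hVb : Measurable (fun V : Orth k => (V : Matrix (Fin k) (Fin k) ℝ) *ᵥ b) :=
      measurable_orth_mulVec.comp (measurable_id.prodMk measurable_const)
    calc ∫⁻ V : Orth k, f ((V : Matrix (Fin k) (Fin k) ℝ) *ᵥ b) ∂μ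
        = ∫⁻ _ : Orth k, (∫⁻ V : Orth k, f ((V : Matrix (Fin k) (Fin k) ℝ) *ᵥ b) ∂μ) ∂μ := by
          simp
      _ = ∫⁻ U : Orth k, (∫⁻ V : Orth k, f (((U⁻¹ : Orth k) : Matrix (Fin k) (Fin k) ℝ) *ᵥ
          ((V : Matrix (Fin k) (Fin k) ℝ) *ᵥ b)) ∂μ) ∂μ := lintegral_congr hU
      _ = ∫⁻ V : Orth k, (∫⁻ U : Orth k, f (((U⁻¹ : Orth k) : Matrix (Fin k) (Fin k) ℝ) *ᵥ
          ((V : Matrix (Fin k) (Fin k) ℝ) *ᵥ b)) ∂μ) ∂μ :=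
          lintegral_lintegral_swap (hmeas.comp
            (measurable_fst.prodMk (hVb.comp measurable_snd))).aemeasurable
      _ = ∫⁻ V : Orth k, ENNReal.ofReal (sqNorm b) ^ d * c ∂μ :=
          lintegral_congr fun V => by rw [← hh, hc, sqNorm_orth_mulVec]
      _ = _ := by simp
  have e2 : ∫⁻ g, f g ∂(gaussVec k)
      = (∫⁻ g, ENNReal.ofReal (sqNorm g) ^ d ∂(gaussVec k)) * c := by
    have hU : ∀ U : Orth k, ∫⁻ g, f g ∂(gaussVec k)
        = ∫⁻ g, f (((U⁻¹ : Orth k) : Matrix (Fin k) (Fin k) ℝ) *ᵥ g) ∂(gaussVec k) := by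
      intro U
      conv_lhs => rw [← gaussVec_map_orth U⁻¹]
      have hU : Measurable (fun g : Fin k → ℝ =>
          ((U⁻¹ : Orth k) : Matrix (Fin k) (Fin k) ℝ) *ᵥ g) :=
        measurable_orth_mulVec.comp (measurable_const.prodMk measurable_id)
      rw [lintegral_map hf hU]
    calc ∫⁻ g, f g ∂(gaussVec k) = ∫⁻ _ : Orth k, (∫⁻ g, f g ∂(gaussVec k)) ∂μ := by simp
      _ = ∫⁻ U : Orth k, (∫⁻ g, f (((U⁻¹ : Orth k) : Matrix (Fin k) (Fin k) ℝ) *ᵥ g)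
          ∂(gaussVec k)) ∂μ := lintegral_congr hU
      _ = ∫⁻ g, (∫⁻ U : Orth k, f (((U⁻¹ : Orth k) : Matrix (Fin k) (Fin k) ℝ) *ᵥ g) ∂μ)
          ∂(gaussVec k) := lintegral_lintegral_swap hmeas.aemeasurable
      _ = ∫⁻ g, ENNReal.ofReal (sqNorm g) ^ d * c ∂(gaussVec k) :=
          lintegral_congr fun g => by rw [← hh, hc]
      _ = _ := lintegral_mul_const _ (measurable_sqNorm.ennreal_ofReal.pow_const d)
  rw [e1, e2]
  ring

end Sphere

/-! ### Gaussian moments and their consequences for the sphere. -/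

section SphereMoments

variable {k : ℕ}

theorem integrable_pow_gaussianReal (m : ℕ) :
    Integrable (fun x : ℝ => x ^ m) (gaussianReal 0 1) := by
  have h := (memLp_id_gaussianReal (μ := 0) (v := 1) (m : NNReal)).integrable_norm_pow'
  have h2 : Integrable (fun x : ℝ => ‖x‖ ^ m) (gaussianReal 0 1) := by simpa using h
  refine h2.mono' (by fun_prop) (Eventually.of_forall fun x => ?_)
  rw [norm_pow]

theorem integral_sq_gaussianReal : ∫ x, x ^ 2 ∂(gaussianReal 0 1) = 1 := by
  have h := variance_fun_id_gaussianReal (μ := 0) (v := 1)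
  rw [variance_of_integral_eq_zero (by fun_prop) (by simp)] at h
  simpa using h

theorem lintegral_gaussVec_eval {f : ℝ → ℝ≥0∞} (hf : Measurable f) (i : Fin k) :
    ∫⁻ g, f (g i) ∂(gaussVec k) = ∫⁻ x, f x ∂(gaussianReal 0 1) :=
  (measurePreserving_eval (fun _ : Fin k => gaussianReal 0 1) i).lintegral_comp hf

theorem lintegral_sqNorm_gaussVec :
    ∫⁻ g, ENNReal.ofReal (sqNorm g) ∂(gaussVec k) = k := by
  have e : ∀ g : Fin k → ℝ, ENNReal.ofReal (sqNorm g) = ∑ i, ENNReal.ofReal (g i ^ 2) :=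
    fun g => ENNReal.ofReal_sum_of_nonneg fun i _ => sq_nonneg _
  simp only [e]
  rw [lintegral_finsetSum _ (fun i _ => by fun_prop)]
  have h1 : ∀ i : Fin k, ∫⁻ g, ENNReal.ofReal (g i ^ 2) ∂(gaussVec k) = 1 := by
    intro i
    rw [lintegral_gaussVec_eval (f := fun x => ENNReal.ofReal (x ^ 2)) (by fun_prop),
      ← ofReal_integral_eq_lintegral_ofReal (integrable_pow_gaussianReal 2)
        (Eventually.of_forall fun x => sq_nonneg x), integral_sq_gaussianReal]
    simp
  simp [h1]

/-- The convex function `s ↦ s^(d+1)` lies above its tangent at `t`. -/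
theorem succ_mul_pow_mul_le {s t : ℝ} (hs : 0 ≤ s) (ht : 0 ≤ t) (d : ℕ) :
    ((d : ℝ) + 1) * t ^ d * s ≤ s ^ (d + 1) + d * t ^ (d + 1) := by
  induction d with
  | zero => simp
  | succ d ih =>
    have h1 := mul_le_mul_of_nonneg_left ih ht
    have h2 : 0 ≤ (s ^ (d + 1) - t ^ (d + 1)) * (s - t) := by
      rcases le_total s t with h | h
      · exact mul_nonneg_of_nonpos_of_nonpos
          (sub_nonpos.mpr (pow_le_pow_left₀ hs h _)) (sub_nonpos.mpr h)
      · exact mul_nonneg (sub_nonneg.mpr (pow_le_pow_left₀ ht h _)) (sub_nonneg.mpr h)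
    push_cast
    ring_nf at h1 h2 ⊢
    linarith

/-- Jensen's inequality at the mean `k` of the squared norm, through the tangent line. It bounds
from below the normalising factor of `lintegral_homogeneous_orth`. -/
theorem pow_le_lintegral_sqNorm_pow (d : ℕ) :
    (k : ℝ≥0∞) ^ (d + 1) ≤ ∫⁻ g, ENNReal.ofReal (sqNorm g) ^ (d + 1) ∂(gaussVec k) := by
  have hpt : ∀ g : Fin k → ℝ, ((d : ℝ≥0∞) + 1) * (k : ℝ≥0∞) ^ d * ENNReal.ofReal (sqNorm g)
      ≤ ENNReal.ofReal (sqNorm g) ^ (d + 1) + d * (k : ℝ≥0∞) ^ (d + 1) := by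
    intro g
    have hs := sqNorm_nonneg g
    have hk : (0 : ℝ) ≤ k := Nat.cast_nonneg k
    have hr : ((d : ℝ) + 1) * (k : ℝ) ^ d * sqNorm g
        ≤ sqNorm g ^ (d + 1) + d * (k : ℝ) ^ (d + 1) := succ_mul_pow_mul_le hs hk d
    have h := ENNReal.ofReal_le_ofReal hr
    rw [ENNReal.ofReal_mul (by positivity), ENNReal.ofReal_mul (by positivity),
      ENNReal.ofReal_add (by positivity) zero_le_one,
      ENNReal.ofReal_add (by positivity) (by positivity), ENNReal.ofReal_mul (by positivity),
      ENNReal.ofReal_pow hs, ENNReal.ofReal_pow hk, ENNReal.ofReal_pow hk] at h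
    simpa using h
  have h := lintegral_mono hpt (μ := gaussVec k)
  rw [lintegral_const_mul _ (measurable_sqNorm.ennreal_ofReal), lintegral_sqNorm_gaussVec,
    lintegral_add_right _ measurable_const, lintegral_const, measure_univ, mul_one, mul_assoc,
    ← pow_succ, add_mul, one_mul, add_comm] at h
  exact (ENNReal.add_le_add_iff_right (by finiteness)).mp h

/-- Fourth moments of centred diagonal quadratic forms on the sphere. -/
theorem exists_sphere_quadratic_bound : ∃ C : ℝ, 0 ≤ C ∧ ∀ (k : ℕ) (μ : Measure (Orth k))
    [IsProbabilityMeasure μ] [μ.IsMulLeftInvariant] (b : Fin k → ℝ) (A : Fin k → ℝ) (B : ℝ),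
    0 < k → (∀ i, 0 ≤ A i) → (∀ i, A i ≤ B) →
    ∫⁻ V : Orth k, ENNReal.ofReal ((∑ i, A i * (((V : Matrix (Fin k) (Fin k) ℝ) *ᵥ b) i ^ 2
      - sqNorm b / k)) ^ 4) ∂μ ≤ ENNReal.ofReal (C * (sqNorm b * B) ^ 4 / k ^ 2) := by
  obtain ⟨K, hK1, hK⟩ : ∃ K : ℝ, 1 ≤ K ∧ ∫ x, (x ^ 2 - 1) ^ 4 ∂(gaussianReal 0 1) ≤ K :=
    ⟨_, le_max_left _ _, le_max_right _ _⟩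
  refine ⟨16 * K ^ 2, by positivity, ?_⟩
  intro k μ _ _ b A B hk hA hAB
  have hk' : (0 : ℝ) < k := by exact_mod_cast hk
  obtain ⟨a, ha⟩ : ∃ a, a = (∑ i, A i) / k := ⟨_, rfl⟩
  have hB : 0 ≤ B := (hA ⟨0, hk⟩).trans (hAB ⟨0, hk⟩)
  have ha0 : 0 ≤ a := by
    rw [ha]
    exact div_nonneg (Finset.sum_nonneg fun i _ => hA i) hk'.le
  have haB : a ≤ B := by
    rw [ha, div_le_iff₀ hk']
    calc ∑ i, A i ≤ ∑ _i : Fin k, B := Finset.sum_le_sum fun i _ => hAB i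
      _ = B * k := by simp [mul_comm]
  have hsum : ∑ i, (A i - a) = 0 := by
    rw [Finset.sum_sub_distrib, ha]
    simp
    field_simp
    simp
  -- Subtracting `sqNorm x / k` from the squares amounts to subtracting the mean `a` from the
  -- weights, which makes the form homogeneous.
  have hcentre : ∀ x : Fin k → ℝ, ∑ i, A i * (x i ^ 2 - sqNorm x / k)
      = ∑ i, (A i - a) * x i ^ 2 := by
    intro x
    simp only [sub_mul, mul_sub, Finset.sum_sub_distrib, ← Finset.sum_mul, ← Finset.mul_sum]
    rw [ha]
    unfold sqNorm
    ring
  -- The centred weights sum to zero, so the squares may be centred at 1 instead. For a Gaussian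
  -- vector this is a linear form in independent centred variables.
  have hgauss : ∀ x : Fin k → ℝ, ∑ i, (A i - a) * x i ^ 2
      = ∑ i, (A i - a) * (x i ^ 2 - 1) := by
    intro x
    simp only [mul_sub, Finset.sum_sub_distrib, mul_one]
    rw [Finset.sum_sub_distrib] at hsum
    linarith
  have hmain := lintegral_homogeneous_orth μ hk
    (f := fun x => ENNReal.ofReal ((∑ i, (A i - a) * x i ^ 2) ^ 4)) (by fun_prop) 4 (by
      intro t x
      rw [← ENNReal.ofReal_pow (sq_nonneg t), ← ENNReal.ofReal_mul (by positivity)]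
      congr 1
      simp only [Pi.smul_apply, smul_eq_mul]
      rw [← mul_pow, Finset.mul_sum]
      congr 1
      exact Finset.sum_congr rfl fun i _ => by ring) b
  have hG : ∫⁻ g, ENNReal.ofReal ((∑ i, (A i - a) * g i ^ 2) ^ 4) ∂(gaussVec k)
      ≤ ENNReal.ofReal ((4 * K * (k * B ^ 2)) ^ 2) := by
    have hi4 : Integrable (fun x : ℝ => (x ^ 2 - 1) ^ 4) (gaussianReal 0 1) := by
      have e : (fun x : ℝ => (x ^ 2 - 1) ^ 4)
          = fun x => x ^ 8 - 4 * x ^ 6 + 6 * x ^ 4 - 4 * x ^ 2 + x ^ 0 := by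
        funext x
        ring
      rw [e]
      have := integrable_pow_gaussianReal
      exact ((((this 8).sub ((this 6).const_mul 4)).add ((this 4).const_mul 6)).sub
        ((this 2).const_mul 4)).add (this 0)
    have hev : ∀ i : Fin k, MeasurePreserving (Function.eval i) (gaussVec k) (gaussianReal 0 1) :=
      fun i => measurePreserving_eval (fun _ : Fin k => gaussianReal 0 1) i
    have hint : ∀ (i : Fin k) {f : ℝ → ℝ}, Measurable f →
        ∫ g, f (g i) ∂(gaussVec k) = ∫ x, f x ∂(gaussianReal 0 1) := by
      intro i f hf
      rw [← (hev i).map_eq, integral_map (measurable_pi_apply i).aemeasurable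
        hf.aestronglyMeasurable]
    have h := fourth_moment_linear_form_le (P := gaussVec k)
      (ε := fun (i : Fin k) (g : Fin k → ℝ) => g i ^ 2 - 1) (fun i => by fun_prop)
      (iIndepFun_pi (μ := fun _ : Fin k => gaussianReal 0 1) (X := fun _ x => x ^ 2 - 1)
        fun i => by fun_prop)
      (fun i => (hev i).integrable_comp_of_integrable hi4)
      (fun i => by
        rw [hint i (f := fun x => x ^ 2 - 1) (by fun_prop),
          integral_sub (integrable_pow_gaussianReal 2) (integrable_const 1),
          integral_sq_gaussianReal]
        simp) hK1
      (fun i => by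
        rw [hint i (f := fun x => (x ^ 2 - 1) ^ 4) (by fun_prop)]
        exact hK) (fun i => A i - a) Finset.univ
    simp only [hgauss]
    rw [← ofReal_integral_eq_lintegral_ofReal h.1 (Eventually.of_forall fun x => by
      show (0 : ℝ) ≤ _
      positivity)]
    refine ENNReal.ofReal_le_ofReal (h.2.trans ?_)
    refine pow_le_pow_left₀ (by positivity) (mul_le_mul_of_nonneg_left ?_ (by positivity)) 2
    calc ∑ i, (A i - a) ^ 2 ≤ ∑ _i : Fin k, B ^ 2 := Finset.sum_le_sum fun i _ => by
          rw [sq_le_sq, abs_of_nonneg hB, abs_le]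
          constructor <;> linarith [hA i, hAB i]
      _ = k * B ^ 2 := by simp
  have hpow := pow_le_lintegral_sqNorm_pow (k := k) 3
  have hlhs : ∀ V : Orth k, ∑ i, A i * (((V : Matrix (Fin k) (Fin k) ℝ) *ᵥ b) i ^ 2
      - sqNorm b / k) = ∑ i, (A i - a) * ((V : Matrix (Fin k) (Fin k) ℝ) *ᵥ b) i ^ 2 := by
    intro V
    rw [← hcentre, sqNorm_orth_mulVec]
  simp only [hlhs]
  have hkE : (k : ℝ≥0∞) ^ 4 ≠ 0 := by
    have : (k : ℝ≥0∞) ≠ 0 := by exact_mod_cast hk.ne'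
    positivity
  -- The Gaussian form has fourth moment at most `(4 K k B²)²`, and division by the normalising
  -- factor, at least `k⁴`, leaves `16 K² B⁴ / k²`.
  rw [← ENNReal.mul_le_mul_iff_left hkE (by finiteness)]
  refine (mul_le_mul_right hpow _).trans (hmain.le.trans ((mul_le_mul_right hG _).trans ?_))
  rw [← ENNReal.ofReal_pow (sqNorm_nonneg b), ← ENNReal.ofReal_mul (by positivity),
    ← ENNReal.ofReal_natCast k, ← ENNReal.ofReal_pow hk'.le, ← ENNReal.ofReal_mul (by positivity)]
  refine ENNReal.ofReal_le_ofReal (le_of_eq ?_)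
  field_simp
  ring

/-- Fourth moments of the coordinates of a point of the sphere. -/
theorem exists_sphere_coordinate_bound : ∃ C : ℝ, 0 ≤ C ∧ ∀ (k : ℕ) (μ : Measure (Orth k))
    [IsProbabilityMeasure μ] [μ.IsMulLeftInvariant] (b : Fin k → ℝ) (i : Fin k),
    ∫⁻ V : Orth k, ENNReal.ofReal (((V : Matrix (Fin k) (Fin k) ℝ) *ᵥ b) i ^ 4) ∂μ
      ≤ ENNReal.ofReal (C * sqNorm b ^ 2 / k ^ 2) := by
  refine ⟨∫ x, x ^ 4 ∂(gaussianReal 0 1), integral_nonneg fun x => by positivity, ?_⟩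
  intro k μ _ _ b i
  have hk : 0 < k := i.pos
  have hk' : (0 : ℝ) < k := by exact_mod_cast hk
  have hmain := lintegral_homogeneous_orth μ hk
    (f := fun x => ENNReal.ofReal (x i ^ 4)) (by fun_prop) 2 (by
      intro t x
      rw [← ENNReal.ofReal_pow (sq_nonneg t), ← ENNReal.ofReal_mul (by positivity)]
      congr 1
      simp only [Pi.smul_apply, smul_eq_mul]
      ring) b
  rw [lintegral_gaussVec_eval (f := fun x => ENNReal.ofReal (x ^ 4)) (by fun_prop),
    ← ofReal_integral_eq_lintegral_ofReal (integrable_pow_gaussianReal 4)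
      (Eventually.of_forall fun x => by show (0 : ℝ) ≤ _; positivity)] at hmain
  have hpow := pow_le_lintegral_sqNorm_pow (k := k) 1
  have hkE : (k : ℝ≥0∞) ^ 2 ≠ 0 := by
    have : (k : ℝ≥0∞) ≠ 0 := by exact_mod_cast hk.ne'
    positivity
  rw [← ENNReal.mul_le_mul_iff_left hkE (by finiteness)]
  refine (mul_le_mul_right hpow _).trans (hmain.le.trans ?_)
  rw [← ENNReal.ofReal_pow (sqNorm_nonneg b), ← ENNReal.ofReal_mul (by positivity),
    ← ENNReal.ofReal_natCast k, ← ENNReal.ofReal_pow hk'.le, ← ENNReal.ofReal_mul (by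
      have := integral_nonneg (μ := gaussianReal 0 1) (f := fun x : ℝ => x ^ 4)
        fun x => by show (0 : ℝ) ≤ _; positivity
      positivity)]
  refine ENNReal.ofReal_le_ofReal (le_of_eq ?_)
  field_simp

end SphereMoments

/-! ### The conditional law of the test design -/

section ConditionalLaw

instance (m k : ℕ) : SecondCountableTopology (Matrix (Fin m) (Fin k) ℝ) :=
  inferInstanceAs (SecondCountableTopology (Fin m → Fin k → ℝ))

variable {k : ℕ} {J : Finset ℕ}

/-- The permutation matrix exchanging two coordinates. -/
theorem exists_swap_mem_basisStabilizer {i j : Fin k} (hi : (i : ℕ) ∉ J) (hj : (j : ℕ) ∉ J) :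
    ∃ W ∈ basisStabilizer k J, ∀ v : Fin k → ℝ,
      (W : Matrix (Fin k) (Fin k) ℝ) *ᵥ v = v ∘ Equiv.swap i j := by
  have hmem : ((Equiv.swap i j).toPEquiv.toMatrix : Matrix (Fin k) (Fin k) ℝ)
      ∈ Matrix.orthogonalGroup (Fin k) ℝ := by
    rw [Matrix.mem_orthogonalGroup_iff, ← PEquiv.toMatrix_symm, ← PEquiv.toMatrix_trans,
      ← Equiv.toPEquiv_symm, ← Equiv.toPEquiv_trans, Equiv.self_trans_symm, Equiv.toPEquiv_refl,
      PEquiv.toMatrix_refl]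
  have hact : ∀ v : Fin k → ℝ, ((Equiv.swap i j).toPEquiv.toMatrix : Matrix (Fin k) (Fin k) ℝ) *ᵥ v
      = v ∘ Equiv.swap i j := fun v => PEquiv.toMatrix_toPEquiv_mulVec _ _
  refine ⟨⟨_, hmem⟩, ?_, hact⟩
  intro l hl
  rw [hact]
  funext a
  have hli : l ≠ i := fun h => hi (h ▸ hl)
  have hlj : l ≠ j := fun h => hj (h ▸ hl)
  simp only [Function.comp, Pi.single_apply]
  simp only [Equiv.swap_apply_eq_iff, Equiv.swap_apply_of_ne_of_ne hli hlj]

/-- The stabilizer condition fixes columns of `U`; applied to `U⁻¹ = Uᵀ` it fixes the rows as well.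
-/
theorem basisStabilizer_mulVec_apply {U : Orth k} (hU : U ∈ basisStabilizer k J) {i : Fin k}
    (hi : (i : ℕ) ∈ J) (v : Fin k → ℝ) : ((U : Matrix (Fin k) (Fin k) ℝ) *ᵥ v) i = v i := by
  have h := (basisStabilizer k J).inv_mem hU i hi
  rw [orth_coe_inv, Matrix.mulVec_single_one] at h
  have hrow : (U : Matrix (Fin k) (Fin k) ℝ) i = Pi.single i 1 := h
  rw [Matrix.mulVec, hrow, single_one_dotProduct]

variable (ν : Measure (basisStabilizer k J)) [IsProbabilityMeasure ν]

theorem measurable_stabilizer_mulVec (v : Fin k → ℝ) :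
    Measurable (fun U : basisStabilizer k J => ((U : Orth k) : Matrix (Fin k) (Fin k) ℝ) *ᵥ v) :=
  measurable_orth_mulVec.comp (f := fun U : basisStabilizer k J => ((U : Orth k), v))
    (measurable_subtype_coe.prodMk measurable_const)

theorem integrable_stabilizer_coord_sq (v : Fin k → ℝ) (i : Fin k) :
    Integrable (fun U : basisStabilizer k J =>
      (((U : Orth k) : Matrix (Fin k) (Fin k) ℝ) *ᵥ v) i ^ 2) ν := by
  have hm : Measurable (fun U : basisStabilizer k J =>
      (((U : Orth k) : Matrix (Fin k) (Fin k) ℝ) *ᵥ v) i ^ 2) :=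
    ((measurable_pi_apply i).comp (measurable_stabilizer_mulVec v)).pow_const 2
  refine (integrable_const (sqNorm v)).mono' hm.aestronglyMeasurable
    (Eventually.of_forall fun U => ?_)
  rw [Real.norm_eq_abs, abs_of_nonneg (sq_nonneg _), ← sqNorm_orth_mulVec (U : Orth k) v]
  exact Finset.single_le_sum
    (f := fun i => (((U : Orth k) : Matrix (Fin k) (Fin k) ℝ) *ᵥ v) i ^ 2)
    (fun j _ => sq_nonneg _) (Finset.mem_univ i)

theorem card_filter_notMem (hJ : J ⊆ Finset.range k) :
    ((Finset.univ.filter fun j : Fin k => (j : ℕ) ∉ J).card : ℝ) = (k : ℝ) - J.card := by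
  have h : (Finset.univ.filter fun j : Fin k => (j : ℕ) ∉ J).card = (Finset.range k \ J).card := by
    rw [← Finset.card_map Fin.valEmbedding]
    congr 1
    ext a
    simp only [Finset.mem_map, Finset.mem_filter, Finset.mem_univ, true_and, Fin.valEmbedding_apply,
      Finset.mem_sdiff, Finset.mem_range]
    constructor
    · rintro ⟨x, hx, rfl⟩
      exact ⟨x.2, hx⟩
    · rintro ⟨ha, hx⟩
      exact ⟨⟨a, ha⟩, hx, rfl⟩
  rw [h, Finset.card_sdiff_of_subset hJ, Nat.cast_sub (Finset.card_le_card hJ), Finset.card_range]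

/-- Coordinates outside `J` are exchangeable, because swapping two of them is a left translation in
the stabilizer. Their total energy does not depend on `U`, since `U` is an isometry and preserves
the coordinates in `J`. Each therefore receives an equal share. -/
theorem integral_stabilizer_coord_sq [ν.IsMulLeftInvariant] (hJ : J ⊆ Finset.range k)
    (v : Fin k → ℝ) {i : Fin k} (hi : (i : ℕ) ∉ J) :
    ∫ U : basisStabilizer k J, (((U : Orth k) : Matrix (Fin k) (Fin k) ℝ) *ᵥ v) i ^ 2 ∂ν
      = (1 / ((k : ℝ) - J.card)) * ∑ j : Fin k, if (j : ℕ) ∈ J then 0 else v j ^ 2 := by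
  have hswap : ∀ j : Fin k, (j : ℕ) ∉ J →
      ∫ U : basisStabilizer k J, (((U : Orth k) : Matrix (Fin k) (Fin k) ℝ) *ᵥ v) j ^ 2 ∂ν
      = ∫ U : basisStabilizer k J, (((U : Orth k) : Matrix (Fin k) (Fin k) ℝ) *ᵥ v) i ^ 2 ∂ν := by
    intro j hj
    obtain ⟨W, hW, hWv⟩ := exists_swap_mem_basisStabilizer hi hj
    rw [← integral_mul_left_eq_self (fun U : basisStabilizer k J =>
      (((U : Orth k) : Matrix (Fin k) (Fin k) ℝ) *ᵥ v) i ^ 2) ⟨W, hW⟩]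
    congr 1 with U
    have e : (((⟨W, hW⟩ * U : basisStabilizer k J) : Orth k) : Matrix (Fin k) (Fin k) ℝ)
        = (W : Matrix (Fin k) (Fin k) ℝ) * ((U : Orth k) : Matrix (Fin k) (Fin k) ℝ) := rfl
    rw [e, ← Matrix.mulVec_mulVec, hWv]
    simp
  have hsum : ∀ U : basisStabilizer k J,
      ∑ j ∈ Finset.univ.filter (fun j : Fin k => (j : ℕ) ∉ J),
        (((U : Orth k) : Matrix (Fin k) (Fin k) ℝ) *ᵥ v) j ^ 2
      = ∑ j : Fin k, if (j : ℕ) ∈ J then 0 else v j ^ 2 := by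
    intro U
    have h := sqNorm_orth_mulVec (U : Orth k) v
    unfold sqNorm at h
    rw [← Finset.sum_filter_add_sum_filter_not Finset.univ (fun j : Fin k => (j : ℕ) ∈ J),
      ← Finset.sum_filter_add_sum_filter_not (f := fun j => v j ^ 2) Finset.univ
        (fun j : Fin k => (j : ℕ) ∈ J)] at h
    have h2 : ∑ j ∈ Finset.univ.filter (fun j : Fin k => (j : ℕ) ∈ J),
        (((U : Orth k) : Matrix (Fin k) (Fin k) ℝ) *ᵥ v) j ^ 2
        = ∑ j ∈ Finset.univ.filter (fun j : Fin k => (j : ℕ) ∈ J), v j ^ 2 :=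
      Finset.sum_congr rfl fun j hj => by
        rw [basisStabilizer_mulVec_apply U.2 (Finset.mem_filter.mp hj).2]
    have h3 : ∑ j : Fin k, (if (j : ℕ) ∈ J then 0 else v j ^ 2)
        = ∑ j ∈ Finset.univ.filter (fun j : Fin k => (j : ℕ) ∉ J), v j ^ 2 := by
      rw [Finset.sum_filter]
      refine Finset.sum_congr rfl fun j _ => ?_
      split_ifs <;> simp_all
    rw [h3]
    linarith
  have htot : ∑ j ∈ Finset.univ.filter (fun j : Fin k => (j : ℕ) ∉ J),
      ∫ U : basisStabilizer k J, (((U : Orth k) : Matrix (Fin k) (Fin k) ℝ) *ᵥ v) j ^ 2 ∂ν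
      = ∑ j : Fin k, if (j : ℕ) ∈ J then 0 else v j ^ 2 := by
    rw [← integral_finsetSum _ fun j _ => integrable_stabilizer_coord_sq ν v j]
    simp only [hsum]
    simp
  rw [Finset.sum_congr rfl fun j hj => hswap j (Finset.mem_filter.mp hj).2, Finset.sum_const,
    nsmul_eq_mul, card_filter_notMem hJ] at htot
  have hne : (k : ℝ) - J.card ≠ 0 := by
    rw [← card_filter_notMem hJ, Nat.cast_ne_zero]
    exact (Finset.card_pos.mpr ⟨i, by simpa using hi⟩).ne'
  rw [← htot]
  field_simp

/-- The weights `𝔡_bulk² + 1(i ∈ J) (𝔡_i² - 𝔡_bulk²)`. -/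
noncomputable def specWeight (k : ℕ) (J : Finset ℕ) (d : ℕ → ℝ) (i : ℕ) : ℝ :=
  bulkSpec k J d + if i ∈ J then d i - bulkSpec k J d else 0

/-- The source of the bulk spectrum: when energy is shared equally, only the average of `d` outside
`J` matters. -/
theorem sum_integral_stabilizer_coord_sq [ν.IsMulLeftInvariant] (hJ : J ⊆ Finset.range k)
    (v : Fin k → ℝ) (d : ℕ → ℝ) :
    ∑ i : Fin k, d i * ∫ U : basisStabilizer k J,
        (((U : Orth k) : Matrix (Fin k) (Fin k) ℝ) *ᵥ v) i ^ 2 ∂ν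
      = ∑ i : Fin k, specWeight k J d i * v i ^ 2 := by
  have h1 : ∀ i : Fin k, d i * ∫ U : basisStabilizer k J,
        (((U : Orth k) : Matrix (Fin k) (Fin k) ℝ) *ᵥ v) i ^ 2 ∂ν
      = (if (i : ℕ) ∈ J then d i * v i ^ 2 else 0) + (if (i : ℕ) ∈ J then 0 else d i) *
        ((1 / ((k : ℝ) - J.card)) * ∑ j : Fin k, if (j : ℕ) ∈ J then 0 else v j ^ 2) := by
    intro i
    by_cases hi : (i : ℕ) ∈ J
    · have : ∀ U : basisStabilizer k J, (((U : Orth k) : Matrix (Fin k) (Fin k) ℝ) *ᵥ v) i = v i :=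
        fun U => basisStabilizer_mulVec_apply U.2 hi v
      simp [hi, this]
    · rw [integral_stabilizer_coord_sq ν hJ v hi]
      simp [hi]
  have h2 : ∀ i : Fin k, specWeight k J d i * v i ^ 2
      = (if (i : ℕ) ∈ J then d i * v i ^ 2 else 0)
        + bulkSpec k J d * (if (i : ℕ) ∈ J then 0 else v i ^ 2) := by
    intro i
    unfold specWeight
    split_ifs <;> ring
  have h3 : ∑ i : Fin k, (if (i : ℕ) ∈ J then 0 else d i) = ∑ i ∈ Finset.range k \ J, d i := by
    rw [Fin.sum_univ_eq_sum_range (fun i => if i ∈ J then 0 else d i) k, Finset.sum_ite,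
      Finset.sum_const_zero, zero_add, Finset.sdiff_eq_filter]
  rw [Finset.sum_congr rfl fun i _ => h1 i, Finset.sum_congr rfl fun i _ => h2 i,
    Finset.sum_add_distrib, Finset.sum_add_distrib, ← Finset.sum_mul, ← Finset.mul_sum, h3]
  unfold bulkSpec
  ring

end ConditionalLaw

/-! ### The conditional law of the test design given the observed training data. -/

section CouplingLaw

instance (k : ℕ) : SecondCountableTopology (Orth k) :=
  TopologicalSpace.Subtype.secondCountableTopology _

theorem measurable_orth_mul {k : ℕ} : Measurable (fun z : Orth k × Orth k => z.1 * z.2) :=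
  continuous_mul.measurable

variable {Ω τ ρ ς E : Type*} [MeasurableSpace Ω] [MeasurableSpace τ] [MeasurableSpace ρ]
  [MeasurableSpace ς] [MeasurableSpace E] [StandardBorelSpace E] [Nonempty E]

/-- The conditional law of a function of `(R, Ot)` when `R` is independent of `(T, Ot)` and `Ot` is
Haar conditioned on some rows of `O` given `T`, the conditioning being on a function `S` of `T`
that determines `O`. -/
theorem condDistrib_of_haarCoupled (P : Measure Ω) [IsProbabilityMeasure P] {k : ℕ} {J : Finset ℕ}
    (ν : Measure (basisStabilizer k J)) [IsProbabilityMeasure ν] {O Ot : Ω → Orth k} {T : Ω → τ}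
    {R : Ω → ρ} {S : Ω → ς} {s : τ → ς} {o : ς → Orth k} {G : ρ × Orth k → E}
    (hOt : Measurable Ot) (hT : Measurable T) (hR : Measurable R) (hs : Measurable s)
    (ho : Measurable o) (hG : Measurable G) (hS : ∀ ω, S ω = s (T ω)) (hO : ∀ ω, O ω = o (S ω))
    (hind : IndepFun R (fun ω => (T ω, Ot ω)) P)
    (hcond : ∀ᵐ ω ∂P, condDistrib Ot T P (T ω) = haarGivenRows ν (O ω)) :
    ∀ᵐ ω ∂P, condDistrib (fun ω => G (R ω, Ot ω)) S P (S ω)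
      = ((P.map R).prod ν).map (fun z => G (z.1, (z.2 : Orth k) * O ω)) := by
  obtain rfl : S = fun ω => s (T ω) := funext hS
  obtain rfl : O = fun ω => o (s (T ω)) := funext hO
  have : IsProbabilityMeasure (P.map R) := Measure.isProbabilityMeasure_map hR.aemeasurable
  have hSm : Measurable (fun ω => s (T ω)) := hs.comp hT
  obtain ⟨F, hF⟩ : ∃ F : ς × (ρ × basisStabilizer k J) → E,
      ∀ z, F z = G (z.2.1, (z.2.2 : Orth k) * o z.1) := ⟨_, fun _ => rfl⟩
  have hFm : Measurable F := by
    rw [show F = _ from funext hF]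
    refine hG.comp (measurable_snd.fst.prodMk ?_)
    exact measurable_orth_mul.comp
      (f := fun z : ς × (ρ × basisStabilizer k J) => ((z.2.2 : Orth k), o z.1))
      ((measurable_subtype_coe.comp measurable_snd.snd).prodMk (ho.comp measurable_fst))
  -- The candidate kernel: from `x`, draw `R` and `U` independently and output `G (R, U * o x)`. It
  -- depends on the training data only through `S`.
  obtain ⟨κ, hκ⟩ : ∃ κ : Kernel ς E, κ = (Kernel.id ×ₖ Kernel.const ς ((P.map R).prod ν)).map F :=
    ⟨_, rfl⟩
  have hκM : IsMarkovKernel κ := by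
    rw [hκ]
    exact Kernel.IsMarkovKernel.map _ hFm
  have hκa : ∀ x, κ x = ((P.map R).prod ν).map (fun z => F (x, z)) := by
    intro x
    rw [hκ, Kernel.map_apply _ hFm, Kernel.prod_apply, Kernel.id_apply, Kernel.const_apply,
      Measure.dirac_prod, Measure.map_map hFm (by fun_prop)]
    rfl
  -- By almost everywhere uniqueness of conditional laws, it suffices that the joint law of `S` and
  -- the output disintegrates along `κ`.
  have hjoint : P.map (fun ω => (s (T ω), G (R ω, Ot ω))) = (P.map fun ω => s (T ω)) ⊗ₘ κ := by
    have hXm : Measurable fun ω => G (R ω, Ot ω) := hG.comp (hR.prodMk hOt)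
    refine Measure.ext_of_lintegral _ fun f hf => ?_
    rw [Measure.lintegral_compProd hf, lintegral_map hf (hSm.prodMk hXm),
      lintegral_map (hf.lintegral_kernel_prod_right') hSm]
    have hstep1 : ∫⁻ ω, f (s (T ω), G (R ω, Ot ω)) ∂P
        = ∫⁻ r, ∫⁻ ω, f (s (T ω), G (r, Ot ω)) ∂P ∂(P.map R) := by
      have h := (indepFun_iff_map_prod_eq_prod_map_map hR.aemeasurable
        (hT.prodMk hOt).aemeasurable).mp hind
      have hg : Measurable (fun z : ρ × (τ × Orth k) => f (s z.2.1, G (z.1, z.2.2))) :=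
        hf.comp ((hs.comp measurable_snd.fst).prodMk
          (hG.comp (measurable_fst.prodMk measurable_snd.snd)))
      have h2 := lintegral_map hg (hR.prodMk (hT.prodMk hOt)) (μ := P)
      rw [h, lintegral_prod _ hg.aemeasurable] at h2
      rw [← h2]
      refine lintegral_congr fun r => ?_
      have hgr : Measurable (fun y : τ × Orth k => f (s y.1, G (r, y.2))) :=
        hg.comp measurable_prodMk_left
      exact lintegral_map hgr (hT.prodMk hOt)
    -- For a frozen value `r` of `R`, the pair `(T, Ot)` is disintegrated along `T`, and the
    -- coupling hypothesis turns the fibre law into that of `U * O`.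
    have hstep2 : ∀ r, ∫⁻ ω, f (s (T ω), G (r, Ot ω)) ∂P
        = ∫⁻ ω, ∫⁻ U : basisStabilizer k J,
          f (s (T ω), G (r, (U : Orth k) * o (s (T ω)))) ∂ν ∂P := by
      intro r
      have hg : Measurable (fun z : τ × Orth k => f (s z.1, G (r, z.2))) :=
        hf.comp ((hs.comp measurable_fst).prodMk
          (hG.comp (measurable_const.prodMk measurable_snd)))
      have h2 := lintegral_map hg (hT.prodMk hOt) (μ := P)
      rw [← compProd_map_condDistrib hOt.aemeasurable, Measure.lintegral_compProd hg,
        lintegral_map (hg.lintegral_kernel_prod_right') hT] at h2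
      rw [← h2]
      refine lintegral_congr_ae ?_
      filter_upwards [hcond] with ω hω
      have hmul : Measurable (fun U : basisStabilizer k J => (U : Orth k) * o (s (T ω))) :=
        measurable_orth_mul.comp (f := fun U : basisStabilizer k J => ((U : Orth k), o (s (T ω))))
          (measurable_subtype_coe.prodMk measurable_const)
      have hgω : Measurable (fun y : Orth k => f (s (T ω), G (r, y))) :=
        hg.comp measurable_prodMk_left
      rw [hω, haarGivenRows]
      exact lintegral_map hgω hmul
    rw [hstep1, lintegral_congr hstep2]
    have hbig : Measurable (fun z : ρ × (Ω × basisStabilizer k J) =>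
        f (s (T z.2.1), F (s (T z.2.1), (z.1, z.2.2)))) :=
      hf.comp ((hSm.comp measurable_snd.fst).prodMk (hFm.comp
        ((hSm.comp measurable_snd.fst).prodMk (measurable_fst.prodMk measurable_snd.snd))))
    simp only [hF] at hbig
    rw [lintegral_lintegral_swap]
    · refine lintegral_congr fun ω => ?_
      have hFω : Measurable fun z => F (s (T ω), z) := hFm.comp measurable_prodMk_left
      have hfω : Measurable (fun y : E => f (s (T ω), y)) := hf.comp measurable_prodMk_left
      rw [hκa, lintegral_map hfω hFω, lintegral_prod
        (fun z => f (s (T ω), F (s (T ω), z))) (hfω.comp hFω).aemeasurable]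
      simp only [hF]
    · refine Measurable.aemeasurable ?_
      exact Measurable.lintegral_prod_right'
        (f := fun z : (ρ × Ω) × basisStabilizer k J =>
          f (s (T z.1.2), G (z.1.1, (z.2 : Orth k) * o (s (T z.1.2)))))
        (hbig.comp (g := fun z : ρ × (Ω × basisStabilizer k J) =>
            f (s (T z.2.1), G (z.1, (z.2.2 : Orth k) * o (s (T z.2.1)))))
          (f := fun z : (ρ × Ω) × basisStabilizer k J => (z.1.1, (z.1.2, z.2))) (by fun_prop))
  have hae := condDistrib_ae_eq_of_measure_eq_compProd (μ := P) (κ := κ) (fun ω => s (T ω))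
    (hG.comp (hR.prodMk hOt)).aemeasurable hjoint
  have hae' := ae_of_ae_map hSm.aemeasurable hae
  filter_upwards [hae'] with ω hω
  have e : (fun ω => G (R ω, Ot ω)) = G ∘ fun ω => (R ω, Ot ω) := rfl
  rw [e, hω, hκa]
  simp only [hF]

end CouplingLaw

/-! ### The conditional risk as a weighted sum of squares. -/

section RiskFormula

variable {m k : ℕ}

theorem measurable_design : Measurable (fun z : (Orth m × Matrix (Fin m) (Fin k) ℝ) × Orth k =>
    design z.1.1 z.1.2 z.2) := by
  refine Continuous.measurable ?_
  unfold design
  exact ((continuous_subtype_val.comp continuous_fst.fst).matrix_transpose.matrix_mul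
    continuous_fst.snd).matrix_mul (continuous_subtype_val.comp continuous_snd)

theorem sqNorm_design_mulVec (Q : Orth m) (D : Matrix (Fin m) (Fin k) ℝ) (O : Orth k)
    (v : Fin k → ℝ) : sqNorm (design Q D O *ᵥ v)
      = sqNorm (D *ᵥ ((O : Matrix (Fin k) (Fin k) ℝ) *ᵥ v)) := by
  rw [design, ← Matrix.mulVec_mulVec, ← Matrix.mulVec_mulVec, ← orth_coe_inv, sqNorm_orth_mulVec]

theorem transpose_mul_self_apply_of_ne {D : Matrix (Fin m) (Fin k) ℝ} (hD : IsSingularValueMatrix D)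
    {i j : Fin k} (hij : i ≠ j) : (Dᵀ * D) i j = 0 := by
  rw [Matrix.mul_apply]
  refine Finset.sum_eq_zero fun l _ => ?_
  rw [Matrix.transpose_apply]
  by_cases h : (l : ℕ) = i
  · rw [hD.1 l j (fun h' => hij (Fin.ext (h.symm.trans h'))), mul_zero]
  · rw [hD.1 l i h, zero_mul]

theorem sqNorm_singular_mulVec {D : Matrix (Fin m) (Fin k) ℝ} (hD : IsSingularValueMatrix D)
    (v : Fin k → ℝ) : sqNorm (D *ᵥ v) = ∑ i, (Dᵀ * D) i i * v i ^ 2 := by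
  rw [sqNorm_eq_dotProduct, Matrix.dotProduct_mulVec, ← Matrix.mulVec_transpose,
    Matrix.mulVec_mulVec, dotProduct]
  refine Finset.sum_congr rfl fun i _ => ?_
  rw [Matrix.mulVec, dotProduct, Finset.sum_eq_single i]
  · ring
  · intro j _ hj
    rw [transpose_mul_self_apply_of_ne hD hj.symm, zero_mul]
  · simp

variable {Ω τ ς : Type*} [MeasurableSpace Ω] [MeasurableSpace τ] [MeasurableSpace ς]

/-- The out-of-sample risk is a weighted square norm of the rotated estimation error. -/
theorem outOfSampleRisk_ae_eq (P : Measure Ω) [IsProbabilityMeasure P] {J : Finset ℕ}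
    (hJ : J ⊆ Finset.range k) {O Ot : Ω → Orth k} {T : Ω → τ} {S : Ω → ς} {s : τ → ς}
    {o : ς → Orth k} {Qt : Ω → Orth m} {Dt Xt : Ω → Matrix (Fin m) (Fin k) ℝ}
    (hOt : Measurable Ot) (hT : Measurable T) (hQt : Measurable Qt) (hDt : Measurable Dt)
    (hs : Measurable s) (ho : Measurable o) (hS : ∀ ω, S ω = s (T ω)) (hO : ∀ ω, O ω = o (S ω))
    (hind : IndepFun (fun ω => (Qt ω, Dt ω)) (fun ω => (T ω, Ot ω)) P)
    (hcoup : IsHaarCoupled P J O Ot T) (hsv : ∀ ω, IsSingularValueMatrix (Dt ω))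
    (hint : ∀ i, Integrable (fun ω => ((Dt ω)ᵀ * Dt ω) i i) P)
    (hXt : ∀ ω, Xt ω = design (Qt ω) (Dt ω) (Ot ω)) :
    ∀ᵐ ω ∂P, ∀ b β : Fin k → ℝ, outOfSampleRisk P Xt S b β ω
      = (1 / (m : ℝ)) * ∑ i : Fin k, specWeight k J (testSpec P Dt) i
        * ((O ω : Matrix (Fin k) (Fin k) ℝ) *ᵥ (b - β)) i ^ 2 := by
  obtain ⟨ν, hν, hνp, hcond⟩ := hcoup
  have h := condDistrib_of_haarCoupled P ν hOt hT (hQt.prodMk hDt) hs ho measurable_design hS hO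
    hind hcond
  filter_upwards [h] with ω hω b β
  rw [outOfSampleRisk, show Xt = fun ω => design (Qt ω) (Dt ω) (Ot ω) from funext hXt, hω]
  congr 1
  have hmeasG : Measurable (fun z : (Orth m × Matrix (Fin m) (Fin k) ℝ) × basisStabilizer k J =>
      design z.1.1 z.1.2 ((z.2 : Orth k) * O ω)) :=
    measurable_design.comp (f := fun z : (Orth m × Matrix (Fin m) (Fin k) ℝ) × basisStabilizer k J =>
      (z.1, (z.2 : Orth k) * O ω)) (measurable_fst.prodMk (measurable_orth_mul.comp
        (f := fun z : (Orth m × Matrix (Fin m) (Fin k) ℝ) × basisStabilizer k J =>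
          ((z.2 : Orth k), O ω)) ((measurable_subtype_coe.comp measurable_snd).prodMk
            measurable_const)))
  have hsq : Measurable (fun M : Matrix (Fin m) (Fin k) ℝ => sqNorm (M *ᵥ b - M *ᵥ β)) := by
    refine measurable_sqNorm.comp (Continuous.measurable ?_)
    exact (Continuous.matrix_mulVec continuous_id continuous_const).sub
      (Continuous.matrix_mulVec continuous_id continuous_const)
  have hprod : (P.map fun ω => (Qt ω, Dt ω)).prod ν
      = (P.prod ν).map (fun z => ((Qt z.1, Dt z.1), z.2)) := by
    have h := Measure.map_prod_map P ν (hQt.prodMk hDt) measurable_id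
    rw [Measure.map_id] at h
    exact h
  have hpm : Measurable (fun z : Ω × basisStabilizer k J => ((Qt z.1, Dt z.1), z.2)) := by
    fun_prop
  rw [hprod, Measure.map_map hmeasG hpm, integral_map (hmeasG.comp hpm).aemeasurable
    hsq.aestronglyMeasurable]
  obtain ⟨v, hv⟩ : ∃ v, v = (O ω : Matrix (Fin k) (Fin k) ℝ) *ᵥ (b - β) := ⟨_, rfl⟩
  rw [← hv]
  -- The left orthogonal factor drops out of the norm, so only the diagonal of `Dtᵀ Dt` and the
  -- randomly rotated error remain.
  have hpt : ∀ z : Ω × basisStabilizer k J,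
      sqNorm (((fun z : (Orth m × Matrix (Fin m) (Fin k) ℝ) × basisStabilizer k J =>
        design z.1.1 z.1.2 ((z.2 : Orth k) * O ω)) ∘ fun z => ((Qt z.1, Dt z.1), z.2)) z *ᵥ b
        - ((fun z : (Orth m × Matrix (Fin m) (Fin k) ℝ) × basisStabilizer k J =>
        design z.1.1 z.1.2 ((z.2 : Orth k) * O ω)) ∘ fun z => ((Qt z.1, Dt z.1), z.2)) z *ᵥ β)
      = ∑ i, ((Dt z.1)ᵀ * Dt z.1) i i
        * (((z.2 : Orth k) : Matrix (Fin k) (Fin k) ℝ) *ᵥ v) i ^ 2 := by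
    intro z
    simp only [Function.comp]
    rw [← Matrix.mulVec_sub, sqNorm_design_mulVec, orth_coe_mul, ← Matrix.mulVec_mulVec, ← hv,
      sqNorm_singular_mulVec (hsv _)]
  simp only [hpt]
  -- Spectrum and rotation are independent under the product measure: the expectation of each term
  -- is `testSpec` times the stabilizer average.
  rw [integral_finsetSum _ fun i _ => (hint i).mul_prod (integrable_stabilizer_coord_sq ν v i),
    ← sum_integral_stabilizer_coord_sq ν hJ]
  refine Finset.sum_congr rfl fun i _ => ?_
  rw [integral_prod_mul (fun ω => ((Dt ω)ᵀ * Dt ω) i i)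
    (fun U : basisStabilizer k J => (((U : Orth k) : Matrix (Fin k) (Fin k) ℝ) *ᵥ v) i ^ 2)]
  simp [testSpec]

end RiskFormula

/-! ### Diagonalization of the ridge estimator. -/

section RidgeError

variable {n k : ℕ}

/-- A vector of length `n` truncated, or extended by zero, to length `k`. -/
def padVec (k : ℕ) (z : Fin n → ℝ) (i : Fin k) : ℝ := if h : (i : ℕ) < n then z ⟨i, h⟩ else 0

theorem transpose_singular_mulVec {D : Matrix (Fin n) (Fin k) ℝ} (hD : IsSingularValueMatrix D)
    (z : Fin n → ℝ) (i : Fin k) : (Dᵀ *ᵥ z) i = diagEntry D i * padVec k z i := by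
  rw [Matrix.mulVec, dotProduct]
  by_cases h : (i : ℕ) < n
  · rw [Finset.sum_eq_single ⟨i, h⟩]
    · simp [diagEntry, padVec, h]
    · intro j _ hj
      rw [Matrix.transpose_apply, hD.1 j i (fun h' => hj (Fin.ext h')), zero_mul]
    · simp
  · rw [Finset.sum_eq_zero]
    · simp [padVec, h]
    · intro j _
      rw [Matrix.transpose_apply, hD.1 j i (fun h' => h (h' ▸ j.2)), zero_mul]

theorem transpose_mul_self_eq_diagonal {D : Matrix (Fin n) (Fin k) ℝ}
    (hD : IsSingularValueMatrix D) :
    Dᵀ * D = Matrix.diagonal fun i : Fin k => diagEntry D i ^ 2 := by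
  ext i j
  by_cases hij : i = j
  · subst hij
    rw [Matrix.diagonal_apply_eq]
    have h := transpose_singular_mulVec hD (fun l => D l i) i
    rw [Matrix.mul_apply]
    rw [Matrix.mulVec, dotProduct] at h
    rw [h]
    unfold diagEntry padVec
    by_cases hi : (i : ℕ) < n
    · simp [hi, pow_two]
    · simp [hi]
  · rw [transpose_mul_self_apply_of_ne hD hij, Matrix.diagonal_apply_ne _ hij]

/-- The estimation error of the ridge estimator in the basis of right singular vectors. -/
theorem orth_mulVec_ridge_sub {Q : Orth n} {D : Matrix (Fin n) (Fin k) ℝ} {O : Orth k}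
    (hD : IsSingularValueMatrix D) (β : Fin k → ℝ) (ε : Fin n → ℝ) {lam : ℝ} (hlam : 0 < lam)
    (i : Fin k) :
    ((O : Matrix (Fin k) (Fin k) ℝ) *ᵥ
      (ridge (design Q D O) (response (design Q D O) β ε) lam - β)) i
      = (-lam * ((O : Matrix (Fin k) (Fin k) ℝ) *ᵥ β) i
        + diagEntry D i * padVec k ((Q : Matrix (Fin n) (Fin n) ℝ) *ᵥ ε) i)
        / (diagEntry D i ^ 2 + lam) := by
  obtain ⟨X, hX⟩ : ∃ X, X = design Q D O := ⟨_, rfl⟩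
  rw [← hX]
  have hpos : ∀ i : Fin k, 0 < diagEntry D i ^ 2 + lam := fun i => by positivity
  have hXT : Xᵀ = (O : Matrix (Fin k) (Fin k) ℝ)ᵀ * Dᵀ * (Q : Matrix (Fin n) (Fin n) ℝ) := by
    rw [hX, design, Matrix.transpose_mul, Matrix.transpose_mul, Matrix.transpose_transpose,
      Matrix.mul_assoc]
  have hXX : Xᵀ * X + lam • (1 : Matrix (Fin k) (Fin k) ℝ)
      = (O : Matrix (Fin k) (Fin k) ℝ)ᵀ * Matrix.diagonal (fun i : Fin k => diagEntry D i ^ 2 + lam)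
        * (O : Matrix (Fin k) (Fin k) ℝ) := by
    have e : Matrix.diagonal (fun i : Fin k => diagEntry D i ^ 2 + lam)
        = Dᵀ * D + lam • (1 : Matrix (Fin k) (Fin k) ℝ) := by
      rw [transpose_mul_self_eq_diagonal hD, Matrix.smul_one_eq_diagonal, Matrix.diagonal_add]
    rw [e, Matrix.mul_add, Matrix.add_mul, Matrix.mul_smul, Matrix.smul_mul, Matrix.mul_one,
      orth_transpose_mul, hXT, hX, design]
    congr 1
    simp only [Matrix.mul_assoc]
    rw [← Matrix.mul_assoc (Q : Matrix (Fin n) (Fin n) ℝ) (Q : Matrix (Fin n) (Fin n) ℝ)ᵀ,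
      orth_mul_transpose, Matrix.one_mul]
  obtain ⟨G, hG⟩ : ∃ G, G = (O : Matrix (Fin k) (Fin k) ℝ)ᵀ
      * Matrix.diagonal (fun i : Fin k => (diagEntry D i ^ 2 + lam)⁻¹)
      * (O : Matrix (Fin k) (Fin k) ℝ) := ⟨_, rfl⟩
  have hGA : (Xᵀ * X + lam • (1 : Matrix (Fin k) (Fin k) ℝ))⁻¹ = G := by
    refine Matrix.inv_eq_left_inv ?_
    have e : Matrix.diagonal (fun i : Fin k => (diagEntry D i ^ 2 + lam)⁻¹)
        * Matrix.diagonal (fun i : Fin k => diagEntry D i ^ 2 + lam) = 1 := by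
      rw [Matrix.diagonal_mul_diagonal, ← Matrix.diagonal_one]
      congr 1
      funext i
      exact inv_mul_cancel₀ (hpos i).ne'
    rw [hXX, hG]
    simp only [Matrix.mul_assoc]
    rw [← Matrix.mul_assoc (O : Matrix (Fin k) (Fin k) ℝ) (O : Matrix (Fin k) (Fin k) ℝ)ᵀ,
      orth_mul_transpose, Matrix.one_mul, ← Matrix.mul_assoc (Matrix.diagonal _)
      (Matrix.diagonal _), e, Matrix.one_mul, orth_transpose_mul]
  have hunit : IsUnit (Xᵀ * X + lam • (1 : Matrix (Fin k) (Fin k) ℝ)).det := by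
    rw [hXX, Matrix.det_mul, Matrix.det_mul, mul_right_comm, ← Matrix.det_mul, orth_transpose_mul,
      Matrix.det_one, one_mul, Matrix.det_diagonal]
    exact (Finset.prod_ne_zero_iff.mpr fun i _ => (hpos i).ne').isUnit
  have hβ : β = G *ᵥ ((Xᵀ * X + lam • (1 : Matrix (Fin k) (Fin k) ℝ)) *ᵥ β) := by
    rw [← hGA, Matrix.mulVec_mulVec, Matrix.nonsing_inv_mul _ hunit, Matrix.one_mulVec]
  have herr : ridge X (response X β ε) lam - β = G *ᵥ (Xᵀ *ᵥ ε - lam • β) := by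
    have h1 : Xᵀ *ᵥ ε - lam • β = Xᵀ *ᵥ response X β ε
        - (Xᵀ * X + lam • (1 : Matrix (Fin k) (Fin k) ℝ)) *ᵥ β := by
      rw [response, Matrix.mulVec_add, Matrix.mulVec_mulVec, Matrix.add_mulVec, Matrix.smul_mulVec,
        Matrix.one_mulVec]
      abel
    rw [ridge, hGA, h1, Matrix.mulVec_sub, ← hβ]
  have hOX : (O : Matrix (Fin k) (Fin k) ℝ) *ᵥ (Xᵀ *ᵥ ε)
      = Dᵀ *ᵥ ((Q : Matrix (Fin n) (Fin n) ℝ) *ᵥ ε) := by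
    rw [hXT, Matrix.mulVec_mulVec, Matrix.mulVec_mulVec, Matrix.mul_assoc, ← Matrix.mul_assoc,
      orth_mul_transpose, Matrix.one_mul]
  rw [herr, hG, Matrix.mulVec_mulVec, Matrix.mul_assoc, ← Matrix.mul_assoc, orth_mul_transpose,
    Matrix.one_mul, ← Matrix.mulVec_mulVec, Matrix.mulVec_diagonal, Matrix.mulVec_sub,
    Matrix.mulVec_smul, hOX, Pi.sub_apply, Pi.smul_apply, smul_eq_mul,
    transpose_singular_mulVec hD]
  field_simp
  ring

/-- The rows of `O` are orthonormal, so an aligned direction becomes a spike in a single coordinate.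
-/
theorem orth_mulVec_alignedSignal (Ja : Finset ℕ) (α : ℕ → ℝ) (β' : Fin k → ℝ) (O : Orth k)
    (i : Fin k) : ((O : Matrix (Fin k) (Fin k) ℝ) *ᵥ alignedSignal n Ja α β' O) i
      = ((O : Matrix (Fin k) (Fin k) ℝ) *ᵥ β') i
        + if (i : ℕ) ∈ Ja then Real.sqrt n * α i else 0 := by
  have hrow : ∀ j : Fin k, ((O : Matrix (Fin k) (Fin k) ℝ) *ᵥ (O : Matrix (Fin k) (Fin k) ℝ) j) i
      = if i = j then 1 else 0 := by
    intro j
    have h := congrFun (congrFun (orth_mul_transpose O) i) j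
    rw [Matrix.mul_apply, Matrix.one_apply] at h
    exact h
  rw [alignedSignal, Matrix.mulVec_add, Pi.add_apply, Matrix.mulVec_sum, Finset.sum_apply,
    Finset.sum_eq_single i]
  · split_ifs with h
    · rw [Matrix.mulVec_smul, Pi.smul_apply, hrow]
      simp
    · simp
  · intro j _ hj
    split_ifs with h
    · rw [Matrix.mulVec_smul, Pi.smul_apply, hrow]
      simp [hj.symm]
    · simp
  · simp

end RidgeError

/-! ### Deterministic bounds on the risk gap and uniformity in the penalty. -/

section Deterministic

/-- The factor `λ / (D² + λ)`. -/
noncomputable def shrinkFactor (D lam : ℝ) : ℝ := lam / (D ^ 2 + lam)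

/-- The factor `D / (D² + λ)`. -/
noncomputable def gainFactor (D lam : ℝ) : ℝ := D / (D ^ 2 + lam)

theorem abs_le_mul_sq_add {c D l : ℝ} (hc : 0 < c) (hl : c ≤ l) :
    |D| ≤ (1 + 1 / c) * (D ^ 2 + l) := by
  have h1 : 1 ≤ 1 / c * l := by
    rw [one_div, inv_mul_eq_div, le_div_iff₀ hc]
    linarith
  have h2 : 0 ≤ 1 / c * D ^ 2 := by positivity
  have h3 : |D| ≤ D ^ 2 + 1 := by nlinarith [sq_nonneg (|D| - 1), sq_abs D]
  nlinarith

theorem abs_shrinkFactor_le {c D l : ℝ} (hc : 0 < c) (hl : c ≤ l) :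
    |shrinkFactor D l| ≤ 1 + 1 / c := by
  have hp : 0 < D ^ 2 + l := add_pos_of_nonneg_of_pos (sq_nonneg D) (hc.trans_le hl)
  have h1 : 0 ≤ 1 / c := by positivity
  rw [shrinkFactor, abs_div, abs_of_pos hp, div_le_iff₀ hp, abs_of_pos (by linarith)]
  nlinarith [sq_nonneg D]

theorem abs_gainFactor_le {c D l : ℝ} (hc : 0 < c) (hl : c ≤ l) :
    |gainFactor D l| ≤ 1 + 1 / c := by
  have hp : 0 < D ^ 2 + l := add_pos_of_nonneg_of_pos (sq_nonneg D) (hc.trans_le hl)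
  rw [gainFactor, abs_div, abs_of_pos hp, div_le_iff₀ hp]
  exact abs_le_mul_sq_add hc hl

/-- The difference factors as the product of the two gain factors times `l - l'`, so the Lipschitz
constant does not depend on `D`. -/
theorem abs_shrinkFactor_sub_le {c D l l' : ℝ} (hc : 0 < c) (hl : c ≤ l) (hl' : c ≤ l') :
    |shrinkFactor D l - shrinkFactor D l'| ≤ (1 + 1 / c) ^ 2 * |l - l'| := by
  have hp : 0 < D ^ 2 + l := add_pos_of_nonneg_of_pos (sq_nonneg D) (hc.trans_le hl)
  have hp' : 0 < D ^ 2 + l' := add_pos_of_nonneg_of_pos (sq_nonneg D) (hc.trans_le hl')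
  have e : shrinkFactor D l - shrinkFactor D l'
      = (gainFactor D l * gainFactor D l') * (l - l') := by
    unfold shrinkFactor gainFactor
    field_simp
    ring
  rw [e, abs_mul, abs_mul, pow_two]
  have h1 := abs_gainFactor_le (D := D) hc hl
  have h2 := abs_gainFactor_le (D := D) hc hl'
  gcongr

theorem abs_gainFactor_sub_le {c D l l' : ℝ} (hc : 0 < c) (hl : c ≤ l) (hl' : c ≤ l') :
    |gainFactor D l - gainFactor D l'| ≤ (1 + 1 / c) ^ 2 * |l - l'| := by
  have hp : 0 < D ^ 2 + l := add_pos_of_nonneg_of_pos (sq_nonneg D) (hc.trans_le hl)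
  have hp' : 0 < D ^ 2 + l' := add_pos_of_nonneg_of_pos (sq_nonneg D) (hc.trans_le hl')
  have e : gainFactor D l - gainFactor D l'
      = (gainFactor D l * (1 / (D ^ 2 + l'))) * (l' - l) := by
    unfold gainFactor
    field_simp
    ring
  rw [e, abs_mul, abs_mul, pow_two (1 + 1 / c), abs_sub_comm l' l]
  have h1 := abs_gainFactor_le (D := D) hc hl
  have h2 : |1 / (D ^ 2 + l')| ≤ 1 + 1 / c := by
    rw [abs_of_pos (by positivity)]
    have : 1 / (D ^ 2 + l') ≤ 1 / c := one_div_le_one_div_of_le hc (by nlinarith [sq_nonneg D])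
    linarith
  gcongr

theorem abs_mul_sub_mul_le {a b a' b' A L : ℝ} (ha : |a| ≤ A) (hb : |b'| ≤ A)
    (hab : |a - a'| ≤ L) (hbb : |b - b'| ≤ L) : |a * b - a' * b'| ≤ 2 * A * L := by
  have e : a * b - a' * b' = a * (b - b') + (a - a') * b' := by ring
  have hA : 0 ≤ A := (abs_nonneg a).trans ha
  have hL : 0 ≤ L := (abs_nonneg _).trans hab
  calc |a * b - a' * b'| ≤ |a| * |b - b'| + |a - a'| * |b'| := by
        rw [e, ← abs_mul, ← abs_mul]
        exact abs_add_le _ _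
    _ ≤ A * L + L * A := by gcongr
    _ = _ := by ring

/-- The difference between the risk and its deterministic equivalent, in terms of the rotated
signal `a`, the rotated noise `z` and the weights `W`. -/
noncomputable def riskGap (n : ℕ) {k : ℕ} (W D a z τ : Fin k → ℝ) (s lam : ℝ) : ℝ :=
  ∑ i, W i / n * (shrinkFactor (D i) lam ^ 2 * (a i ^ 2 - τ i)
    - 2 * (shrinkFactor (D i) lam * gainFactor (D i) lam * (a i * z i))
    + gainFactor (D i) lam ^ 2 * (z i ^ 2 - s))

theorem abs_sub_add_le (x y z : ℝ) : |x - y + z| ≤ |x| + |y| + |z| := by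
  rw [abs_le]
  constructor <;> linarith [neg_abs_le x, le_abs_self x, neg_abs_le y, le_abs_self y,
    neg_abs_le z, le_abs_self z]

theorem abs_sq_sub_le (x : ℝ) {t : ℝ} (ht : 0 ≤ t) : |x ^ 2 - t| ≤ x ^ 2 + t := by
  rw [abs_le]
  constructor <;> linarith [sq_nonneg x]

theorem abs_two_mul_mul_le (x y : ℝ) : |2 * (x * y)| ≤ x ^ 2 + y ^ 2 := by
  rw [abs_le]
  constructor <;> nlinarith [sq_nonneg (x - y), sq_nonneg (x + y)]

/-- With `A = 1 + 1/c`, both factors are bounded by `A` and are `A²`-Lipschitz in the penalty, so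
their pairwise products are `2 A³`-Lipschitz. The random parts of a summand are bounded together by
`2 a_i² + 2 z_i² + τ_i + s`. -/
theorem abs_riskGap_sub_le {n k : ℕ} {W D a z τ : Fin k → ℝ} {s C c l l' : ℝ} (hc : 0 < c)
    (hl : c ≤ l) (hl' : c ≤ l') (hW : ∀ i, 0 ≤ W i) (hWC : ∀ i, W i ≤ C) (hτ : ∀ i, 0 ≤ τ i)
    (hs : 0 ≤ s) :
    |riskGap n W D a z τ s l - riskGap n W D a z τ s l'|
      ≤ 2 * (1 + 1 / c) ^ 3 * C * ((2 * sqNorm a + 2 * sqNorm z + ∑ i, τ i + k * s) / n)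
        * |l - l'| := by
  unfold riskGap
  rw [← Finset.sum_sub_distrib]
  obtain ⟨M, hM⟩ : ∃ M, M = 2 * (1 + 1 / c) * ((1 + 1 / c) ^ 2 * |l - l'|) := ⟨_, rfl⟩
  have hM0 : 0 ≤ M := by rw [hM]; positivity
  have key : ∀ i, |W i / n * (shrinkFactor (D i) l ^ 2 * (a i ^ 2 - τ i)
      - 2 * (shrinkFactor (D i) l * gainFactor (D i) l * (a i * z i))
      + gainFactor (D i) l ^ 2 * (z i ^ 2 - s))
      - W i / n * (shrinkFactor (D i) l' ^ 2 * (a i ^ 2 - τ i)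
      - 2 * (shrinkFactor (D i) l' * gainFactor (D i) l' * (a i * z i))
      + gainFactor (D i) l' ^ 2 * (z i ^ 2 - s))|
      ≤ C / n * (M * (2 * a i ^ 2 + 2 * z i ^ 2 + τ i + s)) := by
    intro i
    have b1 := abs_shrinkFactor_le (D := D i) hc hl
    have b1' := abs_shrinkFactor_le (D := D i) hc hl'
    have b2 := abs_gainFactor_le (D := D i) hc hl
    have b2' := abs_gainFactor_le (D := D i) hc hl'
    have d1 := abs_shrinkFactor_sub_le (D := D i) hc hl hl'
    have d2 := abs_gainFactor_sub_le (D := D i) hc hl hl'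
    have p1 := abs_mul_sub_mul_le b1 b1' d1 d1
    have p2 := abs_mul_sub_mul_le b1 b2' d1 d2
    have p3 := abs_mul_sub_mul_le b2 b2' d2 d2
    rw [← hM] at p1 p2 p3
    generalize shrinkFactor (D i) l = f at *
    generalize shrinkFactor (D i) l' = f' at *
    generalize gainFactor (D i) l = g at *
    generalize gainFactor (D i) l' = g' at *
    have e : W i / n * (f ^ 2 * (a i ^ 2 - τ i) - 2 * (f * g * (a i * z i)) + g ^ 2 * (z i ^ 2 - s))
        - W i / n * (f' ^ 2 * (a i ^ 2 - τ i) - 2 * (f' * g' * (a i * z i))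
          + g' ^ 2 * (z i ^ 2 - s))
        = W i / n * ((f * f - f' * f') * (a i ^ 2 - τ i)
          - (f * g - f' * g') * (2 * (a i * z i)) + (g * g - g' * g') * (z i ^ 2 - s)) := by
      ring
    rw [e, abs_mul, abs_of_nonneg (div_nonneg (hW i) (Nat.cast_nonneg n))]
    refine mul_le_mul (div_le_div_of_nonneg_right (hWC i) (Nat.cast_nonneg n)) ?_ (abs_nonneg _)
      (div_nonneg ((hW i).trans (hWC i)) (Nat.cast_nonneg n))
    have q1 := abs_sq_sub_le (a i) (hτ i)
    have q2 := abs_two_mul_mul_le (a i) (z i)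
    have q3 := abs_sq_sub_le (z i) hs
    have r1 := mul_le_mul p1 q1 (abs_nonneg _) hM0
    have r2 := mul_le_mul p2 q2 (abs_nonneg _) hM0
    have r3 := mul_le_mul p3 q3 (abs_nonneg _) hM0
    rw [← abs_mul] at r1 r2 r3
    refine (abs_sub_add_le _ _ _).trans ?_
    linarith
  refine (Finset.abs_sum_le_sum_abs _ _).trans ((Finset.sum_le_sum fun i _ => key i).trans ?_)
  rw [← Finset.mul_sum, ← Finset.mul_sum, Finset.sum_add_distrib, Finset.sum_add_distrib,
    Finset.sum_add_distrib, ← Finset.mul_sum, ← Finset.mul_sum, hM]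
  unfold sqNorm
  simp only [Finset.sum_const, Finset.card_univ, Fintype.card_fin, nsmul_eq_mul]
  refine le_of_eq ?_
  ring

/-- Equicontinuity upgrades convergence on countably many points to uniform convergence, so almost
sure statements at single penalties can be combined. The supremum is taken in `ℝ≥0∞`, where it needs
no boundedness. -/
theorem tendsto_iSup_enorm_of_grid {F : ℕ → ℝ → ℝ} {a b L : ℝ} (hab : a < b)
    (hgrid : ∀ N j : ℕ, j ≤ N → Tendsto (fun n => F n (a + (b - a) * (j / (N + 1)))) atTop (𝓝 0))
    (hlip : ∀ᶠ n in atTop, ∀ x ∈ Set.Icc a b, ∀ y ∈ Set.Icc a b,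
      |F n x - F n y| ≤ L * |x - y|) :
    Tendsto (fun n => ⨆ x ∈ Set.Icc a b, ‖F n x‖ₑ) atTop (𝓝 0) := by
  rw [ENNReal.tendsto_nhds_zero]
  intro δ hδ
  obtain ⟨e, he0, heδ⟩ : ∃ e : ℝ, 0 < e ∧ ENNReal.ofReal e ≤ δ := by
    rcases eq_or_ne δ ⊤ with rfl | hT
    · exact ⟨1, one_pos, le_top⟩
    · exact ⟨δ.toReal, ENNReal.toReal_pos hδ.ne' hT, ENNReal.ofReal_toReal_le⟩
  have hba : 0 < b - a := sub_pos.mpr hab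
  -- The mesh `(b - a) / (N + 1)` is so fine that the oscillation over one mesh is at most `e / 2`;
  -- the other half is for the value at the grid point.
  obtain ⟨N, hN⟩ := exists_nat_gt (|L| * (b - a) / (e / 2))
  have hN1 : (0 : ℝ) < N + 1 := by positivity
  have hall : ∀ᶠ n in atTop, ∀ j ∈ Finset.range (N + 1),
      |F n (a + (b - a) * (j / (N + 1)))| < e / 2 := by
    rw [Filter.eventually_all_finset]
    intro j hj
    have h := (hgrid N j (by simpa [Nat.lt_succ_iff] using hj)).abs
    rw [abs_zero] at h
    exact h.eventually_lt_const (by linarith)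
  filter_upwards [hlip, hall] with n hl hn
  refine iSup₂_le fun x hx => le_trans ?_ heδ
  rw [Real.enorm_eq_ofReal_abs]
  refine ENNReal.ofReal_le_ofReal ?_
  obtain ⟨t, ht⟩ : ∃ t, t = (x - a) / (b - a) * (N + 1) := ⟨_, rfl⟩
  have ht0 : 0 ≤ t := by
    rw [ht]
    exact mul_nonneg (div_nonneg (sub_nonneg.mpr hx.1) hba.le) hN1.le
  have htN : t ≤ N + 1 := by
    rw [ht]
    refine mul_le_of_le_one_left hN1.le ?_
    rw [div_le_one hba]
    linarith [hx.2]
  have hxt : x = a + (b - a) * (t / (N + 1)) := by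
    rw [ht]
    field_simp
    ring
  -- The grid omits the right endpoint: `x = b` has `t = N + 1` and is assigned to `j = N`, exactly
  -- one mesh away.
  obtain ⟨j, hjN, hjt⟩ : ∃ j : ℕ, j ≤ N ∧ |t - j| ≤ 1 := by
    rcases lt_or_ge t (N + 1) with h | h
    · refine ⟨⌊t⌋₊, ?_, ?_⟩
      · have : ⌊t⌋₊ < N + 1 := (Nat.floor_lt ht0).mpr (by exact_mod_cast h)
        omega
      · have h1 := Nat.floor_le ht0
        have h2 := Nat.lt_floor_add_one t
        rw [abs_le]
        constructor <;> linarith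
    · refine ⟨N, le_rfl, ?_⟩
      rw [abs_le]
      constructor <;> linarith
  have hj1 : (j : ℝ) / (N + 1) ≤ 1 := by
    rw [div_le_one hN1]
    have : (j : ℝ) ≤ N := by exact_mod_cast hjN
    linarith
  have hj0 : (0 : ℝ) ≤ (j : ℝ) / (N + 1) := by positivity
  have hy : a + (b - a) * ((j : ℝ) / (N + 1)) ∈ Set.Icc a b := by
    constructor <;> nlinarith
  have h1 := hl x hx _ hy
  have h2 := hn j (Finset.mem_range.mpr (by omega))
  have h3 : |x - (a + (b - a) * ((j : ℝ) / (N + 1)))| ≤ (b - a) / (N + 1) := by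
    have : x - (a + (b - a) * ((j : ℝ) / (N + 1))) = (b - a) / (N + 1) * (t - j) := by
      rw [hxt]
      field_simp
      ring
    rw [this, abs_mul, abs_of_pos (by positivity)]
    exact mul_le_of_le_one_right (by positivity) hjt
  have h4 : L * |x - (a + (b - a) * ((j : ℝ) / (N + 1)))| ≤ e / 2 := by
    calc L * |x - (a + (b - a) * ((j : ℝ) / (N + 1)))|
        ≤ |L| * ((b - a) / (N + 1)) :=
          mul_le_mul (le_abs_self L) h3 (abs_nonneg _) (abs_nonneg _)
      _ ≤ e / 2 := by
          rw [div_lt_iff₀ (by linarith)] at hN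
          rw [← mul_div_assoc, div_le_iff₀ hN1]
          nlinarith
  have h5 : |F n x| ≤ |F n x - F n (a + (b - a) * ((j : ℝ) / (N + 1)))|
      + |F n (a + (b - a) * ((j : ℝ) / (N + 1)))| := by
    have := abs_add_le (F n x - F n (a + (b - a) * ((j : ℝ) / (N + 1))))
      (F n (a + (b - a) * ((j : ℝ) / (N + 1))))
    rwa [sub_add_cancel] at this
  linarith

end Deterministic

/-! ### Almost sure convergence from summable moments, and conditioning on independent variables. -/

section BorelCantelli

variable {Ω : Type*} [MeasurableSpace Ω] {P : Measure Ω}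

/-- The series of the `f n`, started late enough, has a finite integral, so it is almost surely
finite and its terms tend to zero. Only the individual laws of the `f n` enter the hypothesis. -/
theorem ae_tendsto_zero_of_lintegral_le {f : ℕ → Ω → ℝ≥0∞} (hf : ∀ n, Measurable (f n))
    {C s : ℝ} (hs : 1 < s) (h : ∀ᶠ n : ℕ in atTop, ∫⁻ ω, f n ω ∂P ≤
      ENNReal.ofReal (C * (n : ℝ) ^ (-s))) :
    ∀ᵐ ω ∂P, Tendsto (fun n => f n ω) atTop (𝓝 0) := by
  obtain ⟨N, hN⟩ := eventually_atTop.mp h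
  have hsum : ∑' n, ∫⁻ ω, f (n + N) ω ∂P ≠ ⊤ := by
    have hS : Summable (fun n : ℕ => C * (n : ℝ) ^ (-s)) :=
      (Real.summable_nat_rpow.mpr (by linarith)).mul_left C
    have hS' := ((summable_nat_add_iff N).mpr hS).tsum_ofReal_ne_top
    exact ne_top_of_le_ne_top hS' (ENNReal.tsum_le_tsum fun n => hN _ (Nat.le_add_left N n))
  rw [← lintegral_tsum fun n => (hf _).aemeasurable] at hsum
  have hae := ae_lt_top (Measurable.tsum fun n => hf (n + N)) hsum
  filter_upwards [hae] with ω hω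
  have ht := ENNReal.tendsto_cofinite_zero_of_tsum_ne_top hω.ne
  rw [Nat.cofinite_eq_atTop] at ht
  exact (tendsto_add_atTop_iff_nat N).mp ht

theorem ae_tendsto_zero_of_rpow_moment_le {Y : ℕ → Ω → ℝ} (hY : ∀ n, Measurable (Y n))
    {q C s : ℝ} (hq : 0 < q) (hs : 1 < s) (h : ∀ᶠ n : ℕ in atTop,
      ∫⁻ ω, ENNReal.ofReal (|Y n ω| ^ q) ∂P ≤ ENNReal.ofReal (C * (n : ℝ) ^ (-s))) :
    ∀ᵐ ω ∂P, Tendsto (fun n => Y n ω) atTop (𝓝 0) := by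
  have hm : ∀ n, Measurable (fun ω => ENNReal.ofReal (|Y n ω| ^ q)) := fun n =>
    (((hY n).abs).pow_const q).ennreal_ofReal
  filter_upwards [ae_tendsto_zero_of_lintegral_le hm hs h] with ω hω
  have h1 : Tendsto (fun n => |Y n ω| ^ q) atTop (𝓝 0) := by
    have := (ENNReal.tendsto_toReal ENNReal.zero_ne_top).comp hω
    refine this.congr fun n => ?_
    exact ENNReal.toReal_ofReal (Real.rpow_nonneg (abs_nonneg _) q)
  have h2 := h1.rpow_const (p := q⁻¹) (Or.inr (by positivity))
  rw [Real.zero_rpow (by positivity)] at h2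
  rw [tendsto_zero_iff_abs_tendsto_zero]
  refine h2.congr fun n => ?_
  exact Real.rpow_rpow_inv (abs_nonneg _) hq.ne'

theorem ae_tendsto_zero_of_fourth_moment_le {Y : ℕ → Ω → ℝ} (hY : ∀ n, Measurable (Y n))
    {C : ℝ} (h : ∀ᶠ n : ℕ in atTop,
      ∫⁻ ω, ENNReal.ofReal (Y n ω ^ 4) ∂P ≤ ENNReal.ofReal (C / (n : ℝ) ^ 2)) :
    ∀ᵐ ω ∂P, Tendsto (fun n => Y n ω) atTop (𝓝 0) := by
  refine ae_tendsto_zero_of_rpow_moment_le hY (q := 4) (C := C) (s := 2) (by norm_num)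
    (by norm_num) ?_
  filter_upwards [h] with n hn
  have e1 : ∀ ω, |Y n ω| ^ (4 : ℝ) = Y n ω ^ 4 := by
    intro ω
    rw [show (4 : ℝ) = ((4 : ℕ) : ℝ) by norm_num, Real.rpow_natCast]
    exact Even.pow_abs (by decide) _
  have e2 : (n : ℝ) ^ (-2 : ℝ) = ((n : ℝ) ^ 2)⁻¹ := by
    rw [Real.rpow_neg (Nat.cast_nonneg n), Real.rpow_two]
  simp only [e1, e2]
  exact hn

/-- Fubini for the product law: a bound that holds with `Y` frozen at almost every value survives
averaging over `Y`. It lets the rotation or the noise be treated as the only random object. -/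
theorem lintegral_le_of_indepFun [IsProbabilityMeasure P] {α β : Type*} [MeasurableSpace α]
    [MeasurableSpace β] {X : Ω → α} {Y : Ω → β} (hX : Measurable X) (hY : Measurable Y)
    (hind : IndepFun X Y P) {f : α → β → ℝ≥0∞} (hf : Measurable (Function.uncurry f)) {B : ℝ≥0∞}
    (h : ∀ᵐ ω ∂P, ∫⁻ ω', f (X ω') (Y ω) ∂P ≤ B) : ∫⁻ ω, f (X ω) (Y ω) ∂P ≤ B := by
  have hmap := (indepFun_iff_map_prod_eq_prod_map_map hX.aemeasurable hY.aemeasurable).mp hind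
  have : IsProbabilityMeasure (P.map X) := Measure.isProbabilityMeasure_map hX.aemeasurable
  have : IsProbabilityMeasure (P.map Y) := Measure.isProbabilityMeasure_map hY.aemeasurable
  have h1 : ∫⁻ ω, f (X ω) (Y ω) ∂P = ∫⁻ z, Function.uncurry f z ∂(P.map fun ω => (X ω, Y ω)) :=
    (lintegral_map hf (hX.prodMk hY)).symm
  have h2 : Measurable fun y => ∫⁻ x, f x y ∂(P.map X) := hf.lintegral_prod_left'
  rw [h1, hmap, lintegral_prod_symm' _ hf]
  simp only [Function.uncurry]
  rw [lintegral_map h2 hY]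
  calc ∫⁻ ω, ∫⁻ x, f x (Y ω) ∂(P.map X) ∂P ≤ ∫⁻ _, B ∂P := by
        refine lintegral_mono_ae ?_
        filter_upwards [h] with ω hω
        rwa [lintegral_map hf.of_uncurry_right hX]
    _ = B := by simp

end BorelCantelli

/-! ### Linear and quadratic forms in the noise. -/

section Noise

variable {Ω : Type*} [MeasurableSpace Ω] {P : Measure Ω} [IsProbabilityMeasure P]

theorem lintegral_linear_form_le {n : ℕ} {e : Ω → Fin n → ℝ} (hm : Measurable e)
    (hind : iIndepFun (fun (i : Fin n) ω => e ω i) P)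
    (h4 : ∀ i, Integrable (fun ω => e ω i ^ 4) P) (h0 : ∀ i, ∫ ω, e ω i ∂P = 0) {K : ℝ}
    (hK : 1 ≤ K) (hK4 : ∀ i, ∫ ω, e ω i ^ 4 ∂P ≤ K) (c : Fin n → ℝ) :
    ∫⁻ ω, ENNReal.ofReal ((c ⬝ᵥ e ω) ^ 4) ∂P ≤ ENNReal.ofReal ((4 * K * sqNorm c) ^ 2) := by
  have h := fourth_moment_linear_form_le (ε := fun i ω => e ω i)
    (fun i => (measurable_pi_apply i).comp hm) hind h4 h0 hK hK4 c Finset.univ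
  unfold dotProduct
  rw [← ofReal_integral_eq_lintegral_ofReal h.1 (Eventually.of_forall fun x => by
      show (0 : ℝ) ≤ _
      positivity)]
  exact ENNReal.ofReal_le_ofReal h.2

theorem lintegral_offDiag_form_le {n : ℕ} {e : Ω → Fin n → ℝ} (hm : Measurable e)
    (hind : iIndepFun (fun (i : Fin n) ω => e ω i) P)
    (h4 : ∀ i, Integrable (fun ω => e ω i ^ 4) P) (h0 : ∀ i, ∫ ω, e ω i ∂P = 0) {K : ℝ}
    (hK : 1 ≤ K) (hK4 : ∀ i, ∫ ω, e ω i ^ 4 ∂P ≤ K) (M : Matrix (Fin n) (Fin n) ℝ) {F : ℝ}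
    (hF : ∑ i, ∑ j, M i j ^ 2 ≤ F) :
    ∫⁻ ω, ENNReal.ofReal ((∑ i, ∑ j, if i = j then 0 else M i j * (e ω i * e ω j)) ^ 4) ∂P
      ≤ ENNReal.ofReal ((32 * K ^ 2 * F) ^ 2) := by
  have h := fourth_moment_offDiag_form_le (ε := fun i ω => e ω i)
    (fun i => (measurable_pi_apply i).comp hm) hind h4 h0 hK hK4
    (fun i j => if i = j then 0 else M i j) (fun i => by simp) Finset.univ
  simp only [ite_mul, zero_mul] at h
  rw [← ofReal_integral_eq_lintegral_ofReal h.1 (Eventually.of_forall fun x => by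
      show (0 : ℝ) ≤ _
      positivity)]
  refine ENNReal.ofReal_le_ofReal (h.2.trans ?_)
  refine pow_le_pow_left₀ (mul_nonneg (by positivity) (Finset.sum_nonneg fun i _ =>
    Finset.sum_nonneg fun j _ => sq_nonneg _)) (mul_le_mul_of_nonneg_left ?_ (by positivity)) 2
  refine le_trans (Finset.sum_le_sum fun i _ => Finset.sum_le_sum fun j _ => ?_) hF
  split_ifs
  · simpa using sq_nonneg (M i j)
  · exact le_rfl

/-- Multiplying the weights by `n` makes them bounded by `B`; the sum then has `q`-th moment of
order `n^(q/2)`, and undoing the scaling divides by `n^q`. The condition `1 ≤ B` lets `B^q` dominate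
the second moment factor `B²` too. -/
theorem lintegral_diag_form_le {n : ℕ} (hn : 0 < n) {Z : Fin n → Ω → ℝ}
    (hm : ∀ i, Measurable (Z i)) (hind : iIndepFun Z P) (h0 : ∀ i, ∫ ω, Z i ω ∂P = 0)
    {q K : ℝ} (hq2 : 2 ≤ q) (hq3 : q ≤ 3) (hK : 0 ≤ K)
    (h2 : ∀ i, Integrable (fun ω => Z i ω ^ 2) P) (h2K : ∀ i, ∫ ω, Z i ω ^ 2 ∂P ≤ K)
    (hq : ∀ i, Integrable (fun ω => |Z i ω| ^ q) P) (hqK : ∀ i, ∫ ω, |Z i ω| ^ q ∂P ≤ K)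
    {B : ℝ} (hB : 1 ≤ B) {c : Fin n → ℝ} (hc : ∀ i, |c i| ≤ B / n) :
    ∫⁻ ω, ENNReal.ofReal (|∑ i, c i * Z i ω| ^ q) ∂P
      ≤ ENNReal.ofReal (8 * (B ^ q * K) * (2 + B ^ q * K) * (n : ℝ) ^ (-(q / 2))) := by
  have hn0 : (0 : ℝ) < n := by exact_mod_cast hn
  have hn1 : (1 : ℝ) ≤ n := by exact_mod_cast hn
  have hB0 : 0 ≤ B := by linarith
  have hBq : 0 ≤ B ^ q := Real.rpow_nonneg hB0 q
  have hcn : ∀ i, |n * c i| ≤ B := by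
    intro i
    rw [abs_mul, abs_of_pos hn0]
    have := (le_div_iff₀ hn0).mp (hc i)
    linarith
  have hsq : ∀ i, (n * c i) ^ 2 ≤ B ^ q := by
    intro i
    calc (n * c i) ^ 2 = |n * c i| ^ 2 := (sq_abs _).symm
      _ ≤ B ^ 2 := pow_le_pow_left₀ (abs_nonneg _) (hcn i) 2
      _ = B ^ (2 : ℝ) := (Real.rpow_two B).symm
      _ ≤ B ^ q := Real.rpow_le_rpow_of_exponent_le hB hq2
  have hrq : ∀ i, |n * c i| ^ q ≤ B ^ q := fun i =>
    Real.rpow_le_rpow (abs_nonneg _) (hcn i) (by linarith)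
  have e2 : ∀ i ω, (n * c i * Z i ω) ^ 2 = (n * c i) ^ 2 * Z i ω ^ 2 := fun i ω => mul_pow _ _ _
  have eq : ∀ i ω, |n * c i * Z i ω| ^ q = |n * c i| ^ q * |Z i ω| ^ q := fun i ω => by
    rw [abs_mul, Real.mul_rpow (abs_nonneg _) (abs_nonneg _)]
  have h := integral_abs_sum_rpow_le (P := P) (Z := fun i ω => n * c i * Z i ω)
    (fun i => (hm i).const_mul _)
    (hind.comp (fun i x => n * c i * x) (fun i => measurable_const_mul _))
    (fun i => by rw [integral_const_mul, h0, mul_zero]) hq2 hq3 (K := B ^ q * K) (by positivity)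
    (fun i => by simp only [e2]; exact (h2 i).const_mul _)
    (fun i => by
      simp only [e2]
      rw [integral_const_mul]
      exact mul_le_mul (hsq i) (h2K i) (integral_nonneg fun ω => sq_nonneg _) hBq)
    (fun i => by simp only [eq]; exact (hq i).const_mul _)
    (fun i => by
      simp only [eq]
      rw [integral_const_mul]
      exact mul_le_mul (hrq i) (hqK i) (integral_nonneg fun ω => Real.rpow_nonneg (abs_nonneg _) _)
        hBq) hn1 Finset.univ (by simp)
  obtain ⟨-, hi, hle⟩ := h
  have hscale : ∀ ω, |∑ i, c i * Z i ω| ^ q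
      = (n : ℝ) ^ (-q) * |∑ i, n * c i * Z i ω| ^ q := by
    intro ω
    have : ∑ i, n * c i * Z i ω = n * ∑ i, c i * Z i ω := by
      rw [Finset.mul_sum]
      exact Finset.sum_congr rfl fun i _ => by ring
    rw [this, abs_mul, abs_of_pos hn0, Real.mul_rpow hn0.le (abs_nonneg _), ← mul_assoc,
      ← Real.rpow_add hn0]
    simp
  simp only [hscale]
  rw [← ofReal_integral_eq_lintegral_ofReal (hi.const_mul _) (Eventually.of_forall fun x => by
    show (0 : ℝ) ≤ _
    positivity), integral_const_mul]
  refine ENNReal.ofReal_le_ofReal ?_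
  refine (mul_le_mul_of_nonneg_left hle (by positivity)).trans (le_of_eq ?_)
  have e3 : (n : ℝ) ^ (-(q / 2)) = (n : ℝ) ^ (-q) * (n * (n : ℝ) ^ ((q - 2) / 2)) := by
    conv_rhs => rw [← Real.rpow_one_add' hn0.le (by linarith), ← Real.rpow_add hn0]
    congr 1
    ring
  rw [e3, Finset.card_univ, Fintype.card_fin]
  ring

/-- Conjugation by an orthogonal matrix preserves the trace, so the centring `s` can be moved to the
diagonal of the conjugated matrix. The diagonal part is a sum of independent centred terms, and the
off-diagonal part requires only fourth moments of `e`. -/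
theorem quadratic_form_sub_eq {n : ℕ} (A : Matrix (Fin n) (Fin n) ℝ) (hA : A * Aᵀ = 1)
    (c e : Fin n → ℝ) (s : ℝ) :
    ∑ j, c j * ((A *ᵥ e) j ^ 2 - s)
      = (∑ i, (Aᵀ * Matrix.diagonal c * A) i i * (e i ^ 2 - s))
        + ∑ i, ∑ j, if i = j then 0 else (Aᵀ * Matrix.diagonal c * A) i j * (e i * e j) := by
  obtain ⟨M, hM⟩ : ∃ M, M = Aᵀ * Matrix.diagonal c * A := ⟨_, rfl⟩
  have hq : ∑ j, c j * (A *ᵥ e) j ^ 2 = ∑ i, ∑ j, M i j * (e i * e j) := by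
    have h1 : ∑ j, c j * (A *ᵥ e) j ^ 2 = e ⬝ᵥ (M *ᵥ e) := by
      rw [hM, Matrix.mul_assoc, ← Matrix.mulVec_mulVec, Matrix.dotProduct_mulVec,
        Matrix.vecMul_transpose, ← Matrix.mulVec_mulVec, dotProduct]
      refine Finset.sum_congr rfl fun j _ => ?_
      rw [Matrix.mulVec_diagonal]
      ring
    rw [h1, dotProduct]
    refine Finset.sum_congr rfl fun i _ => ?_
    rw [Matrix.mulVec, dotProduct, Finset.mul_sum]
    exact Finset.sum_congr rfl fun j _ => by ring
  have htr : ∑ i, M i i = ∑ j, c j := by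
    have : M.trace = (Matrix.diagonal c).trace := by
      rw [hM, Matrix.trace_mul_comm, ← Matrix.mul_assoc, hA, Matrix.one_mul]
    rw [Matrix.trace_diagonal] at this
    exact this
  have hsplit : ∀ i, ∑ j, M i j * (e i * e j)
      = M i i * e i ^ 2 + ∑ j, if i = j then 0 else M i j * (e i * e j) := by
    intro i
    have : ∀ j, M i j * (e i * e j) = (if i = j then M i i * e i ^ 2 else 0)
        + if i = j then 0 else M i j * (e i * e j) := by
      intro j
      split_ifs with h
      · subst h; ring
      · ring
    rw [Finset.sum_congr rfl fun j _ => this j, Finset.sum_add_distrib]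
    simp
  rw [← hM]
  simp only [mul_sub, Finset.sum_sub_distrib, ← Finset.sum_mul, hq, htr,
    Finset.sum_congr rfl fun i _ => hsplit i, Finset.sum_add_distrib]
  ring

/-- Columns of `A` are unit vectors, so each diagonal entry is a convex combination of the `c j`. -/
theorem abs_diag_conj_le {n : ℕ} {A : Matrix (Fin n) (Fin n) ℝ} (hA : Aᵀ * A = 1)
    {c : Fin n → ℝ} {B : ℝ} (hc : ∀ i, |c i| ≤ B) (i : Fin n) :
    |(Aᵀ * Matrix.diagonal c * A) i i| ≤ B := by
  have h1 : (Aᵀ * Matrix.diagonal c * A) i i = ∑ j, c j * A j i ^ 2 := by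
    rw [Matrix.mul_apply]
    refine Finset.sum_congr rfl fun j _ => ?_
    rw [Matrix.mul_diagonal, Matrix.transpose_apply]
    ring
  have h2 : ∑ j, A j i ^ 2 = 1 := by
    have h := congrFun (congrFun hA i) i
    rw [Matrix.mul_apply, Matrix.one_apply_eq] at h
    rw [← h]
    exact Finset.sum_congr rfl fun j _ => by rw [Matrix.transpose_apply]; ring
  rw [h1]
  calc |∑ j, c j * A j i ^ 2| ≤ ∑ j, |c j * A j i ^ 2| := Finset.abs_sum_le_sum_abs _ _
    _ ≤ ∑ j, B * A j i ^ 2 := Finset.sum_le_sum fun j _ => by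
        rw [abs_mul, abs_of_nonneg (sq_nonneg (A j i))]
        exact mul_le_mul_of_nonneg_right (hc j) (sq_nonneg _)
    _ = B := by rw [← Finset.mul_sum, h2, mul_one]

/-- Each column is the image of a unit vector under an isometry, then `diagonal c`, then another
isometry, so its squared norm is at most `B²`. -/
theorem sum_sq_diag_conj_le {n : ℕ} {A : Matrix (Fin n) (Fin n) ℝ} (hA : Aᵀ * A = 1)
    (hA' : A * Aᵀ = 1) {c : Fin n → ℝ} {B : ℝ} (hc : ∀ i, |c i| ≤ B) :
    ∑ i, ∑ j, (Aᵀ * Matrix.diagonal c * A) i j ^ 2 ≤ n * B ^ 2 := by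
  have hcol : ∀ j, ∑ i, (Aᵀ * Matrix.diagonal c * A) i j ^ 2 ≤ B ^ 2 := by
    intro j
    have h1 : ∑ i, (Aᵀ * Matrix.diagonal c * A) i j ^ 2
        = sqNorm ((Aᵀ * Matrix.diagonal c * A) *ᵥ Pi.single j 1) := by
      rw [Matrix.mulVec_single_one]
      rfl
    rw [h1, Matrix.mul_assoc, ← Matrix.mulVec_mulVec,
      sqNorm_mulVec_of_transpose_mul (by rwa [Matrix.transpose_transpose]), ← Matrix.mulVec_mulVec]
    have h2 : sqNorm (A *ᵥ Pi.single j (1 : ℝ)) = 1 := by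
      rw [sqNorm_mulVec_of_transpose_mul hA, sqNorm_eq_dotProduct]
      simp
    calc sqNorm (Matrix.diagonal c *ᵥ (A *ᵥ Pi.single j 1))
        ≤ B ^ 2 * sqNorm (A *ᵥ Pi.single j (1 : ℝ)) := by
          unfold sqNorm
          rw [Finset.mul_sum]
          refine Finset.sum_le_sum fun i _ => ?_
          rw [Matrix.mulVec_diagonal, mul_pow]
          refine mul_le_mul_of_nonneg_right ?_ (sq_nonneg _)
          rw [← sq_abs]
          exact pow_le_pow_left₀ (abs_nonneg _) (hc i) 2
      _ = B ^ 2 := by rw [h2, mul_one]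
  rw [Finset.sum_comm]
  calc _ ≤ ∑ _j : Fin n, B ^ 2 := Finset.sum_le_sum fun j _ => hcol j
    _ = n * B ^ 2 := by simp

end Noise

/-! ### Moments of the centred squared noise. -/

section NoiseMoments

variable {Ω : Type*} [MeasurableSpace Ω] {P : Measure Ω}

theorem rpow_le_one_add_rpow {t a b : ℝ} (ht : 0 ≤ t) (ha : 0 ≤ a) (hab : a ≤ b) :
    t ^ a ≤ 1 + t ^ b := by
  rcases le_total t 1 with h | h
  · have h1 := Real.rpow_le_one ht h ha
    have h2 := Real.rpow_nonneg ht b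
    linarith
  · have := Real.rpow_le_rpow_of_exponent_le h hab
    linarith

theorem integrable_and_integral_le_of_le {f g : Ω → ℝ} (hf : Measurable f) (hf0 : ∀ ω, 0 ≤ f ω)
    (hg : Integrable g P) (hle : ∀ ω, f ω ≤ g ω) {K : ℝ} (hK : ∫ ω, g ω ∂P ≤ K) :
    Integrable f P ∧ ∫ ω, f ω ∂P ≤ K := by
  have hint : Integrable f P := hg.mono' hf.aestronglyMeasurable
    (Eventually.of_forall fun ω => by rw [Real.norm_eq_abs, abs_of_nonneg (hf0 ω)]; exact hle ω)
  exact ⟨hint, (integral_mono hint hg hle).trans hK⟩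

/-- Moments of `x⁴`, `(x² - s)²` and `|x² - s|^q` from a moment of order `4 + η`. -/
theorem moments_of_moment_gt_four [IsProbabilityMeasure P] {η K₀ s q : ℝ} (hs : 0 ≤ s) (hq2 : 2 ≤ q)
    (hq3 : q ≤ 3) (hqη : 2 * q ≤ 4 + η) {x : Ω → ℝ} (hx : Measurable x)
    (hint : Integrable (fun ω => |x ω| ^ (4 + η)) P) (hK : ∫ ω, |x ω| ^ (4 + η) ∂P ≤ K₀) :
    (Integrable (fun ω => x ω ^ 4) P ∧ ∫ ω, x ω ^ 4 ∂P ≤ 9 + 8 * K₀ + 8 * s ^ q) ∧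
    (Integrable (fun ω => (x ω ^ 2 - s) ^ 2) P ∧
      ∫ ω, (x ω ^ 2 - s) ^ 2 ∂P ≤ 9 + 8 * K₀ + 8 * s ^ q) ∧
    (Integrable (fun ω => |x ω ^ 2 - s| ^ q) P ∧
      ∫ ω, |x ω ^ 2 - s| ^ q ∂P ≤ 9 + 8 * K₀ + 8 * s ^ q) := by
  have hsq : 0 ≤ s ^ q := Real.rpow_nonneg hs q
  -- One dominating function serves all three claims: the factors 8 bound `2^q`, and 9 leaves room
  -- for the additional 1 in `t² ≤ 1 + t^q`.
  have hg : Integrable (fun ω => 9 + 8 * |x ω| ^ (4 + η) + 8 * s ^ q) P :=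
    ((integrable_const 9).add (hint.const_mul 8)).add (integrable_const _)
  have hgK : ∫ ω, (9 + 8 * |x ω| ^ (4 + η) + 8 * s ^ q) ∂P ≤ 9 + 8 * K₀ + 8 * s ^ q := by
    rw [integral_add (by fun_prop) (integrable_const _), integral_add (integrable_const 9) (hint.const_mul 8), integral_const_mul]
    simp
    linarith
  have hpow : ∀ ω, 0 ≤ |x ω| ^ (4 + η) := fun ω => Real.rpow_nonneg (abs_nonneg _) _
  have h3 : ∀ ω, |x ω ^ 2 - s| ^ q ≤ 8 + 8 * |x ω| ^ (4 + η) + 8 * s ^ q := by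
    intro ω
    have h1 : |x ω ^ 2 - s| ≤ 2 * max (x ω ^ 2) s := by
      have := abs_sq_sub_le (x ω) hs
      linarith [le_max_left (x ω ^ 2) s, le_max_right (x ω ^ 2) s]
    have hm : 0 ≤ max (x ω ^ 2) s := le_max_of_le_right hs
    have h2 : |x ω ^ 2 - s| ^ q ≤ 2 ^ q * max (x ω ^ 2) s ^ q := by
      rw [← Real.mul_rpow (by norm_num) hm]
      exact Real.rpow_le_rpow (abs_nonneg _) h1 (by linarith)
    have h2q : (2 : ℝ) ^ q ≤ 8 := by
      calc (2 : ℝ) ^ q ≤ 2 ^ (3 : ℝ) := Real.rpow_le_rpow_of_exponent_le (by norm_num) hq3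
        _ = 8 := by norm_num
    have hx2 : (x ω ^ 2) ^ q ≤ 1 + |x ω| ^ (4 + η) := by
      rw [← sq_abs, ← Real.rpow_two, ← Real.rpow_mul (abs_nonneg _)]
      exact rpow_le_one_add_rpow (abs_nonneg _) (by linarith) hqη
    have hmax : max (x ω ^ 2) s ^ q ≤ 1 + |x ω| ^ (4 + η) + s ^ q := by
      rcases max_choice (x ω ^ 2) s with h | h <;> rw [h]
      · linarith
      · linarith [hpow ω]
    have hmq : 0 ≤ max (x ω ^ 2) s ^ q := Real.rpow_nonneg hm q
    nlinarith
  refine ⟨integrable_and_integral_le_of_le (by fun_prop) (fun ω => by positivity) hg ?_ hgK,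
    integrable_and_integral_le_of_le (by fun_prop) (fun ω => by positivity) hg ?_ hgK,
    integrable_and_integral_le_of_le ?_ (fun ω => by positivity) hg ?_ hgK⟩
  · intro ω
    have h := rpow_le_one_add_rpow (abs_nonneg (x ω)) (show (0 : ℝ) ≤ (4 : ℕ) by norm_num)
      (show ((4 : ℕ) : ℝ) ≤ 4 + η by push_cast; linarith)
    rw [Real.rpow_natCast, Even.pow_abs (by decide)] at h
    linarith [hpow ω]
  · intro ω
    have h := rpow_le_one_add_rpow (abs_nonneg (x ω ^ 2 - s)) (show (0 : ℝ) ≤ 2 by norm_num) hq2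
    rw [Real.rpow_two, sq_abs] at h
    linarith [h3 ω]
  · exact (((hx.pow_const 2).sub_const s).abs).pow_const q
  · intro ω
    linarith [h3 ω]

end NoiseMoments

/-! ### Measurability of the building blocks. -/

section Measurability

variable {α : Type*} [MeasurableSpace α] {n k : ℕ}

@[fun_prop]
theorem Measurable.diagEntry {f : α → Matrix (Fin n) (Fin k) ℝ} (hf : Measurable f) (i : ℕ) :
    Measurable fun x => _root_.diagEntry (f x) i := by
  unfold _root_.diagEntry
  split_ifs with h
  · exact (measurable_pi_apply _).comp ((measurable_pi_apply _).comp hf)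
  · exact measurable_const

@[fun_prop]
theorem Measurable.shrinkFactor {f : α → ℝ} (hf : Measurable f) (l : ℝ) :
    Measurable fun x => _root_.shrinkFactor (f x) l := by
  unfold _root_.shrinkFactor
  fun_prop

@[fun_prop]
theorem Measurable.gainFactor {f : α → ℝ} (hf : Measurable f) (l : ℝ) :
    Measurable fun x => _root_.gainFactor (f x) l := by
  unfold _root_.gainFactor
  fun_prop

theorem Measurable.orth_mulVec {O : α → Orth k} {b : α → Fin k → ℝ} (hO : Measurable O)
    (hb : Measurable b) :
    Measurable fun x => (O x : Matrix (Fin k) (Fin k) ℝ) *ᵥ b x :=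
  measurable_orth_mulVec.comp (f := fun x => (O x, b x)) (hO.prodMk hb)

theorem Measurable.orth_mulVec_apply {O : α → Orth k} {b : α → Fin k → ℝ} (hO : Measurable O)
    (hb : Measurable b) (i : Fin k) :
    Measurable fun x => ((O x : Matrix (Fin k) (Fin k) ℝ) *ᵥ b x) i :=
  (measurable_pi_apply i).comp (hO.orth_mulVec hb)

@[fun_prop]
theorem Measurable.padVec_apply {z : α → Fin n → ℝ} (hz : Measurable z) (i : Fin k) :
    Measurable fun x => padVec k (z x) i := by
  unfold padVec
  split_ifs with h
  · exact (measurable_pi_apply _).comp hz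
  · exact measurable_const

theorem Measurable.diag_conj_apply {Q : α → Orth n} {c : α → Fin n → ℝ} (hQ : Measurable Q)
    (hc : Measurable c) (i j : Fin n) :
    Measurable fun x => ((Q x : Matrix (Fin n) (Fin n) ℝ)ᵀ * Matrix.diagonal (c x)
      * (Q x : Matrix (Fin n) (Fin n) ℝ)) i j := by
  have hent : ∀ a b, Measurable fun x => (Q x : Matrix (Fin n) (Fin n) ℝ) a b := fun a b =>
    (measurable_pi_apply b).comp ((measurable_pi_apply a).comp (measurable_subtype_coe.comp hQ))
  have e : ∀ x, ((Q x : Matrix (Fin n) (Fin n) ℝ)ᵀ * Matrix.diagonal (c x)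
      * (Q x : Matrix (Fin n) (Fin n) ℝ)) i j = ∑ l, (Q x : Matrix (Fin n) (Fin n) ℝ) l i * c x l
        * (Q x : Matrix (Fin n) (Fin n) ℝ) l j := by
    intro x
    rw [Matrix.mul_apply]
    exact Finset.sum_congr rfl fun l _ => by rw [Matrix.mul_diagonal, Matrix.transpose_apply]
  simp only [e]
  refine Finset.measurable_fun_sum _ fun l _ => ?_
  exact ((hent l i).mul ((measurable_pi_apply l).comp hc)).mul (hent l j)

end Measurability

/-! ### Passing between vectors of lengths `n` and `p`. -/

section Padding

variable {n k : ℕ}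

theorem sum_dite_fin_le (f : ℕ → ℝ) : ∑ i : Fin k, (if (i : ℕ) < n then f i else 0)
    = ∑ j : Fin n, (if (j : ℕ) < k then f j else 0) := by
  rw [Fin.sum_univ_eq_sum_range (fun i => if i < n then f i else 0) k,
    Fin.sum_univ_eq_sum_range (fun i => if i < k then f i else 0) n, ← Finset.sum_filter,
    ← Finset.sum_filter]
  congr 1
  ext a
  simp only [Finset.mem_filter, Finset.mem_range]
  tauto

/-- Padding from `n` to `k` is adjoint to padding from `k` to `n`, since both sums run over indices
below both lengths. This moves weights from the side of `p` to that of the noise. -/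
theorem sum_mul_padVec (f : Fin k → ℝ) (z : Fin n → ℝ) :
    ∑ i, f i * padVec k z i = ∑ j, padVec n f j * z j := by
  have h := sum_dite_fin_le (n := n) (k := k)
    (fun i => if h : i < k ∧ i < n then f ⟨i, h.1⟩ * z ⟨i, h.2⟩ else 0)
  have h1 : ∀ i : Fin k, f i * padVec k z i = if (i : ℕ) < n then
      (if h : (i : ℕ) < k ∧ (i : ℕ) < n then f ⟨i, h.1⟩ * z ⟨i, h.2⟩ else 0) else 0 := by
    intro i
    unfold padVec
    by_cases h : (i : ℕ) < n <;> simp [h]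
  have h2 : ∀ j : Fin n, padVec n f j * z j = if (j : ℕ) < k then
      (if h : (j : ℕ) < k ∧ (j : ℕ) < n then f ⟨j, h.1⟩ * z ⟨j, h.2⟩ else 0) else 0 := by
    intro j
    unfold padVec
    by_cases h : (j : ℕ) < k <;> simp [h]
  rw [Finset.sum_congr rfl fun i _ => h1 i, Finset.sum_congr rfl fun j _ => h2 j, h]

theorem sqNorm_padVec_le (f : Fin k → ℝ) : sqNorm (padVec n f) ≤ sqNorm f := by
  have h1 : sqNorm (padVec n f) = ∑ j, padVec n f j * padVec n f j := by
    simp [sqNorm, pow_two]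
  rw [h1, ← sum_mul_padVec, sqNorm]
  refine Finset.sum_le_sum fun i _ => ?_
  unfold padVec
  by_cases h : (i : ℕ) < n
  · simp [h, pow_two]
  · simpa [h] using sq_nonneg (f i)

theorem abs_padVec_le {f : Fin k → ℝ} {B : ℝ} (hB : 0 ≤ B) (hf : ∀ i, |f i| ≤ B) (j : Fin n) :
    |padVec n f j| ≤ B := by
  unfold padVec
  split_ifs with h
  · exact hf _
  · simpa using hB

end Padding

/-! ### Moment bounds for the pieces of the risk gap. -/

section TermMoments

variable {Ω : Type*} [MeasurableSpace Ω] {P : Measure Ω} [IsProbabilityMeasure P] {n k : ℕ}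

theorem sum_fin_ite_mem_le (J : Finset ℕ) {g : ℕ → ℝ} (hg : ∀ i, 0 ≤ g i) :
    ∑ i : Fin k, (if (i : ℕ) ∈ J then g i else 0) ≤ ∑ i ∈ J, g i := by
  rw [Fin.sum_univ_eq_sum_range (fun i => if i ∈ J then g i else 0) k, ← Finset.sum_filter]
  refine Finset.sum_le_sum_of_subset_of_nonneg ?_ fun i _ _ => hg i
  intro i hi
  exact (Finset.mem_filter.mp hi).2

/-- The signal in the basis of right singular vectors. -/
noncomputable def rotatedSignal (n : ℕ) {k : ℕ} (Ja : Finset ℕ) (α : ℕ → ℝ) (O : Orth k)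
    (b : Fin k → ℝ) (i : Fin k) : ℝ :=
  ((O : Matrix (Fin k) (Fin k) ℝ) *ᵥ b) i + if (i : ℕ) ∈ Ja then Real.sqrt n * α i else 0

theorem sqNorm_rotatedSignal_le (Ja : Finset ℕ) (α : ℕ → ℝ) (O : Orth k) (b : Fin k → ℝ) :
    sqNorm (rotatedSignal n Ja α O b) ≤ 2 * sqNorm b + 2 * (n * ∑ i ∈ Ja, α i ^ 2) := by
  have h1 : ∀ i, rotatedSignal n Ja α O b i ^ 2
      ≤ 2 * ((O : Matrix (Fin k) (Fin k) ℝ) *ᵥ b) i ^ 2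
        + 2 * (n * if (i : ℕ) ∈ Ja then α i ^ 2 else 0) := by
    intro i
    unfold rotatedSignal
    have e : (n : ℝ) * (if (i : ℕ) ∈ Ja then α i ^ 2 else 0)
        = (if (i : ℕ) ∈ Ja then Real.sqrt n * α i else 0) ^ 2 := by
      split_ifs
      · rw [mul_pow, Real.sq_sqrt (Nat.cast_nonneg n)]
      · simp
    rw [e]
    generalize ((O : Matrix (Fin k) (Fin k) ℝ) *ᵥ b) i = x
    generalize (if (i : ℕ) ∈ Ja then Real.sqrt n * α i else 0) = y
    nlinarith [sq_nonneg (x - y)]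
  have h2 := sum_fin_ite_mem_le (k := k) Ja (fun i => sq_nonneg (α i))
  calc sqNorm (rotatedSignal n Ja α O b) ≤ ∑ i : Fin k, _ := Finset.sum_le_sum fun i _ => h1 i
    _ = 2 * sqNorm b + 2 * (n * ∑ i : Fin k, if (i : ℕ) ∈ Ja then α i ^ 2 else 0) := by
        rw [Finset.sum_add_distrib, ← Finset.mul_sum, ← Finset.mul_sum, ← Finset.mul_sum,
          ← sqNorm_orth_mulVec O b]
        rfl
    _ ≤ _ := by gcongr

theorem Measurable.rotatedSignal {α' : Type*} [MeasurableSpace α'] {O : α' → Orth k}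
    {b : α' → Fin k → ℝ} (hO : Measurable O) (hb : Measurable b) (Ja : Finset ℕ) (α : ℕ → ℝ)
    (i : Fin k) : Measurable fun x => _root_.rotatedSignal n Ja α (O x) (b x) i := by
  unfold _root_.rotatedSignal
  exact (hO.orth_mulVec_apply hb i).add_const _

/-- Freezing first `b` and then `(Q, D)` leaves the Haar matrix alone, with weights of order `1/n`.
As `sqNorm b = n r²`, the factors `n` cancel in the sphere bound. The constant `C₀` is a parameter
so that a single value can serve all dimensions. -/
theorem signal_quadratic_moment_le (hn : 0 < n)
    {Q : Ω → Orth n} {D : Ω → Matrix (Fin n) (Fin k) ℝ} {O : Ω → Orth k} {b : Ω → Fin k → ℝ}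
    (hQ : Measurable Q) (hD : Measurable D) (hO : Measurable O) (hb : Measurable b)
    (hOi : IndepFun O (fun ω => (Q ω, D ω)) P)
    (hbi : IndepFun b (fun ω => (Q ω, D ω, O ω)) P) {r : ℝ}
    (hr : ∀ᵐ ω ∂P, sqNorm (b ω) = n * r ^ 2) {C₀ : ℝ}
    (hsphere : ∀ (b : Fin k → ℝ) (A : Fin k → ℝ) (B : ℝ), (∀ i, 0 ≤ A i) → (∀ i, A i ≤ B) →
      ∫⁻ V : Orth k, ENNReal.ofReal ((∑ i, A i * (((V : Matrix (Fin k) (Fin k) ℝ) *ᵥ b) i ^ 2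
        - sqNorm b / k)) ^ 4) ∂(P.map O) ≤ ENNReal.ofReal (C₀ * (sqNorm b * B) ^ 4 / k ^ 2))
    {W : Fin k → ℝ} {C lam : ℝ} (hW : ∀ i, 0 ≤ W i) (hWC : ∀ i, W i ≤ C) (hlam : 0 < lam) :
    ∫⁻ ω, ENNReal.ofReal ((∑ i, W i / n * shrinkFactor (diagEntry (D ω) i) lam ^ 2
      * (((O ω : Matrix (Fin k) (Fin k) ℝ) *ᵥ b ω) i ^ 2 - n * r ^ 2 / k)) ^ 4) ∂P
      ≤ ENNReal.ofReal (C₀ * (r ^ 2 * (C * (1 + 1 / lam) ^ 2)) ^ 4 / k ^ 2) := by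
  have hn0 : (0 : ℝ) < n := by exact_mod_cast hn
  refine lintegral_le_of_indepFun (X := fun ω => (Q ω, D ω, O ω)) (Y := b)
    (f := fun x b => ENNReal.ofReal ((∑ i, W i / n * shrinkFactor (diagEntry x.2.1 i) lam ^ 2
      * (((x.2.2 : Matrix (Fin k) (Fin k) ℝ) *ᵥ b) i ^ 2 - n * r ^ 2 / k)) ^ 4))
    (hQ.prodMk (hD.prodMk hO)) hb hbi.symm ?_ ?_
  · simp only [Function.uncurry_def]
    refine Measurable.ennreal_ofReal (Measurable.pow_const (Finset.measurable_fun_sum _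
      fun i _ => ?_) 4)
    have h1 : Measurable fun p : (Orth n × Matrix (Fin n) (Fin k) ℝ × Orth k) × (Fin k → ℝ) =>
        ((p.1.2.2 : Matrix (Fin k) (Fin k) ℝ) *ᵥ p.2) i :=
      Measurable.orth_mulVec_apply (by fun_prop) (by fun_prop) i
    have h2 : Measurable fun p : (Orth n × Matrix (Fin n) (Fin k) ℝ × Orth k) × (Fin k → ℝ) =>
        shrinkFactor (diagEntry p.1.2.1 i) lam := by fun_prop
    exact ((h2.pow_const 2).const_mul _).mul ((h1.pow_const 2).sub_const _)
  · filter_upwards [hr] with ω hω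
    refine lintegral_le_of_indepFun (X := O) (Y := fun ω => (Q ω, D ω))
      (f := fun V y => ENNReal.ofReal ((∑ i, W i / n * shrinkFactor (diagEntry y.2 i) lam ^ 2
      * (((V : Matrix (Fin k) (Fin k) ℝ) *ᵥ b ω) i ^ 2 - n * r ^ 2 / k)) ^ 4))
      hO (hQ.prodMk hD) hOi ?_ ?_
    · simp only [Function.uncurry_def]
      refine Measurable.ennreal_ofReal (Measurable.pow_const (Finset.measurable_fun_sum _
        fun i _ => ?_) 4)
      have h1 : Measurable fun p : Orth k × (Orth n × Matrix (Fin n) (Fin k) ℝ) =>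
          ((p.1 : Matrix (Fin k) (Fin k) ℝ) *ᵥ b ω) i :=
        Measurable.orth_mulVec_apply (by fun_prop) (by fun_prop) i
      have h2 : Measurable fun p : Orth k × (Orth n × Matrix (Fin n) (Fin k) ℝ) =>
          shrinkFactor (diagEntry p.2.2 i) lam := by fun_prop
      exact ((h2.pow_const 2).const_mul _).mul ((h1.pow_const 2).sub_const _)
    · refine Eventually.of_forall fun ω' => ?_
      have h := hsphere (b ω) (fun i => W i / n * shrinkFactor (diagEntry (D ω') i) lam ^ 2)
        (C / n * (1 + 1 / lam) ^ 2) (fun i => mul_nonneg (div_nonneg (hW i) hn0.le) (sq_nonneg _))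
        (fun i => by
          refine mul_le_mul (div_le_div_of_nonneg_right (hWC i) hn0.le) ?_ (sq_nonneg _)
            (div_nonneg ((hW i).trans (hWC i)) hn0.le)
          rw [← sq_abs]
          exact pow_le_pow_left₀ (abs_nonneg _) (abs_shrinkFactor_le hlam le_rfl) 2)
      rw [hω, lintegral_map _ hO] at h
      · refine h.trans (le_of_eq ?_)
        congr 4
        field_simp
      · refine Measurable.ennreal_ofReal (Measurable.pow_const (Finset.measurable_fun_sum _
          fun i _ => ?_) 4)
        have h1 : Measurable fun V : Orth k => ((V : Matrix (Fin k) (Fin k) ℝ) *ᵥ b ω) i :=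
          Measurable.orth_mulVec_apply measurable_id measurable_const i
        exact ((h1.pow_const 2).sub_const _).const_mul _

theorem signal_coordinate_moment_le (hn : 0 < n)
    {O : Ω → Orth k} {b : Ω → Fin k → ℝ} (hO : Measurable O) (hb : Measurable b)
    (hbi : IndepFun b O P) {r : ℝ} (hr : ∀ᵐ ω ∂P, sqNorm (b ω) = n * r ^ 2) {C₀ : ℝ}
    (hsphere : ∀ (b : Fin k → ℝ) (i : Fin k),
      ∫⁻ V : Orth k, ENNReal.ofReal (((V : Matrix (Fin k) (Fin k) ℝ) *ᵥ b) i ^ 4) ∂(P.map O)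
        ≤ ENNReal.ofReal (C₀ * sqNorm b ^ 2 / k ^ 2)) (i : Fin k) :
    ∫⁻ ω, ENNReal.ofReal ((((O ω : Matrix (Fin k) (Fin k) ℝ) *ᵥ b ω) i / Real.sqrt n) ^ 4) ∂P
      ≤ ENNReal.ofReal (C₀ * r ^ 4 / k ^ 2) := by
  have hn0 : (0 : ℝ) < n := by exact_mod_cast hn
  have e : ∀ x : ℝ, ENNReal.ofReal ((x / Real.sqrt n) ^ 4)
      = ENNReal.ofReal (1 / n ^ 2) * ENNReal.ofReal (x ^ 4) := by
    intro x
    rw [← ENNReal.ofReal_mul (by positivity), div_pow,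
      show Real.sqrt n ^ 4 = (Real.sqrt n ^ 2) ^ 2 by ring, Real.sq_sqrt hn0.le]
    congr 1
    ring
  refine lintegral_le_of_indepFun (X := O) (Y := b) (f := fun V b =>
    ENNReal.ofReal ((((V : Matrix (Fin k) (Fin k) ℝ) *ᵥ b) i / Real.sqrt n) ^ 4))
    hO hb hbi.symm ?_ ?_
  · simp only [Function.uncurry_def]
    have h1 : Measurable fun p : Orth k × (Fin k → ℝ) =>
        ((p.1 : Matrix (Fin k) (Fin k) ℝ) *ᵥ p.2) i :=
      Measurable.orth_mulVec_apply (by fun_prop) (by fun_prop) i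
    exact ((h1.div_const _).pow_const 4).ennreal_ofReal
  · filter_upwards [hr] with ω hω
    have h1 : Measurable fun V : Orth k => ((V : Matrix (Fin k) (Fin k) ℝ) *ᵥ b ω) i :=
      Measurable.orth_mulVec_apply measurable_id measurable_const i
    have h := hsphere (b ω) i
    rw [hω, lintegral_map ((h1.pow_const 4).ennreal_ofReal) hO] at h
    simp only [e]
    have h2 : Measurable fun ω' => ENNReal.ofReal
        (((O ω' : Matrix (Fin k) (Fin k) ℝ) *ᵥ b ω) i ^ 4) :=
      ((h1.comp hO).pow_const 4).ennreal_ofReal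
    rw [lintegral_const_mul _ h2]
    refine (mul_le_mul_right h _).trans ?_
    rw [← ENNReal.ofReal_mul (by positivity)]
    refine ENNReal.ofReal_le_ofReal (le_of_eq ?_)
    field_simp

/-- Fourth moment of the interaction between the signal and the noise. -/
theorem cross_term_moment_le (hn : 0 < n)
    {Q : Ω → Orth n} {D : Ω → Matrix (Fin n) (Fin k) ℝ} {O : Ω → Orth k} {b : Ω → Fin k → ℝ}
    {e : Ω → Fin n → ℝ}
    (hQ : Measurable Q) (hD : Measurable D) (hO : Measurable O) (hb : Measurable b)
    (he : Measurable e) (hei : IndepFun e (fun ω => (Q ω, D ω, O ω, b ω)) P) {r : ℝ}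
    (hr : ∀ᵐ ω ∂P, sqNorm (b ω) = n * r ^ 2)
    (hind : iIndepFun (fun (i : Fin n) ω => e ω i) P)
    (h4 : ∀ i, Integrable (fun ω => e ω i ^ 4) P) (h0 : ∀ i, ∫ ω, e ω i ∂P = 0) {K : ℝ}
    (hK : 1 ≤ K) (hK4 : ∀ i, ∫ ω, e ω i ^ 4 ∂P ≤ K) (Ja : Finset ℕ) (α : ℕ → ℝ)
    {W : Fin k → ℝ} {C lam : ℝ} (hW : ∀ i, 0 ≤ W i) (hWC : ∀ i, W i ≤ C) (hlam : 0 < lam) :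
    ∫⁻ ω, ENNReal.ofReal ((∑ i, W i / n * (shrinkFactor (diagEntry (D ω) i) lam
      * gainFactor (diagEntry (D ω) i) lam * (rotatedSignal n Ja α (O ω) (b ω) i
        * padVec k ((Q ω : Matrix (Fin n) (Fin n) ℝ) *ᵥ e ω) i))) ^ 4) ∂P
      ≤ ENNReal.ofReal ((4 * K * ((C * (1 + 1 / lam) ^ 2) ^ 2
        * (2 * r ^ 2 + 2 * ∑ i ∈ Ja, α i ^ 2))) ^ 2 / n ^ 2) := by
  have hn0 : (0 : ℝ) < n := by exact_mod_cast hn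
  refine lintegral_le_of_indepFun (X := e) (Y := fun ω => (Q ω, D ω, O ω, b ω))
    (f := fun x y => ENNReal.ofReal ((∑ i, W i / n * (shrinkFactor (diagEntry y.2.1 i) lam
      * gainFactor (diagEntry y.2.1 i) lam * (rotatedSignal n Ja α y.2.2.1 y.2.2.2 i
        * padVec k ((y.1 : Matrix (Fin n) (Fin n) ℝ) *ᵥ x) i))) ^ 4)) he
    (hQ.prodMk (hD.prodMk (hO.prodMk hb))) hei ?_ ?_
  · simp only [Function.uncurry_def]
    refine Measurable.ennreal_ofReal (Measurable.pow_const (Finset.measurable_fun_sum _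
      fun i _ => ?_) 4)
    have h1 : Measurable fun p : (Fin n → ℝ) × (Orth n × Matrix (Fin n) (Fin k) ℝ × Orth k
        × (Fin k → ℝ)) => rotatedSignal n Ja α p.2.2.2.1 p.2.2.2.2 i :=
      Measurable.rotatedSignal (by fun_prop) (by fun_prop) Ja α i
    have h2 : Measurable fun p : (Fin n → ℝ) × (Orth n × Matrix (Fin n) (Fin k) ℝ × Orth k
        × (Fin k → ℝ)) => (p.2.1 : Matrix (Fin n) (Fin n) ℝ) *ᵥ p.1 :=
      Measurable.orth_mulVec (by fun_prop) (by fun_prop)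
    have h3 : Measurable fun p : (Fin n → ℝ) × (Orth n × Matrix (Fin n) (Fin k) ℝ × Orth k
        × (Fin k → ℝ)) => shrinkFactor (diagEntry p.2.2.1 i) lam := by fun_prop
    have h4 : Measurable fun p : (Fin n → ℝ) × (Orth n × Matrix (Fin n) (Fin k) ℝ × Orth k
        × (Fin k → ℝ)) => gainFactor (diagEntry p.2.2.1 i) lam := by fun_prop
    exact ((h3.mul h4).mul (h1.mul (h2.padVec_apply i))).const_mul _
  · filter_upwards [hr] with ω hω
    obtain ⟨f, hf⟩ : ∃ f : Fin k → ℝ, ∀ i, f i = W i / n * (shrinkFactor (diagEntry (D ω) i) lam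
      * gainFactor (diagEntry (D ω) i) lam * rotatedSignal n Ja α (O ω) (b ω) i) :=
      ⟨_, fun _ => rfl⟩
    -- With all but the noise frozen, this is a linear form in the noise. Its coefficient vector has
    -- squared norm of order `1/n`: squared weights of order `1/n²` against a signal energy of order
    -- `n`.
    have hform : ∀ x : Fin n → ℝ, ∑ i, W i / n * (shrinkFactor (diagEntry (D ω) i) lam
      * gainFactor (diagEntry (D ω) i) lam * (rotatedSignal n Ja α (O ω) (b ω) i
        * padVec k ((Q ω : Matrix (Fin n) (Fin n) ℝ) *ᵥ x) i))
        = ((Q ω : Matrix (Fin n) (Fin n) ℝ)ᵀ *ᵥ padVec n f) ⬝ᵥ x := by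
      intro x
      rw [Matrix.mulVec_transpose, ← Matrix.dotProduct_mulVec, dotProduct, ← sum_mul_padVec]
      refine Finset.sum_congr rfl fun i _ => ?_
      rw [hf]
      ring
    simp only [hform]
    refine (lintegral_linear_form_le he hind h4 h0 hK hK4 _).trans (ENNReal.ofReal_le_ofReal ?_)
    have hQn : sqNorm ((Q ω : Matrix (Fin n) (Fin n) ℝ)ᵀ *ᵥ padVec n f) = sqNorm (padVec n f) := by
      rw [← orth_coe_inv, sqNorm_orth_mulVec]
    have hf2 : sqNorm f ≤ (C / n * (1 + 1 / lam) ^ 2) ^ 2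
        * sqNorm (rotatedSignal n Ja α (O ω) (b ω)) := by
      unfold sqNorm
      rw [Finset.mul_sum]
      refine Finset.sum_le_sum fun i _ => ?_
      rw [hf, ← mul_assoc, mul_pow]
      refine mul_le_mul_of_nonneg_right ?_ (sq_nonneg _)
      rw [← sq_abs, abs_mul, abs_mul, abs_of_nonneg (div_nonneg (hW i) hn0.le), pow_two (1 + 1 / lam)]
      have h1 := abs_shrinkFactor_le (D := diagEntry (D ω) i) hlam le_rfl
      have h2 := abs_gainFactor_le (D := diagEntry (D ω) i) hlam le_rfl
      have h3 := hW i
      have h5 := hWC i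
      have h6 : 0 ≤ C / n := div_nonneg (h3.trans h5) hn0.le
      gcongr
    have hrs := sqNorm_rotatedSignal_le (n := n) Ja α (O ω) (b ω)
    rw [hω] at hrs
    have hfin : sqNorm ((Q ω : Matrix (Fin n) (Fin n) ℝ)ᵀ *ᵥ padVec n f)
        ≤ (C * (1 + 1 / lam) ^ 2) ^ 2 * (2 * r ^ 2 + 2 * ∑ i ∈ Ja, α i ^ 2) / n := by
      rw [hQn]
      refine (sqNorm_padVec_le f).trans (hf2.trans
        ((mul_le_mul_of_nonneg_left hrs (sq_nonneg _)).trans (le_of_eq ?_)))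
      field_simp
    refine (pow_le_pow_left₀ (mul_nonneg (by linarith) (sqNorm_nonneg _))
      (mul_le_mul_of_nonneg_left hfin (by linarith)) 2).trans (le_of_eq ?_)
    field_simp

theorem abs_noiseWeight_le (hn : 0 < n) (D : Matrix (Fin n) (Fin k) ℝ) {W : Fin k → ℝ}
    {C lam : ℝ} (hC : 0 ≤ C) (hW : ∀ i, 0 ≤ W i) (hWC : ∀ i, W i ≤ C) (hlam : 0 < lam) (j : Fin n) :
    |padVec n (fun i : Fin k => W i / n * gainFactor (diagEntry D i) lam ^ 2) j|
      ≤ C * (1 + 1 / lam) ^ 2 / n := by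
  have hn0 : (0 : ℝ) < n := by exact_mod_cast hn
  refine abs_padVec_le (by positivity) (fun i => ?_) j
  have h2 := abs_gainFactor_le (D := diagEntry D i) hlam le_rfl
  have h3 := hW i
  have h5 := hWC i
  rw [abs_mul, abs_of_nonneg (div_nonneg h3 hn0.le), abs_pow, mul_div_right_comm]
  gcongr

theorem measurable_noiseWeight {β : Type*} [MeasurableSpace β] {D : β → Matrix (Fin n) (Fin k) ℝ}
    (hD : Measurable D) (W : Fin k → ℝ) (lam : ℝ) :
    Measurable fun x => padVec n (fun i : Fin k => W i / n * gainFactor (diagEntry (D x) i) lam ^ 2) :=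
  measurable_pi_lambda _ fun j => Measurable.padVec_apply (measurable_pi_lambda _ fun i =>
    ((hD.diagEntry i).gainFactor lam).pow_const 2 |>.const_mul _) j

theorem noise_diag_moment_le (hn : 0 < n)
    {Q : Ω → Orth n} {D : Ω → Matrix (Fin n) (Fin k) ℝ} {e : Ω → Fin n → ℝ}
    (hQ : Measurable Q) (hD : Measurable D)
    (he : Measurable e) (hei : IndepFun e (fun ω => (Q ω, D ω)) P)
    (hind : iIndepFun (fun (i : Fin n) ω => e ω i) P) {s q K : ℝ} (hq2 : 2 ≤ q) (hq3 : q ≤ 3)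
    (hK : 0 ≤ K) (h0 : ∀ i, ∫ ω, (e ω i ^ 2 - s) ∂P = 0)
    (h2 : ∀ i, Integrable (fun ω => (e ω i ^ 2 - s) ^ 2) P)
    (h2K : ∀ i, ∫ ω, (e ω i ^ 2 - s) ^ 2 ∂P ≤ K)
    (hq : ∀ i, Integrable (fun ω => |e ω i ^ 2 - s| ^ q) P)
    (hqK : ∀ i, ∫ ω, |e ω i ^ 2 - s| ^ q ∂P ≤ K)
    {W : Fin k → ℝ} {C lam B : ℝ} (hC : 0 ≤ C) (hW : ∀ i, 0 ≤ W i) (hWC : ∀ i, W i ≤ C)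
    (hlam : 0 < lam) (hB1 : 1 ≤ B) (hB : C * (1 + 1 / lam) ^ 2 ≤ B) :
    ∫⁻ ω, ENNReal.ofReal (|∑ i, ((Q ω : Matrix (Fin n) (Fin n) ℝ)ᵀ * Matrix.diagonal
      (padVec n (fun i : Fin k => W i / n * gainFactor (diagEntry (D ω) i) lam ^ 2))
        * (Q ω : Matrix (Fin n) (Fin n) ℝ)) i i * (e ω i ^ 2 - s)| ^ q) ∂P
      ≤ ENNReal.ofReal (8 * (B ^ q * K) * (2 + B ^ q * K) * (n : ℝ) ^ (-(q / 2))) := by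
  have hn0 : (0 : ℝ) < n := by exact_mod_cast hn
  refine lintegral_le_of_indepFun (X := e) (Y := fun ω => (Q ω, D ω))
    (f := fun x y => ENNReal.ofReal (|∑ i, ((y.1 : Matrix (Fin n) (Fin n) ℝ)ᵀ * Matrix.diagonal
      (padVec n (fun i : Fin k => W i / n * gainFactor (diagEntry y.2 i) lam ^ 2))
        * (y.1 : Matrix (Fin n) (Fin n) ℝ)) i i * (x i ^ 2 - s)| ^ q)) he
    (hQ.prodMk hD) hei ?_ (Eventually.of_forall fun ω => ?_)
  · simp only [Function.uncurry_def]
    refine Measurable.ennreal_ofReal (Measurable.pow_const (Measurable.abs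
      (Finset.measurable_fun_sum _ fun i _ => ?_)) q)
    have h1 := Measurable.diag_conj_apply
      (Q := fun p : (Fin n → ℝ) × (Orth n × Matrix (Fin n) (Fin k) ℝ) => p.2.1) (by fun_prop)
      (measurable_noiseWeight
        (D := fun p : (Fin n → ℝ) × (Orth n × Matrix (Fin n) (Fin k) ℝ) => p.2.2)
        (by fun_prop) W lam) i i
    exact h1.mul (by fun_prop)
  · exact lintegral_diag_form_le hn (Z := fun i ω => e ω i ^ 2 - s)
      (fun i => by have := (measurable_pi_apply i).comp he; exact (this.pow_const 2).sub_const s)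
      (hind.comp (fun _ x => x ^ 2 - s) (fun _ => by fun_prop)) h0 hq2 hq3 hK h2 h2K hq hqK hB1
      (fun i => (abs_diag_conj_le (orth_transpose_mul (Q ω))
        (abs_noiseWeight_le hn (D ω) hC hW hWC hlam) i).trans
        (div_le_div_of_nonneg_right hB hn0.le))

/-- With `Q` and `D` frozen, the conjugated weight matrix has squared Frobenius norm at most `n`
times the square of a weight of order `1/n`; squaring the resulting `1/n` gives the rate `n^(-2)`.
-/
theorem noise_offDiag_moment_le (hn : 0 < n)
    {Q : Ω → Orth n} {D : Ω → Matrix (Fin n) (Fin k) ℝ} {e : Ω → Fin n → ℝ}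
    (hQ : Measurable Q) (hD : Measurable D)
    (he : Measurable e) (hei : IndepFun e (fun ω => (Q ω, D ω)) P)
    (hind : iIndepFun (fun (i : Fin n) ω => e ω i) P)
    (h4 : ∀ i, Integrable (fun ω => e ω i ^ 4) P) (h0 : ∀ i, ∫ ω, e ω i ∂P = 0) {K : ℝ}
    (hK : 1 ≤ K) (hK4 : ∀ i, ∫ ω, e ω i ^ 4 ∂P ≤ K)
    {W : Fin k → ℝ} {C lam : ℝ} (hC : 0 ≤ C) (hW : ∀ i, 0 ≤ W i) (hWC : ∀ i, W i ≤ C)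
    (hlam : 0 < lam) :
    ∫⁻ ω, ENNReal.ofReal ((∑ i, ∑ j, if i = j then 0 else
      ((Q ω : Matrix (Fin n) (Fin n) ℝ)ᵀ * Matrix.diagonal
      (padVec n (fun i : Fin k => W i / n * gainFactor (diagEntry (D ω) i) lam ^ 2))
        * (Q ω : Matrix (Fin n) (Fin n) ℝ)) i j * (e ω i * e ω j)) ^ 4) ∂P
      ≤ ENNReal.ofReal ((32 * K ^ 2 * (C * (1 + 1 / lam) ^ 2) ^ 2) ^ 2 / n ^ 2) := by
  have hn0 : (0 : ℝ) < n := by exact_mod_cast hn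
  refine lintegral_le_of_indepFun (X := e) (Y := fun ω => (Q ω, D ω))
    (f := fun x y => ENNReal.ofReal ((∑ i, ∑ j, if i = j then 0 else
      ((y.1 : Matrix (Fin n) (Fin n) ℝ)ᵀ * Matrix.diagonal
      (padVec n (fun i : Fin k => W i / n * gainFactor (diagEntry y.2 i) lam ^ 2))
        * (y.1 : Matrix (Fin n) (Fin n) ℝ)) i j * (x i * x j)) ^ 4)) he
    (hQ.prodMk hD) hei ?_ (Eventually.of_forall fun ω => ?_)
  · simp only [Function.uncurry_def]
    refine Measurable.ennreal_ofReal (Measurable.pow_const (Finset.measurable_fun_sum _ fun i _ =>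
      Finset.measurable_fun_sum _ fun j _ => ?_) 4)
    have h1 := Measurable.diag_conj_apply
      (Q := fun p : (Fin n → ℝ) × (Orth n × Matrix (Fin n) (Fin k) ℝ) => p.2.1) (by fun_prop)
      (measurable_noiseWeight
        (D := fun p : (Fin n → ℝ) × (Orth n × Matrix (Fin n) (Fin k) ℝ) => p.2.2)
        (by fun_prop) W lam) i j
    split_ifs
    · exact measurable_const
    · exact h1.mul (by fun_prop)
  · refine (lintegral_offDiag_form_le he hind h4 h0 hK hK4 _
      (sum_sq_diag_conj_le (orth_transpose_mul (Q ω)) (orth_mul_transpose (Q ω))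
        (abs_noiseWeight_le hn (D ω) hC hW hWC hlam))).trans
      (ENNReal.ofReal_le_ofReal (le_of_eq ?_))
    field_simp

end TermMoments

/-! ### The risk gap and its decomposition. -/

section GapIdentities

variable {n k : ℕ}

theorem specWeight_eq (J : Finset ℕ) (d : ℕ → ℝ) (i : ℕ) :
    specWeight k J d i = if i ∈ J then d i else bulkSpec k J d := by
  unfold specWeight
  split_ifs <;> ring

theorem specWeight_scaled_bounds {J : Finset ℕ} (hJ : J ⊆ Finset.range k) {d : ℕ → ℝ} {c C : ℝ}
    (hd : ∀ i < k, 0 ≤ c * d i ∧ c * d i ≤ C) (i : Fin k) :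
    0 ≤ c * specWeight k J d i ∧ c * specWeight k J d i ≤ C := by
  rw [specWeight_eq]
  split_ifs with h
  · exact hd i i.2
  · have hcard : ((Finset.range k \ J).card : ℝ) = (k : ℝ) - J.card := by
      rw [Finset.card_sdiff_of_subset hJ, Nat.cast_sub (Finset.card_le_card hJ), Finset.card_range]
    -- The index `i` itself lies outside `J`, so the bulk weight is a genuine average and inherits
    -- the bounds.
    have hpos : 0 < (k : ℝ) - J.card := by
      rw [← hcard, Nat.cast_pos]
      exact Finset.card_pos.mpr ⟨i, by simp [h]⟩
    have e : c * bulkSpec k J d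
        = (∑ j ∈ Finset.range k \ J, c * d j) / ((k : ℝ) - J.card) := by
      unfold bulkSpec
      rw [← Finset.mul_sum]
      ring
    have hmem : ∀ j ∈ Finset.range k \ J, j < k := fun j hj =>
      Finset.mem_range.mp (Finset.mem_sdiff.mp hj).1
    rw [e]
    refine ⟨div_nonneg (Finset.sum_nonneg fun j hj => (hd j (hmem j hj)).1) hpos.le, ?_⟩
    rw [div_le_iff₀ hpos, ← hcard]
    calc ∑ j ∈ Finset.range k \ J, c * d j ≤ ∑ _j ∈ Finset.range k \ J, C :=
          Finset.sum_le_sum fun j hj => (hd j (hmem j hj)).2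
      _ = _ := by rw [Finset.sum_const, nsmul_eq_mul, mul_comm]

theorem diagEntry_eq_zero {D : Matrix (Fin n) (Fin k) ℝ} {i : ℕ} (h : ¬(i < n ∧ i < k)) :
    diagEntry D i = 0 := dif_neg h

theorem sum_range_eq_sum_fin {g : ℕ → ℝ} (hg : ∀ i, ¬(i < n ∧ i < k) → g i = 0) :
    ∑ i ∈ Finset.range n, g i = ∑ i : Fin k, g i := by
  have h := sum_dite_fin_le (n := n) (k := k) g
  have h1 : ∀ i : Fin k, g i = if (i : ℕ) < n then g i else 0 := fun i => by
    split_ifs with hi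
    · rfl
    · exact hg i fun h => hi h.1
  have h2 : ∀ j : Fin n, g j = if (j : ℕ) < k then g j else 0 := fun j => by
    split_ifs with hj
    · rfl
    · exact hg j fun h => hj h.2
  rw [← Fin.sum_univ_eq_sum_range, Finset.sum_congr rfl fun j _ => h2 j,
    Finset.sum_congr rfl fun i _ => h1 i, h]

/-- The centring `r²/γ + 1(i ∈ Ja) n α_i²` of the squared signal. -/
noncomputable def signalEnergy (n : ℕ) (Ja : Finset ℕ) (α : ℕ → ℝ) (r γ : ℝ) (i : ℕ) : ℝ :=
  r ^ 2 / γ + if i ∈ Ja then n * α i ^ 2 else 0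

/-- The identity holds term by term once the variance sum, which runs to `n`, is carried over to
`Fin k`; this changes nothing, since `diagEntry` vanishes beyond either dimension. -/
theorem risk_sub_formula_eq_riskGap (hn : 0 < n) (n' : ℕ) (D : Matrix (Fin n) (Fin k) ℝ)
    (Ja Jc : Finset ℕ) (α d : ℕ → ℝ) (r γ σ : ℝ) (a z : Fin k → ℝ) {lam : ℝ} (hlam : 0 < lam) :
    (1 / (n' : ℝ)) * ∑ i : Fin k, specWeight k Jc d i
        * ((-lam * a i + diagEntry D i * z i) / (diagEntry D i ^ 2 + lam)) ^ 2
      - (biasFormula n n' D Ja Jc α d r γ lam + varFormula n n' D Jc d σ lam)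
      = riskGap n (fun i => (n : ℝ) / n' * specWeight k Jc d i) (fun i => diagEntry D i) a z
        (fun i => signalEnergy n Ja α r γ i) (σ ^ 2) lam := by
  have hn0 : (n : ℝ) ≠ 0 := by exact_mod_cast hn.ne'
  have hv : ∑ i ∈ Finset.range n, diagEntry D i ^ 2 / (diagEntry D i ^ 2 + lam) ^ 2 *
      (bulkSpec k Jc d + if i ∈ Jc then d i - bulkSpec k Jc d else 0)
      = ∑ i : Fin k, diagEntry D i ^ 2 / (diagEntry D i ^ 2 + lam) ^ 2 *
      (bulkSpec k Jc d + if (i : ℕ) ∈ Jc then d i - bulkSpec k Jc d else 0) :=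
    sum_range_eq_sum_fin (g := fun i => diagEntry D i ^ 2 / (diagEntry D i ^ 2 + lam) ^ 2 *
      (bulkSpec k Jc d + if i ∈ Jc then d i - bulkSpec k Jc d else 0))
      fun i hi => by simp [diagEntry_eq_zero hi]
  unfold biasFormula varFormula
  rw [hv, ← Fin.sum_univ_eq_sum_range (fun i => ((r ^ 2 / γ + if i ∈ Ja then n * α i ^ 2 else 0) *
      (bulkSpec k Jc d + if i ∈ Jc then d i - bulkSpec k Jc d else 0)) /
      (diagEntry D i ^ 2 + lam) ^ 2), Finset.mul_sum, Finset.mul_sum, Finset.mul_sum,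
    ← Finset.sum_add_distrib, ← Finset.sum_sub_distrib]
  unfold riskGap
  refine Finset.sum_congr rfl fun i _ => ?_
  have hpos : diagEntry D i ^ 2 + lam ≠ 0 := by positivity
  have e1 : specWeight k Jc d i
      = bulkSpec k Jc d + if (i : ℕ) ∈ Jc then d i - bulkSpec k Jc d else 0 := rfl
  have e2 : signalEnergy n Ja α r γ i = r ^ 2 / γ + if (i : ℕ) ∈ Ja then n * α i ^ 2 else 0 := rfl
  have e3 : (n : ℝ) / n' * specWeight k Jc d i / n = 1 / n' * specWeight k Jc d i := by
    field_simp
  rw [← e1, ← e2, e3]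
  unfold shrinkFactor gainFactor
  rw [show lam ^ 2 / (n' : ℝ) = lam ^ 2 * (1 / n') by ring,
    show σ ^ 2 / (n' : ℝ) = σ ^ 2 * (1 / n') by ring]
  generalize (1 / (n' : ℝ)) = t
  beta_reduce
  generalize specWeight k Jc d i = w
  generalize signalEnergy n Ja α r γ i = e
  generalize diagEntry D i = x at hpos ⊢
  field_simp
  ring

/-- Padded coordinates beyond `n` would each contribute `-s`; the vanishing weights remove them. -/
theorem sum_mul_padVec_sq_sub (c : Fin k → ℝ) (hc : ∀ i : Fin k, n ≤ (i : ℕ) → c i = 0)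
    (z : Fin n → ℝ) (s : ℝ) :
    ∑ i, c i * (padVec k z i ^ 2 - s) = ∑ j, padVec n c j * (z j ^ 2 - s) := by
  rw [← sum_mul_padVec c (fun j => z j ^ 2 - s)]
  refine Finset.sum_congr rfl fun i _ => ?_
  unfold padVec
  split_ifs with h
  · rfl
  · rw [hc i (not_lt.mp h), zero_mul, zero_mul]

/-- The summands are, in order: the centred form on the sphere, the error in the ratio `p / n`, the
interaction of the spikes with the unaligned signal, the interaction of signal and noise, and the
diagonal and off-diagonal noise forms. -/
theorem riskGap_eq (W : Fin k → ℝ) (D : Matrix (Fin n) (Fin k) ℝ) (Q : Orth n) (O : Orth k)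
    (b : Fin k → ℝ) (e : Fin n → ℝ) (Ja : Finset ℕ) (α : ℕ → ℝ) (r γ s lam : ℝ) :
    riskGap n W (fun i => diagEntry D i) (rotatedSignal n Ja α O b)
        (padVec k ((Q : Matrix (Fin n) (Fin n) ℝ) *ᵥ e)) (fun i => signalEnergy n Ja α r γ i) s lam
      = (∑ i, W i / n * shrinkFactor (diagEntry D i) lam ^ 2
          * (((O : Matrix (Fin k) (Fin k) ℝ) *ᵥ b) i ^ 2 - n * r ^ 2 / k))
        + (∑ i, W i / n * shrinkFactor (diagEntry D i) lam ^ 2) * (n * r ^ 2 / k - r ^ 2 / γ)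
        + (∑ i : Fin k, W i / n * shrinkFactor (diagEntry D i) lam ^ 2 * if (i : ℕ) ∈ Ja then
            2 * Real.sqrt n * α i * ((O : Matrix (Fin k) (Fin k) ℝ) *ᵥ b) i else 0)
        - 2 * (∑ i, W i / n * (shrinkFactor (diagEntry D i) lam
            * gainFactor (diagEntry D i) lam * (rotatedSignal n Ja α O b i
            * padVec k ((Q : Matrix (Fin n) (Fin n) ℝ) *ᵥ e) i)))
        + ((∑ i, ((Q : Matrix (Fin n) (Fin n) ℝ)ᵀ * Matrix.diagonal
            (padVec n (fun i : Fin k => W i / n * gainFactor (diagEntry D i) lam ^ 2))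
            * (Q : Matrix (Fin n) (Fin n) ℝ)) i i * (e i ^ 2 - s))
          + ∑ i, ∑ j, if i = j then 0 else ((Q : Matrix (Fin n) (Fin n) ℝ)ᵀ * Matrix.diagonal
            (padVec n (fun i : Fin k => W i / n * gainFactor (diagEntry D i) lam ^ 2))
            * (Q : Matrix (Fin n) (Fin n) ℝ)) i j * (e i * e j)) := by
  rw [← quadratic_form_sub_eq _ (orth_mul_transpose Q), ← sum_mul_padVec_sq_sub]
  · unfold riskGap
    rw [Finset.sum_mul, Finset.mul_sum, ← Finset.sum_add_distrib, ← Finset.sum_add_distrib,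
      ← Finset.sum_sub_distrib, ← Finset.sum_add_distrib]
    refine Finset.sum_congr rfl fun i _ => ?_
    -- On an aligned coordinate the square of the spike cancels `n α_i²` and leaves only the double
    -- product.
    have e1 : rotatedSignal n Ja α O b i ^ 2 - signalEnergy n Ja α r γ i
        = (((O : Matrix (Fin k) (Fin k) ℝ) *ᵥ b) i ^ 2 - n * r ^ 2 / k)
          + (n * r ^ 2 / k - r ^ 2 / γ) + if (i : ℕ) ∈ Ja then
            2 * Real.sqrt n * α i * ((O : Matrix (Fin k) (Fin k) ℝ) *ᵥ b) i else 0 := by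
      unfold rotatedSignal signalEnergy
      split_ifs
      · have := Real.sq_sqrt (Nat.cast_nonneg (α := ℝ) n)
        linear_combination (α i ^ 2) * this
      · ring
    rw [e1]
    ring
  · intro i hi
    rw [diagEntry_eq_zero fun h => absurd h.1 (not_lt.mpr hi)]
    simp [gainFactor]

/-- Since `√n / n = 1 / √n`, only finitely many normalised coordinates of the rotated signal are
involved, and the bound sums over the fixed set `Ja`. -/
theorem abs_alignment_term_le {W : Fin k → ℝ} {C lam : ℝ} (hC : 0 ≤ C) (hW : ∀ i, 0 ≤ W i)
    (hWC : ∀ i, W i ≤ C) (hlam : 0 < lam) (hn : 0 < n) (D : Fin k → ℝ) (Ja : Finset ℕ) (α : ℕ → ℝ)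
    (u : Fin k → ℝ) :
    |∑ i : Fin k, W i / n * shrinkFactor (D i) lam ^ 2 * if (i : ℕ) ∈ Ja then
      2 * Real.sqrt n * α i * u i else 0|
    ≤ ∑ j ∈ Ja, 2 * (C * (1 + 1 / lam) ^ 2) * |α j|
      * |if h : j < k then u ⟨j, h⟩ / Real.sqrt n else 0| := by
  have hn0 : (0 : ℝ) < n := by exact_mod_cast hn
  refine (Finset.abs_sum_le_sum_abs _ _).trans (le_trans (Finset.sum_le_sum fun i _ => ?_)
    (sum_fin_ite_mem_le (k := k) Ja (g := fun j => 2 * (C * (1 + 1 / lam) ^ 2) * |α j|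
      * |if h : j < k then u ⟨j, h⟩ / Real.sqrt n else 0|) fun j => by positivity))
  split_ifs with h1 h2
  · have hs : Real.sqrt n * Real.sqrt n = n := Real.mul_self_sqrt hn0.le
    have hs0 : 0 < Real.sqrt n := Real.sqrt_pos.mpr hn0
    have e : W i / n * shrinkFactor (D i) lam ^ 2 * (2 * Real.sqrt n * α i * u i)
        = 2 * (W i * shrinkFactor (D i) lam ^ 2) * α i * (u i / Real.sqrt n) := by
      have hx : W i / (n : ℝ) = W i / (Real.sqrt n * Real.sqrt n) := by rw [hs]
      rw [hx]
      field_simp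
    have h3 := abs_shrinkFactor_le (D := D i) hlam le_rfl
    rw [e, abs_mul, abs_mul, abs_mul, abs_mul, abs_pow, abs_of_nonneg (hW i), abs_two]
    have := hWC i
    gcongr
  · exact absurd i.2 h2
  · simp

end GapIdentities

/-! ### Almost sure limits for a fixed penalty. -/

section AlmostSureLimits

theorem isMulLeftInvariant_of_isHaarDistributed {Ω : Type*} [MeasurableSpace Ω] {P : Measure Ω} {k : ℕ}
    {O : Ω → Orth k}
    (hO : IsHaarDistributed P O) : (P.map O).IsMulLeftInvariant :=
  have : (P.map O).IsHaarMeasure := hO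
  inferInstance

variable {Ω : Type*} [MeasurableSpace Ω] {P : Measure Ω} [IsProbabilityMeasure P]
  {p : ℕ → ℕ} {γ : ℝ}
  {Q : ∀ n, Ω → Orth n} {D : ∀ n, Ω → Matrix (Fin n) (Fin (p n)) ℝ} {O : ∀ n, Ω → Orth (p n)}
  {b : ∀ n, Ω → Fin (p n) → ℝ} {e : ∀ n, Ω → Fin n → ℝ}
  {W : ∀ n, Fin (p n) → ℝ} {C lam r s : ℝ} {Ja : Finset ℕ} {α : ℕ → ℝ}

theorem eventually_dim_pos (hγ : 0 < γ)
    (hp : Tendsto (fun n => (p n : ℝ) / (n : ℝ)) atTop (𝓝 γ)) :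
    ∀ᶠ n in atTop, 0 < n ∧ 0 < p n ∧ γ / 2 * n ≤ p n ∧ (p n : ℝ) / n ≤ 2 * γ := by
  filter_upwards [eventually_gt_atTop 0, hp.eventually_const_lt (u := γ / 2) (by linarith),
    hp.eventually_lt_const (u := 2 * γ) (by linarith)] with n hn h1 h2
  have hn0 : (0 : ℝ) < n := by exact_mod_cast hn
  have h3 : γ / 2 * n < p n := (lt_div_iff₀ hn0).mp h1
  refine ⟨hn, ?_, h3.le, h2.le⟩
  have : (0 : ℝ) < p n := lt_trans (by positivity) h3
  exact_mod_cast this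

theorem eventually_div_dim_sq_le (hγ : 0 < γ)
    (hp : Tendsto (fun n => (p n : ℝ) / (n : ℝ)) atTop (𝓝 γ)) {A : ℝ} (hA : 0 ≤ A) :
    ∀ᶠ n : ℕ in atTop, A / (p n : ℝ) ^ 2 ≤ A * (2 / γ) ^ 2 / (n : ℝ) ^ 2 := by
  filter_upwards [eventually_dim_pos hγ hp] with n hn
  have hn0 : (0 : ℝ) < n := by exact_mod_cast hn.1
  have h : (γ / 2 * n) ^ 2 ≤ (p n : ℝ) ^ 2 := pow_le_pow_left₀ (by positivity) hn.2.2.1 2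
  calc A / (p n : ℝ) ^ 2 ≤ A / (γ / 2 * n) ^ 2 := div_le_div_of_nonneg_left hA (by positivity) h
    _ = _ := by field_simp

theorem ae_tendsto_signal_quadratic (hγ : 0 < γ)
    (hp : Tendsto (fun n => (p n : ℝ) / (n : ℝ)) atTop (𝓝 γ))
    (hQ : ∀ n, Measurable (Q n)) (hD : ∀ n, Measurable (D n)) (hO : ∀ n, Measurable (O n))
    (hb : ∀ n, Measurable (b n)) (hHaar : ∀ n, IsHaarDistributed P (O n))
    (hOi : ∀ n, IndepFun (O n) (fun ω => (Q n ω, D n ω)) P)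
    (hbi : ∀ n, IndepFun (b n) (fun ω => (Q n ω, D n ω, O n ω)) P)
    (hr : ∀ᶠ n in atTop, ∀ᵐ ω ∂P, sqNorm (b n ω) = n * r ^ 2)
    (hW : ∀ᶠ n in atTop, ∀ i, 0 ≤ W n i ∧ W n i ≤ C) (hlam : 0 < lam) :
    ∀ᵐ ω ∂P, Tendsto (fun n => ∑ i, W n i / n * shrinkFactor (diagEntry (D n ω) i) lam ^ 2
      * (((O n ω : Matrix (Fin (p n)) (Fin (p n)) ℝ) *ᵥ b n ω) i ^ 2 - n * r ^ 2 / p n))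
      atTop (𝓝 0) := by
  obtain ⟨C₀, hC₀, hsphere⟩ := exists_sphere_quadratic_bound
  have hA : 0 ≤ C₀ * (r ^ 2 * (C * (1 + 1 / lam) ^ 2)) ^ 4 := by positivity
  refine ae_tendsto_zero_of_fourth_moment_le
    (C := C₀ * (r ^ 2 * (C * (1 + 1 / lam) ^ 2)) ^ 4 * (2 / γ) ^ 2) (fun n => ?_) ?_
  · refine Finset.measurable_fun_sum _ fun i _ => ?_
    have h2 : Measurable fun ω => shrinkFactor (diagEntry (D n ω) i) lam := by
      have := hD n
      fun_prop
    exact ((h2.pow_const 2).const_mul _).mul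
      ((((hO n).orth_mulVec_apply (hb n) i).pow_const 2).sub_const _)
  · filter_upwards [eventually_dim_pos hγ hp, eventually_div_dim_sq_le hγ hp hA, hr, hW]
      with n hn hle hrn hWn
    have := isMulLeftInvariant_of_isHaarDistributed (hHaar n)
    have : IsProbabilityMeasure (P.map (O n)) :=
      Measure.isProbabilityMeasure_map (hO n).aemeasurable
    exact (signal_quadratic_moment_le hn.1 (hQ n) (hD n) (hO n) (hb n) (hOi n) (hbi n) hrn
      (fun b A B h h' => hsphere (p n) (P.map (O n)) b A B hn.2.1 h h') (fun i => (hWn i).1)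
      (fun i => (hWn i).2) hlam).trans (ENNReal.ofReal_le_ofReal hle)

theorem ae_tendsto_signal_coordinate (hγ : 0 < γ)
    (hp : Tendsto (fun n => (p n : ℝ) / (n : ℝ)) atTop (𝓝 γ))
    (hO : ∀ n, Measurable (O n))
    (hb : ∀ n, Measurable (b n)) (hHaar : ∀ n, IsHaarDistributed P (O n))
    (hbi : ∀ n, IndepFun (b n) (O n) P)
    (hr : ∀ᶠ n in atTop, ∀ᵐ ω ∂P, sqNorm (b n ω) = n * r ^ 2) (j : ℕ) :
    ∀ᵐ ω ∂P, Tendsto (fun n : ℕ => if h : j < p n then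
      ((O n ω : Matrix (Fin (p n)) (Fin (p n)) ℝ) *ᵥ b n ω) ⟨j, h⟩ / Real.sqrt n else 0)
      atTop (𝓝 0) := by
  obtain ⟨C₀, hC₀, hsphere⟩ := exists_sphere_coordinate_bound
  have hA : 0 ≤ C₀ * r ^ 4 := by positivity
  refine ae_tendsto_zero_of_fourth_moment_le (C := C₀ * r ^ 4 * (2 / γ) ^ 2) (fun n => ?_) ?_
  · split_ifs with h
    · exact ((hO n).orth_mulVec_apply (hb n) _).div_const _
    · exact measurable_const
  · filter_upwards [eventually_dim_pos hγ hp, eventually_div_dim_sq_le hγ hp hA, hr]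
      with n hn hle hrn
    have := isMulLeftInvariant_of_isHaarDistributed (hHaar n)
    have : IsProbabilityMeasure (P.map (O n)) :=
      Measure.isProbabilityMeasure_map (hO n).aemeasurable
    split_ifs with h
    · exact (signal_coordinate_moment_le hn.1 (hO n) (hb n) (hbi n) hrn
        (fun b i => hsphere (p n) (P.map (O n)) b i) ⟨j, h⟩).trans (ENNReal.ofReal_le_ofReal hle)
    · simp

theorem ae_tendsto_cross_term
    (hQ : ∀ n, Measurable (Q n)) (hD : ∀ n, Measurable (D n)) (hO : ∀ n, Measurable (O n))
    (hb : ∀ n, Measurable (b n)) (he : ∀ n, Measurable (e n))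
    (hei : ∀ n, IndepFun (e n) (fun ω => (Q n ω, D n ω, O n ω, b n ω)) P)
    (hr : ∀ᶠ n in atTop, ∀ᵐ ω ∂P, sqNorm (b n ω) = n * r ^ 2)
    (hind : ∀ n, iIndepFun (fun (i : Fin n) ω => e n ω i) P)
    (h4 : ∀ n i, Integrable (fun ω => e n ω i ^ 4) P) (h0 : ∀ n i, ∫ ω, e n ω i ∂P = 0) {K : ℝ}
    (hK : 1 ≤ K) (hK4 : ∀ n i, ∫ ω, e n ω i ^ 4 ∂P ≤ K) (Ja : Finset ℕ) (α : ℕ → ℝ)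
    (hW : ∀ᶠ n in atTop, ∀ i, 0 ≤ W n i ∧ W n i ≤ C) (hlam : 0 < lam) :
    ∀ᵐ ω ∂P, Tendsto (fun n => ∑ i, W n i / n * (shrinkFactor (diagEntry (D n ω) i) lam
      * gainFactor (diagEntry (D n ω) i) lam * (rotatedSignal n Ja α (O n ω) (b n ω) i
        * padVec (p n) ((Q n ω : Matrix (Fin n) (Fin n) ℝ) *ᵥ e n ω) i))) atTop (𝓝 0) := by
  refine ae_tendsto_zero_of_fourth_moment_le (C := (4 * K * ((C * (1 + 1 / lam) ^ 2) ^ 2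
        * (2 * r ^ 2 + 2 * ∑ i ∈ Ja, α i ^ 2))) ^ 2) (fun n => ?_) ?_
  · refine Finset.measurable_fun_sum _ fun i _ => ?_
    have h2 : Measurable fun ω => shrinkFactor (diagEntry (D n ω) i) lam := by
      have := hD n
      fun_prop
    have h3 : Measurable fun ω => gainFactor (diagEntry (D n ω) i) lam := by
      have := hD n
      fun_prop
    exact ((h2.mul h3).mul (((hO n).rotatedSignal (hb n) Ja α i).mul
      (((hQ n).orth_mulVec (he n)).padVec_apply i))).const_mul _
  · filter_upwards [eventually_gt_atTop 0, hr, hW] with n hn hrn hWn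
    exact cross_term_moment_le hn (hQ n) (hD n) (hO n) (hb n) (he n) (hei n) hrn (hind n) (h4 n)
      (h0 n) hK (hK4 n) Ja α (fun i => (hWn i).1) (fun i => (hWn i).2) hlam

theorem ae_tendsto_noise_diag
    (hQ : ∀ n, Measurable (Q n)) (hD : ∀ n, Measurable (D n)) (he : ∀ n, Measurable (e n))
    (hei : ∀ n, IndepFun (e n) (fun ω => (Q n ω, D n ω)) P)
    (hind : ∀ n, iIndepFun (fun (i : Fin n) ω => e n ω i) P) {q K : ℝ} (hq2 : 2 < q) (hq3 : q ≤ 3)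
    (hK : 0 ≤ K) (h0 : ∀ n i, ∫ ω, (e n ω i ^ 2 - s) ∂P = 0)
    (h2 : ∀ n i, Integrable (fun ω => (e n ω i ^ 2 - s) ^ 2) P ∧
      ∫ ω, (e n ω i ^ 2 - s) ^ 2 ∂P ≤ K)
    (hq : ∀ n i, Integrable (fun ω => |e n ω i ^ 2 - s| ^ q) P ∧
      ∫ ω, |e n ω i ^ 2 - s| ^ q ∂P ≤ K)
    (hC : 0 ≤ C) (hW : ∀ᶠ n in atTop, ∀ i, 0 ≤ W n i ∧ W n i ≤ C) (hlam : 0 < lam) :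
    ∀ᵐ ω ∂P, Tendsto (fun n => ∑ i, ((Q n ω : Matrix (Fin n) (Fin n) ℝ)ᵀ * Matrix.diagonal
      (padVec n (fun i : Fin (p n) => W n i / n * gainFactor (diagEntry (D n ω) i) lam ^ 2))
        * (Q n ω : Matrix (Fin n) (Fin n) ℝ)) i i * (e n ω i ^ 2 - s)) atTop (𝓝 0) := by
  obtain ⟨B, hB⟩ : ∃ B, B = max 1 (C * (1 + 1 / lam) ^ 2) := ⟨_, rfl⟩
  -- The rate `n^(-q/2)` is summable because `q > 2`, which is where noise moments beyond the fourth
  -- are needed.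
  refine ae_tendsto_zero_of_rpow_moment_le (q := q) (s := q / 2)
    (C := 8 * (B ^ q * K) * (2 + B ^ q * K)) (fun n => ?_) (by linarith) (by linarith) ?_
  · refine Finset.measurable_fun_sum _ fun i _ => ?_
    have h1 := Measurable.diag_conj_apply (hQ n) (measurable_noiseWeight (hD n) (W n) lam) i i
    have h2 : Measurable fun ω => e n ω i := (measurable_pi_apply i).comp (he n)
    exact h1.mul ((h2.pow_const 2).sub_const s)
  · filter_upwards [eventually_gt_atTop 0, hW] with n hn hWn
    exact noise_diag_moment_le hn (hQ n) (hD n) (he n) (hei n) (hind n) hq2.le hq3 hK (h0 n)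
      (fun i => (h2 n i).1) (fun i => (h2 n i).2) (fun i => (hq n i).1) (fun i => (hq n i).2) hC
      (fun i => (hWn i).1) (fun i => (hWn i).2) hlam (hB ▸ le_max_left _ _)
      (hB ▸ le_max_right _ _)

theorem ae_tendsto_noise_offDiag
    (hQ : ∀ n, Measurable (Q n)) (hD : ∀ n, Measurable (D n)) (he : ∀ n, Measurable (e n))
    (hei : ∀ n, IndepFun (e n) (fun ω => (Q n ω, D n ω)) P)
    (hind : ∀ n, iIndepFun (fun (i : Fin n) ω => e n ω i) P)
    (h4 : ∀ n i, Integrable (fun ω => e n ω i ^ 4) P) (h0 : ∀ n i, ∫ ω, e n ω i ∂P = 0) {K : ℝ}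
    (hK : 1 ≤ K) (hK4 : ∀ n i, ∫ ω, e n ω i ^ 4 ∂P ≤ K)
    (hC : 0 ≤ C) (hW : ∀ᶠ n in atTop, ∀ i, 0 ≤ W n i ∧ W n i ≤ C) (hlam : 0 < lam) :
    ∀ᵐ ω ∂P, Tendsto (fun n => ∑ i, ∑ j, if i = j then 0 else
      ((Q n ω : Matrix (Fin n) (Fin n) ℝ)ᵀ * Matrix.diagonal
      (padVec n (fun i : Fin (p n) => W n i / n * gainFactor (diagEntry (D n ω) i) lam ^ 2))
        * (Q n ω : Matrix (Fin n) (Fin n) ℝ)) i j * (e n ω i * e n ω j)) atTop (𝓝 0) := by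
  refine ae_tendsto_zero_of_fourth_moment_le
    (C := (32 * K ^ 2 * (C * (1 + 1 / lam) ^ 2) ^ 2) ^ 2) (fun n => ?_) ?_
  · refine Finset.measurable_fun_sum _ fun i _ => Finset.measurable_fun_sum _ fun j _ => ?_
    have h1 := Measurable.diag_conj_apply (hQ n) (measurable_noiseWeight (hD n) (W n) lam) i j
    have h2 : ∀ i, Measurable fun ω => e n ω i := fun i => (measurable_pi_apply i).comp (he n)
    split_ifs
    · exact measurable_const
    · exact h1.mul ((h2 i).mul (h2 j))
  · filter_upwards [eventually_gt_atTop 0, hW] with n hn hWn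
    exact noise_offDiag_moment_le hn (hQ n) (hD n) (he n) (hei n) (hind n) (h4 n) (h0 n) hK (hK4 n)
      hC (fun i => (hWn i).1) (fun i => (hWn i).2) hlam

/-- The empirical second moment of the noise converges. -/
theorem ae_tendsto_sqNorm_noise (he : ∀ n, Measurable (e n))
    (hind : ∀ n, iIndepFun (fun (i : Fin n) ω => e n ω i) P) {q K : ℝ} (hq2 : 2 < q) (hq3 : q ≤ 3)
    (hK : 0 ≤ K) (h0 : ∀ n i, ∫ ω, (e n ω i ^ 2 - s) ∂P = 0)
    (h2 : ∀ n i, Integrable (fun ω => (e n ω i ^ 2 - s) ^ 2) P ∧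
      ∫ ω, (e n ω i ^ 2 - s) ^ 2 ∂P ≤ K)
    (hq : ∀ n i, Integrable (fun ω => |e n ω i ^ 2 - s| ^ q) P ∧
      ∫ ω, |e n ω i ^ 2 - s| ^ q ∂P ≤ K) :
    ∀ᵐ ω ∂P, Tendsto (fun n => sqNorm (e n ω) / n) atTop (𝓝 s) := by
  have hm : ∀ n i, Measurable fun ω => e n ω i ^ 2 - s := fun n i => by
    have h2 : Measurable fun ω => e n ω i := (measurable_pi_apply i).comp (he n)
    exact (h2.pow_const 2).sub_const s
  -- A diagonal form with all weights equal to `1/n`, so `B = 1`.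
  have h : ∀ᵐ ω ∂P, Tendsto (fun n : ℕ => ∑ i, 1 / (n : ℝ) * (e n ω i ^ 2 - s)) atTop (𝓝 0) := by
    refine ae_tendsto_zero_of_rpow_moment_le (q := q) (s := q / 2)
      (C := 8 * (1 ^ q * K) * (2 + 1 ^ q * K)) (fun n => ?_) (by linarith) (by linarith) ?_
    · exact Finset.measurable_fun_sum _ fun i _ => (hm n i).const_mul _
    · filter_upwards [eventually_gt_atTop 0] with n hn
      exact lintegral_diag_form_le hn (Z := fun i ω => e n ω i ^ 2 - s) (hm n)
        ((hind n).comp (fun _ x => x ^ 2 - s) (fun _ => by fun_prop)) (h0 n) hq2.le hq3 hK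
        (fun i => (h2 n i).1) (fun i => (h2 n i).2) (fun i => (hq n i).1) (fun i => (hq n i).2)
        le_rfl (fun i => by rw [abs_of_nonneg (by positivity)])
  filter_upwards [h] with ω hω
  have h1 := hω.add_const s
  rw [zero_add] at h1
  refine h1.congr' ?_
  filter_upwards [eventually_gt_atTop 0] with n hn
  have hn0 : (n : ℝ) ≠ 0 := by exact_mod_cast hn.ne'
  rw [← Finset.mul_sum, Finset.sum_sub_distrib, Finset.sum_const, Finset.card_univ,
    Fintype.card_fin, nsmul_eq_mul, sqNorm]
  field_simp
  ring

/-- For a fixed penalty, the risk gap vanishes almost surely. -/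
theorem ae_tendsto_riskGap (hγ : 0 < γ)
    (hp : Tendsto (fun n => (p n : ℝ) / (n : ℝ)) atTop (𝓝 γ))
    (hQ : ∀ n, Measurable (Q n)) (hD : ∀ n, Measurable (D n)) (hO : ∀ n, Measurable (O n))
    (hb : ∀ n, Measurable (b n)) (he : ∀ n, Measurable (e n))
    (hHaar : ∀ n, IsHaarDistributed P (O n))
    (hOi : ∀ n, IndepFun (O n) (fun ω => (Q n ω, D n ω)) P)
    (hbi : ∀ n, IndepFun (b n) (fun ω => (Q n ω, D n ω, O n ω)) P)
    (hei : ∀ n, IndepFun (e n) (fun ω => (Q n ω, D n ω, O n ω, b n ω)) P)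
    (hr : ∀ᶠ n in atTop, ∀ᵐ ω ∂P, sqNorm (b n ω) = n * r ^ 2)
    (hind : ∀ n, iIndepFun (fun (i : Fin n) ω => e n ω i) P)
    (h0 : ∀ n i, ∫ ω, e n ω i ∂P = 0) (h0' : ∀ n i, ∫ ω, (e n ω i ^ 2 - s) ∂P = 0)
    {q K : ℝ} (hq2 : 2 < q) (hq3 : q ≤ 3) (hK : 1 ≤ K)
    (h4 : ∀ n i, Integrable (fun ω => e n ω i ^ 4) P ∧ ∫ ω, e n ω i ^ 4 ∂P ≤ K)
    (h2 : ∀ n i, Integrable (fun ω => (e n ω i ^ 2 - s) ^ 2) P ∧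
      ∫ ω, (e n ω i ^ 2 - s) ^ 2 ∂P ≤ K)
    (hq : ∀ n i, Integrable (fun ω => |e n ω i ^ 2 - s| ^ q) P ∧
      ∫ ω, |e n ω i ^ 2 - s| ^ q ∂P ≤ K) (Ja : Finset ℕ) (α : ℕ → ℝ)
    (hC : 0 ≤ C) (hW : ∀ᶠ n in atTop, ∀ i, 0 ≤ W n i ∧ W n i ≤ C) (hlam : 0 < lam) :
    ∀ᵐ ω ∂P, Tendsto (fun n => riskGap n (W n) (fun i => diagEntry (D n ω) i)
      (rotatedSignal n Ja α (O n ω) (b n ω))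
      (padVec (p n) ((Q n ω : Matrix (Fin n) (Fin n) ℝ) *ᵥ e n ω))
      (fun i => signalEnergy n Ja α r γ i) s lam) atTop (𝓝 0) := by
  have hbO : ∀ n, IndepFun (b n) (O n) P := fun n =>
    (hbi n).comp measurable_id (measurable_snd.comp measurable_snd)
  have heQ : ∀ n, IndepFun (e n) (fun ω => (Q n ω, D n ω)) P := fun n =>
    (hei n).comp measurable_id (measurable_fst.prodMk (measurable_fst.comp measurable_snd))
  have hcoord := ae_all_iff.mpr
    fun j => ae_tendsto_signal_coordinate (r := r) hγ hp hO hb hHaar hbO hr j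
  filter_upwards [ae_tendsto_signal_quadratic hγ hp hQ hD hO hb hHaar hOi hbi hr hW hlam, hcoord,
    ae_tendsto_cross_term hQ hD hO hb he hei hr hind (fun n i => (h4 n i).1) h0 hK
      (fun n i => (h4 n i).2) Ja α hW hlam,
    ae_tendsto_noise_diag hQ hD he heQ hind hq2 hq3 (by linarith) h0' h2 hq hC hW hlam,
    ae_tendsto_noise_offDiag hQ hD he heQ hind (fun n i => (h4 n i).1) h0 hK
      (fun n i => (h4 n i).2) hC hW hlam] with ω h1 h3 h5 h6 h7
  -- A coordinate of the rotated `b` has mean square `n r² / p`, whereas the formula is centred at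
  -- its limit `r² / γ`.
  have hcenter : Tendsto (fun n : ℕ => (n : ℝ) * r ^ 2 / p n - r ^ 2 / γ) atTop (𝓝 0) := by
    have h : Tendsto (fun n : ℕ => r ^ 2 / ((p n : ℝ) / n) - r ^ 2 / γ) atTop (𝓝 0) := by
      have := ((tendsto_const_nhds (x := r ^ 2)).div hp hγ.ne').sub_const (r ^ 2 / γ)
      rwa [sub_self] at this
    refine h.congr fun n => ?_
    rw [div_div_eq_mul_div, mul_comm]
  -- The prefactor has `p` summands of order `1/n`, hence stays bounded.
  have t2 : Tendsto (fun n => (∑ i, W n i / n * shrinkFactor (diagEntry (D n ω) i) lam ^ 2)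
      * ((n : ℝ) * r ^ 2 / p n - r ^ 2 / γ)) atTop (𝓝 0) := by
    refine squeeze_zero_norm' (a := fun n : ℕ => C * (1 + 1 / lam) ^ 2 * (2 * γ)
      * |(n : ℝ) * r ^ 2 / p n - r ^ 2 / γ|) ?_ ?_
    · filter_upwards [eventually_dim_pos hγ hp, hW] with n hn hWn
      have hn0 : (0 : ℝ) < n := by exact_mod_cast hn.1
      rw [Real.norm_eq_abs, abs_mul]
      refine mul_le_mul_of_nonneg_right ?_ (abs_nonneg _)
      refine (Finset.abs_sum_le_sum_abs _ _).trans ?_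
      calc ∑ i, |W n i / n * shrinkFactor (diagEntry (D n ω) i) lam ^ 2|
          ≤ ∑ _i : Fin (p n), C / n * (1 + 1 / lam) ^ 2 := by
            refine Finset.sum_le_sum fun i _ => ?_
            rw [abs_mul, abs_of_nonneg (div_nonneg (hWn i).1 hn0.le), abs_pow]
            have h2 := abs_shrinkFactor_le (D := diagEntry (D n ω) i) hlam le_rfl
            have h3 := (hWn i).2
            gcongr
        _ = C * (1 + 1 / lam) ^ 2 * ((p n : ℝ) / n) := by
            rw [Finset.sum_const, Finset.card_univ, Fintype.card_fin, nsmul_eq_mul]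
            ring
        _ ≤ _ := mul_le_mul_of_nonneg_left hn.2.2.2 (by positivity)
    · have := hcenter.abs.const_mul (C * (1 + 1 / lam) ^ 2 * (2 * γ))
      rwa [abs_zero, mul_zero] at this
  have t3 : Tendsto (fun n => ∑ i : Fin (p n), W n i / n
      * shrinkFactor (diagEntry (D n ω) i) lam ^ 2 * if (i : ℕ) ∈ Ja then 2 * Real.sqrt n * α i
        * ((O n ω : Matrix (Fin (p n)) (Fin (p n)) ℝ) *ᵥ b n ω) i else 0) atTop (𝓝 0) := by
    refine squeeze_zero_norm' (a := fun n : ℕ => ∑ j ∈ Ja, 2 * (C * (1 + 1 / lam) ^ 2) * |α j|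
      * |if h : j < p n then
        ((O n ω : Matrix (Fin (p n)) (Fin (p n)) ℝ) *ᵥ b n ω) ⟨j, h⟩ / Real.sqrt n else 0|) ?_ ?_
    · filter_upwards [eventually_gt_atTop 0, hW] with n hn hWn
      exact abs_alignment_term_le hC (fun i => (hWn i).1) (fun i => (hWn i).2) hlam hn
        (fun i => diagEntry (D n ω) i) Ja α _
    · have := tendsto_finsetSum Ja fun j _ =>
        (h3 j).abs.const_mul (2 * (C * (1 + 1 / lam) ^ 2) * |α j|)
      simpa only [abs_zero, mul_zero, Finset.sum_const_zero] using this
  have := (((h1.add t2).add t3).sub (h5.const_mul 2)).add (h6.add h7)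
  simp only [add_zero, mul_zero, sub_zero] at this
  exact this.congr fun n => (riskGap_eq (W n) (D n ω) (Q n ω) (O n ω) (b n ω) (e n ω) Ja α r γ s
    lam).symm

end AlmostSureLimits

/-! ### Uniformity in the penalty and conclusion. -/

theorem sum_signalEnergy_le (n k : ℕ) (Ja : Finset ℕ) (α : ℕ → ℝ) (r γ : ℝ) :
    ∑ i : Fin k, signalEnergy n Ja α r γ i ≤ k * (r ^ 2 / γ) + n * ∑ i ∈ Ja, α i ^ 2 := by
  unfold signalEnergy
  rw [Finset.sum_add_distrib, Finset.sum_const, Finset.card_univ, Fintype.card_fin, nsmul_eq_mul,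
    Finset.mul_sum]
  exact add_le_add le_rfl (sum_fin_ite_mem_le (g := fun i => n * α i ^ 2) Ja fun i => by positivity)

/-- The risk gap is eventually Lipschitz in the penalty, with a constant not depending on `n`. -/
theorem eventually_abs_riskGap_sub_le {p : ℕ → ℕ} {γ : ℝ} (hγ : 0 < γ)
    (hp : Tendsto (fun n => (p n : ℝ) / (n : ℝ)) atTop (𝓝 γ)) {Q : ∀ n, Orth n}
    {D : ∀ n, Fin (p n) → ℝ} {O : ∀ n, Orth (p n)} {b : ∀ n, Fin (p n) → ℝ}
    {e : ∀ n, Fin n → ℝ} {W : ∀ n, Fin (p n) → ℝ} {C r s c : ℝ} (Ja : Finset ℕ) (α : ℕ → ℝ)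
    (hC : 0 ≤ C) (hs : 0 ≤ s) (hc : 0 < c)
    (hr : ∀ᶠ n in atTop, sqNorm (b n) = n * r ^ 2)
    (he : Tendsto (fun n => sqNorm (e n) / n) atTop (𝓝 s))
    (hW : ∀ᶠ n in atTop, ∀ i, 0 ≤ W n i ∧ W n i ≤ C) :
    ∃ L : ℝ, ∀ᶠ n in atTop, ∀ x, c ≤ x → ∀ y, c ≤ y →
      |riskGap n (W n) (D n) (rotatedSignal n Ja α (O n) (b n))
        (padVec (p n) ((Q n : Matrix (Fin n) (Fin n) ℝ) *ᵥ e n))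
        (fun i => signalEnergy n Ja α r γ i) s x
      - riskGap n (W n) (D n) (rotatedSignal n Ja α (O n) (b n))
        (padVec (p n) ((Q n : Matrix (Fin n) (Fin n) ℝ) *ᵥ e n))
        (fun i => signalEnergy n Ja α r γ i) s y| ≤ L * |x - y| := by
  obtain ⟨A, hA⟩ : ∃ A, A = ∑ i ∈ Ja, α i ^ 2 := ⟨_, rfl⟩
  -- The four summands bound, after division by `n`, the signal energy, the noise energy (eventually
  -- below `s + 1`), the sum of the centrings, and `p s`, using `p / n ≤ 2 γ`.
  refine ⟨2 * (1 + 1 / c) ^ 3 * C * (2 * (2 * r ^ 2 + 2 * A) + 2 * (s + 1)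
    + (2 * γ * (r ^ 2 / γ) + A) + 2 * γ * s), ?_⟩
  filter_upwards [eventually_dim_pos hγ hp, hr, he.eventually_lt_const (lt_add_one s), hW]
    with n hn hrn hen hWn x hx y hy
  have hn0 : (0 : ℝ) < n := by exact_mod_cast hn.1
  refine (abs_riskGap_sub_le hc hx hy (fun i => (hWn i).1) (fun i => (hWn i).2) (fun i => ?_)
    hs).trans (mul_le_mul_of_nonneg_right (mul_le_mul_of_nonneg_left ?_ (by positivity))
      (abs_nonneg _))
  · unfold signalEnergy
    split_ifs <;> positivity
  · rw [div_le_iff₀ hn0]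
    have h1 := sqNorm_rotatedSignal_le (n := n) Ja α (O n) (b n)
    have h2 := sqNorm_padVec_le (n := p n) ((Q n : Matrix (Fin n) (Fin n) ℝ) *ᵥ e n)
    have h3 := sum_signalEnergy_le n (p n) Ja α r γ
    rw [hrn, ← hA] at h1
    rw [sqNorm_orth_mulVec] at h2
    rw [← hA] at h3
    rw [div_lt_iff₀ hn0] at hen
    have h4 : (p n : ℝ) ≤ 2 * γ * n := (div_le_iff₀ hn0).mp hn.2.2.2
    have h5 : (p n : ℝ) * (r ^ 2 / γ) ≤ 2 * γ * n * (r ^ 2 / γ) :=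
      mul_le_mul_of_nonneg_right h4 (by positivity)
    have h6 : (p n : ℝ) * s ≤ 2 * γ * n * s := mul_le_mul_of_nonneg_right h4 hs
    linarith

theorem Measurable.alignedSignal {τ : Type*} [MeasurableSpace τ] (n : ℕ) {k : ℕ} (J : Finset ℕ)
    (α : ℕ → ℝ) {b : τ → Fin k → ℝ} {O : τ → Orth k} (hb : Measurable b) (hO : Measurable O) :
    Measurable fun t => _root_.alignedSignal n J α (b t) (O t) := by
  unfold _root_.alignedSignal
  refine hb.add (Finset.measurable_fun_sum _ fun i _ => ?_)
  split_ifs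
  · have h1 : Measurable fun t => (O t : Matrix (Fin k) (Fin k) ℝ) := measurable_subtype_coe.comp hO
    have h2 : Measurable fun M : Matrix (Fin k) (Fin k) ℝ => M i :=
      measurable_pi_apply (X := fun _ : Fin k => Fin k → ℝ) i
    have h3 := h2.comp h1
    exact h3.const_smul (Real.sqrt n * α i)
  · exact measurable_const

theorem Measurable.response {τ : Type*} [MeasurableSpace τ] {m k : ℕ}
    {X : τ → Matrix (Fin m) (Fin k) ℝ} {b : τ → Fin k → ℝ} {e : τ → Fin m → ℝ}
    (hX : Measurable X) (hb : Measurable b) (he : Measurable e) :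
    Measurable fun t => _root_.response (X t) (b t) (e t) := by
  have h : Continuous fun z : Matrix (Fin m) (Fin k) ℝ × (Fin k → ℝ) × (Fin m → ℝ) =>
      _root_.response z.1 z.2.1 z.2.2 := by
    unfold _root_.response
    exact (continuous_fst.matrix_mulVec continuous_snd.fst).add continuous_snd.snd
  exact h.measurable.comp (hX.prodMk (hb.prodMk he))

theorem testSpec_nonneg {Ω : Type*} [MeasurableSpace Ω] (P : Measure Ω) {m k : ℕ}
    (Dt : Ω → Matrix (Fin m) (Fin k) ℝ) (i : ℕ) : 0 ≤ testSpec P Dt i := by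
  unfold testSpec
  split_ifs with h
  · refine integral_nonneg fun ω => ?_
    rw [Matrix.mul_apply]
    exact Finset.sum_nonneg fun j _ => mul_self_nonneg _
  · exact le_rfl

theorem eventually_subset_range {p : ℕ → ℕ} {γ : ℝ} (hγ : 0 < γ)
    (hp : Tendsto (fun n => (p n : ℝ) / (n : ℝ)) atTop (𝓝 γ)) (J : Finset ℕ) :
    ∀ᶠ n in atTop, J ⊆ Finset.range (p n) := by
  obtain ⟨M, hM⟩ := J.exists_nat_subset_range
  obtain ⟨N, hN⟩ := exists_nat_gt ((M : ℝ) / (γ / 2))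
  filter_upwards [eventually_dim_pos hγ hp, eventually_ge_atTop N] with n hn hNn
  refine hM.trans (Finset.range_subset_range.mpr ?_)
  have h1 : (M : ℝ) < γ / 2 * N := by
    rw [div_lt_iff₀ (by positivity)] at hN
    linarith
  have h2 : (N : ℝ) ≤ n := by exact_mod_cast hNn
  have h3 : (M : ℝ) ≤ p n := by nlinarith [hn.2.2.1]
  exact_mod_cast h3

/-- Conditional risk of the ridge estimator against its deterministic equivalent, for one sample
size. -/
theorem outOfSampleRisk_ridge_sub_formula {Ω : Type*} [MeasurableSpace Ω] (P : Measure Ω)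
    [IsProbabilityMeasure P] {n m k : ℕ} (hn : 0 < n) {Q : Ω → Orth n}
    {D : Ω → Matrix (Fin n) (Fin k) ℝ} {O : Ω → Orth k} {b : Ω → Fin k → ℝ} {e : Ω → Fin n → ℝ}
    (hQ : Measurable Q) (hDm : Measurable D) (hO : Measurable O) (hb : Measurable b)
    (he : Measurable e) (hD : ∀ ω, IsSingularValueMatrix (D ω)) (Ja : Finset ℕ) {Jc : Finset ℕ}
    (hJc : Jc ⊆ Finset.range k) (α : ℕ → ℝ) (r γ σ : ℝ) {Qt : Ω → Orth m}
    {Dt : Ω → Matrix (Fin m) (Fin k) ℝ} {Ot : Ω → Orth k} (hQt : Measurable Qt)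
    (hDt : Measurable Dt) (hOt : Measurable Ot) (hsv : ∀ ω, IsSingularValueMatrix (Dt ω))
    (hcoup : IsHaarCoupled P Jc O Ot (fun ω => (Q ω, D ω, O ω, b ω, e ω)))
    (hind : IndepFun (fun ω => (Qt ω, Dt ω)) (fun ω => ((Q ω, D ω, O ω, b ω, e ω), Ot ω)) P)
    (hint : ∀ i, Integrable (fun ω => ((Dt ω)ᵀ * Dt ω) i i) P)
    {X : Ω → Matrix (Fin n) (Fin k) ℝ} (hX : ∀ ω, X ω = design (Q ω) (D ω) (O ω))
    {β : Ω → Fin k → ℝ} (hβ : ∀ ω, β ω = alignedSignal n Ja α (b ω) (O ω))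
    {y : Ω → Fin n → ℝ} (hy : ∀ ω, y ω = response (X ω) (β ω) (e ω))
    {Xt : Ω → Matrix (Fin m) (Fin k) ℝ} (hXt : ∀ ω, Xt ω = design (Qt ω) (Dt ω) (Ot ω)) :
    ∀ᵐ ω ∂P, ∀ lam : ℝ, 0 < lam →
      outOfSampleRisk P Xt (fun ω' => (X ω', y ω', O ω', β ω')) (ridge (X ω) (y ω) lam) (β ω) ω
        - (biasFormula n m (D ω) Ja Jc α (testSpec P Dt) r γ lam
          + varFormula n m (D ω) Jc (testSpec P Dt) σ lam)
      = riskGap n (fun i : Fin k => (n : ℝ) / m * specWeight k Jc (testSpec P Dt) i)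
        (fun i => diagEntry (D ω) i) (rotatedSignal n Ja α (O ω) (b ω))
        (padVec k ((Q ω : Matrix (Fin n) (Fin n) ℝ) *ᵥ e ω))
        (fun i => signalEnergy n Ja α r γ i) (σ ^ 2) lam := by
  have h1 : Measurable fun t : Orth n × Matrix (Fin n) (Fin k) ℝ × Orth k × (Fin k → ℝ)
      × (Fin n → ℝ) => design t.1 t.2.1 t.2.2.1 :=
    measurable_design.comp (f := fun t : Orth n × Matrix (Fin n) (Fin k) ℝ × Orth k
      × (Fin k → ℝ) × (Fin n → ℝ) => ((t.1, t.2.1), t.2.2.1)) (by fun_prop)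
  have h2 : Measurable fun t : Orth n × Matrix (Fin n) (Fin k) ℝ × Orth k × (Fin k → ℝ)
      × (Fin n → ℝ) => alignedSignal n Ja α t.2.2.2.1 t.2.2.1 :=
    Measurable.alignedSignal n Ja α (by fun_prop) (by fun_prop)
  have h3 : Measurable fun t : Orth n × Matrix (Fin n) (Fin k) ℝ × Orth k × (Fin k → ℝ)
      × (Fin n → ℝ) => response (design t.1 t.2.1 t.2.2.1)
        (alignedSignal n Ja α t.2.2.2.1 t.2.2.1) t.2.2.2.2 :=
    Measurable.response h1 h2 (by fun_prop)
  have h4 : Measurable fun t : Orth n × Matrix (Fin n) (Fin k) ℝ × Orth k × (Fin k → ℝ)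
      × (Fin n → ℝ) => t.2.2.1 := by fun_prop
  have h5 : Measurable fun t : Matrix (Fin n) (Fin k) ℝ × (Fin n → ℝ) × Orth k
      × (Fin k → ℝ) => t.2.2.1 := by fun_prop
  -- The observed data are a measurable function of the full training tuple and still contain `O`,
  -- as the conditional law requires.
  have hS : ∀ ω, (X ω, y ω, O ω, β ω) = (design (Q ω) (D ω) (O ω),
      response (design (Q ω) (D ω) (O ω)) (alignedSignal n Ja α (b ω) (O ω)) (e ω), O ω,
      alignedSignal n Ja α (b ω) (O ω)) := fun ω => by rw [hy, hX, hβ]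
  -- The exceptional null set is independent of the vectors inserted, so one null set serves all
  -- penalties.
  have hrisk := outOfSampleRisk_ae_eq P hJc hOt
    (hQ.prodMk (hDm.prodMk (hO.prodMk (hb.prodMk he)))) hQt hDt
    (h1.prodMk (h3.prodMk (h4.prodMk h2))) h5 hS (fun ω => rfl) hind hcoup hsv hint hXt
  filter_upwards [hrisk] with ω hω lam hlam
  rw [hω, ← risk_sub_formula_eq_riskGap hn _ _ _ _ _ _ _ _ _ _ _ hlam]
  refine congrArg₂ _ (congrArg₂ _ rfl (Finset.sum_congr rfl fun i _ => ?_)) rfl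
  rw [hy, hX, orth_mulVec_ridge_sub (hD ω) _ _ hlam, hβ, orth_mulVec_alignedSignal]
  rfl

theorem mainTheorem6
    {Ω : Type*} [MeasurableSpace Ω] (P : Measure Ω) [IsProbabilityMeasure P]
    -- dimensions: `X_n` is `n × p n`, the test design is `n' n × p n`
    (p n' : ℕ → ℕ) (hn' : ∀ n, 0 < n' n)
    (γ : ℝ) (hγ : 0 < γ) (hp : Tendsto (fun n => (p n : ℝ) / (n : ℝ)) atTop (𝓝 γ))
    -- training design `X = Qᵀ D O`, with `O` Haar and independent of `(Q, D)`
    (Q : ∀ n, Ω → Orth n) (D : ∀ n, Ω → Matrix (Fin n) (Fin (p n)) ℝ) (O : ∀ n, Ω → Orth (p n))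
    (hQm : ∀ n, Measurable (Q n)) (hDm : ∀ n, Measurable (D n)) (hOm : ∀ n, Measurable (O n))
    (hD : ∀ n ω, IsSingularValueMatrix (D n ω))
    (hO : ∀ n, IsHaarDistributed P (O n))
    (hO_indep : ∀ n, IndepFun (O n) (fun ω => (Q n ω, D n ω)) P)
    -- bounded singular values
    (hDbdd : ∃ C : ℝ, ∀ᵐ ω ∂P, ∀ᶠ n in atTop, ∀ i j, D n ω i j ≤ C)
    -- the unaligned part of the signal, independent of the design
    (r : ℝ) (β' : ∀ n, Ω → Fin (p n) → ℝ) (hβm : ∀ n, Measurable (β' n))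
    (hβ_indep : ∀ n, IndepFun (β' n) (fun ω => (Q n ω, D n ω, O n ω)) P)
    (hβ_norm : ∀ᶠ n in atTop, ∀ᵐ ω ∂P, sqNorm (β' n ω) = n * r ^ 2)
    -- the noise, with independent entries, independent of everything else in the training set
    (σ : ℝ) (ε : ∀ n, Ω → Fin n → ℝ) (hεm : ∀ n, Measurable (ε n))
    (hε_indep : ∀ n, IndepFun (ε n) (fun ω => (Q n ω, D n ω, O n ω, β' n ω)) P)
    (hε_entries : ∀ n, iIndepFun (fun (i : Fin n) ω => ε n ω i) P)
    (hε_mean : ∀ n i, ∫ ω, ε n ω i ∂P = 0)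
    (hε_var : ∀ n i, ∫ ω, ε n ω i ^ 2 ∂P = σ ^ 2)
    (hε_mom : ∃ η : ℝ, 0 < η ∧ ∃ K : ℝ, ∀ n i,
      Integrable (fun ω => |ε n ω i| ^ (4 + η)) P ∧ ∫ ω, |ε n ω i| ^ (4 + η) ∂P ≤ K)
    -- aligned and coupled indices, alignment coefficients
    (Ja Jc : Finset ℕ) (α : ℕ → ℝ)
    -- test design `X̃ = Q̃ᵀ D̃ Õ`: given the training data, `Õ` is Haar conditioned on
    -- `õ_i = o_i` for `i ∈ Jc`, and `(Q̃, D̃)` is independent of all of this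
    (Qt : ∀ n, Ω → Orth (n' n)) (Dt : ∀ n, Ω → Matrix (Fin (n' n)) (Fin (p n)) ℝ)
    (Ot : ∀ n, Ω → Orth (p n))
    (hQtm : ∀ n, Measurable (Qt n)) (hDtm : ∀ n, Measurable (Dt n))
    (hOtm : ∀ n, Measurable (Ot n))
    (hDt : ∀ n ω, IsSingularValueMatrix (Dt n ω))
    (hOt : ∀ n, IsHaarCoupled P Jc (O n) (Ot n)
      (fun ω => (Q n ω, D n ω, O n ω, β' n ω, ε n ω)))
    (hQDt_indep : ∀ n, IndepFun (fun ω => (Qt n ω, Dt n ω))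
      (fun ω => ((Q n ω, D n ω, O n ω, β' n ω, ε n ω), Ot n ω)) P)
    -- the test spectrum has finite, suitably bounded expectation
    (hDt_int : ∀ n i, Integrable (fun ω => ((Dt n ω)ᵀ * Dt n ω) i i) P)
    (hDt_bdd : ∃ C : ℝ, ∀ᶠ n in atTop, ∀ i : Fin (p n),
      (n : ℝ) / (n' n : ℝ) * testSpec P (Dt n) i ≤ C)
    -- abbreviations: training design, signal, response, test design
    (X : ∀ n, Ω → Matrix (Fin n) (Fin (p n)) ℝ)
    (hX : ∀ n ω, X n ω = design (Q n ω) (D n ω) (O n ω))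
    (β : ∀ n, Ω → Fin (p n) → ℝ)
    (hβ : ∀ n ω, β n ω = alignedSignal n Ja α (β' n ω) (O n ω))
    (y : ∀ n, Ω → Fin n → ℝ)
    (hy : ∀ n ω, y n ω = response (X n ω) (β n ω) (ε n ω))
    (Xt : ∀ n, Ω → Matrix (Fin (n' n)) (Fin (p n)) ℝ)
    (hXt : ∀ n ω, Xt n ω = design (Qt n ω) (Dt n ω) (Ot n ω))
    (lam₁ lam₂ : ℝ) (hlam₁ : 0 < lam₁) (hlam₂ : lam₁ < lam₂) :
    ∀ᵐ ω ∂P, Tendsto (fun n => ⨆ lam ∈ Set.Icc lam₁ lam₂,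
      ‖outOfSampleRisk P (Xt n) (fun ω' => (X n ω', y n ω', O n ω', β n ω'))
          (ridge (X n ω) (y n ω) lam) (β n ω) ω
        - (biasFormula n (n' n) (D n ω) Ja Jc α (testSpec P (Dt n)) r γ lam
          + varFormula n (n' n) (D n ω) Jc (testSpec P (Dt n)) σ lam)‖ₑ)
      atTop (𝓝 0) := by
  obtain ⟨η, hη, K₀, hmom⟩ := hε_mom
  obtain ⟨C₀, hC₀⟩ := hDt_bdd
  -- This choice satisfies `2 < q ≤ 3` and `2 q ≤ 4 + η`.
  obtain ⟨q, hq⟩ : ∃ q, q = 2 + min η 2 / 2 := ⟨_, rfl⟩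
  have hm1 : min η 2 ≤ η := min_le_left _ _
  have hm2 : min η 2 ≤ 2 := min_le_right _ _
  have hm0 : 0 < min η 2 := lt_min hη two_pos
  obtain ⟨K, hKdef⟩ : ∃ K, K = 9 + 8 * max K₀ 0 + 8 * (σ ^ 2) ^ q := ⟨_, rfl⟩
  have hK : 1 ≤ K := by
    have h1 : 0 ≤ max K₀ 0 := le_max_right _ _
    have h2 : 0 ≤ (σ ^ 2) ^ q := Real.rpow_nonneg (sq_nonneg σ) q
    linarith
  have hεi : ∀ n i, Measurable fun ω => ε n ω i := fun n i => (measurable_pi_apply i).comp (hεm n)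
  have hmoments := fun n i => moments_of_moment_gt_four (P := P) (η := η) (K₀ := max K₀ 0) (q := q)
    (sq_nonneg σ) (by linarith) (by linarith) (by linarith) (hεi n i) (hmom n i).1
    ((hmom n i).2.trans (le_max_left _ _))
  rw [← hKdef] at hmoments
  have hcentred : ∀ n i, ∫ ω, (ε n ω i ^ 2 - σ ^ 2) ∂P = 0 := fun n i => by
    rw [integral_sub (integral_sq_le_of_fourth (hεi n i) (hmoments n i).1.1 hK
      (hmoments n i).1.2).1 (integrable_const _), hε_var]
    simp
  -- The factor `n / n'` puts the weights on the scale on which the test spectrum is assumed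
  -- bounded.
  obtain ⟨W, hWdef⟩ : ∃ W : ∀ n, Fin (p n) → ℝ, ∀ n, W n = fun i : Fin (p n) =>
    (n : ℝ) / n' n * specWeight (p n) Jc (testSpec P (Dt n)) i := ⟨_, fun _ => rfl⟩
  have hC : 0 ≤ max C₀ 0 := le_max_right _ _
  have hJc := eventually_subset_range hγ hp Jc
  have hW : ∀ᶠ n in atTop, ∀ i, 0 ≤ W n i ∧ W n i ≤ max C₀ 0 := by
    filter_upwards [hC₀, hJc] with n hn hJn i
    rw [hWdef]
    exact specWeight_scaled_bounds hJn (fun j hj =>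
      ⟨mul_nonneg (by positivity) (testSpec_nonneg P (Dt n) j), (hn ⟨j, hj⟩).trans (le_max_left _ _)⟩) i
  have hpoint := fun (lam : ℝ) (hlam : 0 < lam) => ae_tendsto_riskGap hγ hp hQm hDm hOm hβm hεm hO
    hO_indep hβ_indep hε_indep hβ_norm hε_entries hε_mean hcentred (by linarith) (by linarith) hK
    (fun n i => (hmoments n i).1) (fun n i => (hmoments n i).2.1) (fun n i => (hmoments n i).2.2)
    Ja α hC hW hlam
  have hgridpos : ∀ N j : ℕ, 0 < lam₁ + (lam₂ - lam₁) * (j / (N + 1)) := fun N j => by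
    have : 0 < lam₂ - lam₁ := sub_pos.mpr hlam₂
    positivity
  -- The grid points over all meshes are countable, so their null sets can be united.
  have hgrid := ae_all_iff.mpr fun N : ℕ => ae_all_iff.mpr fun j : ℕ => hpoint _ (hgridpos N j)
  have hnoise := ae_tendsto_sqNorm_noise hεm hε_entries (by linarith) (by linarith)
    (zero_le_one.trans hK) hcentred (fun n i => (hmoments n i).2.1) (fun n i => (hmoments n i).2.2)
  have hnorm : ∀ᵐ ω ∂P, ∀ᶠ n in atTop, sqNorm (β' n ω) = n * r ^ 2 := by
    obtain ⟨N, hN⟩ := eventually_atTop.mp hβ_norm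
    have := ae_all_iff.mpr fun n => ae_all_iff.mpr fun h : N ≤ n => hN n h
    filter_upwards [this] with ω hω
    exact eventually_atTop.mpr ⟨N, fun n hn => hω n hn⟩
  have hrisk := ae_all_iff.mpr fun n => ae_all_iff.mpr fun hn : 0 < n =>
    ae_all_iff.mpr fun hJn : Jc ⊆ Finset.range (p n) =>
      outOfSampleRisk_ridge_sub_formula P hn (hQm n) (hDm n) (hOm n) (hβm n) (hεm n) (hD n) Ja hJn α
        r γ σ (hQtm n) (hDtm n) (hOtm n) (hDt n) (hOt n) (hQDt_indep n) (hDt_int n) (hX n) (hβ n)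
        (hy n) (hXt n)
  filter_upwards [hgrid, hnoise, hnorm, hrisk] with ω hω1 hω2 hω3 hω4
  obtain ⟨L, hL⟩ := eventually_abs_riskGap_sub_le hγ hp (Q := fun n => Q n ω)
    (D := fun n i => diagEntry (D n ω) i) (O := fun n => O n ω) Ja α hC (sq_nonneg σ) hlam₁ hω3
    hω2 hW
  refine (tendsto_iSup_enorm_of_grid hlam₂ (fun N j _ => hω1 N j) (hL.mono fun n h x hx y hy =>
    h x hx.1 y hy.1)).congr' ?_
  filter_upwards [eventually_gt_atTop 0, hJc] with n hn hJn
  refine iSup_congr fun lam => iSup_congr fun hlam => ?_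
  rw [hω4 n hn hJn lam (hlam₁.trans_le hlam.1), hWdef]
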